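/- Let $k$ be an algebraically closed field of arbitrary characteristic, let $M$ be a normal projective variety over $k$ with $\dim M\ge 2$, and let $f\in\mathrm{Bir}(M)$ be a birational automorphism of $M$ over $k$. Definitions. For a dominant rational map $\varphi:M\dashrightarrow B$ over $k$ to a normal projective variety $B$, let $\Gamma_\varphi\subset M\times_k B$ be the closure of the graph of $\varphi$ on its domain of definition, with projections $p_1,p_2$, and for $b\in B(k)$ put $F_b=p_1(p_2^{-1}(b))$. The map $\varphi$ is a *rational fibration* if $F_b$ is connected for all $b\in U(k)$, for some non-empty open $U\subset B$; it is *non-trivial* if $0<\dim B<\dim M$. The birational automorphism $f$ is *imprimitive* if there are a non-trivial rational fibration $\varphi:M\dashrightarrow B$ and a rational map $f_B:B\dashrightarrow B$ over $k$ with $\varphi\circ f=f_B\circ\varphi$; otherwise $f$ is *primitive*. $\mathrm{Pic}(M)$ is the Picard group, i.e. the group of Cartier divisors modulo principal divisors; for $L=\mathcal O_M(D)$, $|L|$ is the set of effective Cartier divisors linearly equivalent to $D$, identified with the projective space of lines in $H^0(M,\mathcal O_M(D))$, so that $\dim|L|=\dim_k H^0(M,\mathcal O_M(D))-1$. For Cartier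 divisors $D,D'$ on $M$ we write $f^*D=D'$ if on the domain of definition of $f$ (whose complement has codimension $\ge 2$) $D'$ is the pull-back of $D$ under the morphism $f$; by normality $D'$ is then unique. We say that $f$ is *isomorphic in codimension one* if it restricts to an isomorphism $M\setminus V\to M\setminus W$ with $V,W\subset M$ closed, possibly empty, of codimension $\ge 2$. $M$ is *factorial* if all its local rings are unique factorization domains. Then: 1. If there is $L\in\mathrm{Pic}(M)$ with $\dim|L|\ge 1$ such that $f^*:|L|\to|L|$ is a well-defined projective automorphism (i.e. $f^*E$ exists and lies in $|L|$ for every $E\in|L|$, and $E\mapsto f^*E$ is a bijection of $|L|$ induced by a $k$-linear automorphism of $H^0(M,L)$), then $f$ is not primitive. 2. Assume that either $f\in\mathrm{Aut}(M)$, or $M$ is factorial and $f$ is isomorphic in codimension one. Then every Cartier divisor $D$ on $M$ has a pull-back $f^*D$, and $[D]\mapsto[f^*D]$ is a well-defined automorphism $f^*$ of the group $\mathrm{Pic}(M)$. If moreover $f^*\in\mathrm{Aut}(\mathrm{Pic}(M))$ is of finite order, then $f$ is not primitive. 3. If $f$ is of finite order in $\mathrm{Bir}(M)$, then $f$ is not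 primitive. -/

import Mathlib

universe u

open CategoryTheory AlgebraicGeometry

noncomputable section

namespace PrimBir

/-! ### Normal projective varieties over a field -/

attribute [local instance] MvPolynomial.gradedAlgebra

/-- The projective space `ℙⁿ` over `k`, as `Proj k[x₀, …, xₙ]`. -/
abbrev projSpace (k : Type u) [Field k] (n : ℕ) : Scheme.{u} :=
  Proj (MvPolynomial.homogeneousSubmodule (Fin (n + 1)) k)

/-- The structure morphism `ℙⁿ ⟶ Spec k`. -/
def projSpaceStr (k : Type u) [Field k] (n : ℕ) : projSpace k n ⟶ Spec (.of k) :=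
  Proj.toSpecZero (MvPolynomial.homogeneousSubmodule (Fin (n + 1)) k) ≫
    Spec.map (CommRingCat.ofHom
      (algebraMap k (MvPolynomial.homogeneousSubmodule (Fin (n + 1)) k 0)))

/-- A normal projective variety over `k`: an integral scheme, all of whose local rings are
integrally closed, with a closed immersion over `k` into some projective space. -/
structure NormalProjVariety (k : Type u) [Field k] where
  X : Scheme.{u}
  str : X ⟶ Spec (.of k)
  isIntegral : IsIntegral X
  normal : ∀ x : X, IsIntegrallyClosed (X.presheaf.stalk x)
  projective : ∃ (n : ℕ) (i : X ⟶ projSpace k n),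
    IsClosedImmersion i ∧ i ≫ projSpaceStr k n = str

namespace NormalProjVariety

variable {k : Type u} [Field k] (M : NormalProjVariety k)

instance : IsIntegral M.X := M.isIntegral

instance : M.X.Over (Spec (.of k)) := ⟨M.str⟩

instance : M.X.IsSeparated := by
  obtain ⟨n, i, hi, -⟩ := M.projective
  constructor
  rw [← Limits.terminal.comp_from i]
  infer_instance

/-- The dimension of `M`. -/
def dim : WithBot ℕ∞ := topologicalKrullDim M.X

/-- `M` is factorial: all its local rings are unique factorization domains. -/
def IsFactorial : Prop := ∀ x : M.X, UniqueFactorizationMonoid (M.X.presheaf.stalk x)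

/-- The closed complement of the open `U` has codimension `≥ 2` in `M` (it may be empty). -/
def CodimComplGeTwo (U : M.X.Opens) : Prop :=
  ∀ x : M.X, x ∉ U → 2 ≤ ringKrullDim (M.X.presheaf.stalk x)

/-- The field of rational functions on `M`. -/
def K : Type u := M.X.functionField

instance : Field M.K := inferInstanceAs (Field M.X.functionField)

/-- The embedding of the local ring at `x` into the function field. -/
def toK (x : M.X) : M.X.presheaf.stalk x →+* M.K :=
  (algebraMap (M.X.presheaf.stalk x) M.X.functionField : _)

/-- The local ring `O_x` at `x`, as a subring of the function field. -/
def localRing (x : M.X) : Subring M.K := (M.toK x).range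

/-- The germ at `x` of a constant. -/
def constGerm (x : M.X) : k →+* M.X.presheaf.stalk x :=
  (M.X.presheaf.germ ⊤ x (TopologicalSpace.Opens.mem_top x)).hom.comp
    (M.str.appTop.hom.comp (Scheme.ΓSpecIso (.of k)).inv.hom)

/-- Constants as rational functions. -/
instance : Algebra k M.K := ((M.toK (genericPoint M.X)).comp (M.constGerm _)).toAlgebra

lemma algebraMap_mem_localRing (c : k) (x : M.X) : algebraMap k M.K c ∈ M.localRing x := by
  have : Nonempty (⊤ : M.X.Opens) := ⟨⟨x, TopologicalSpace.Opens.mem_top _⟩⟩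
  refine ⟨M.constGerm x c, ?_⟩
  exact (Scheme.algebraMap_germ_eq_germToFunctionField _ (TopologicalSpace.Opens.mem_top x) _).trans
    (Scheme.algebraMap_germ_eq_germToFunctionField _ (TopologicalSpace.Opens.mem_top _) _).symm

end NormalProjVariety

/-! ### Rational fibrations and primitive birational automorphisms -/

section Fibrations

variable {k : Type u} [Field k] {M B : NormalProjVariety k}

/-- The graph of the morphism `φ : dom φ ⟶ B`, as a morphism `dom φ ⟶ M ×ₖ B`. -/
def graphMor (φ : M.X ⤏ B.X) [φ.IsOver (Spec (.of k))] :
    φ.toPartialMap.domain.toScheme ⟶ Limits.pullback M.str B.str :=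
  Limits.pullback.lift φ.toPartialMap.domain.ι φ.toPartialMap.hom
    (by
      have h : φ.toPartialMap.IsOver (Spec (.of k)) := inferInstance
      exact ((Scheme.PartialMap.isOver_iff (S := Spec (.of k))).mp h).symm)

/-- The graph `Γ_φ ⊆ M ×ₖ B`: the closure of the graph of `φ` on its domain of definition. -/
def graphClosure (φ : M.X ⤏ B.X) [φ.IsOver (Spec (.of k))] :
    Set ↥(Limits.pullback M.str B.str) :=
  closure (Set.range (graphMor φ))

/-- The fibre `F_b = p₁ (p₂⁻¹ (b)) ⊆ M` of `φ` over `b`, with `p₁`, `p₂` the two projections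
of `Γ_φ`. -/
def fiber (φ : M.X ⤏ B.X) [φ.IsOver (Spec (.of k))] (b : B.X) : Set M.X :=
  {x | ∃ z ∈ graphClosure φ,
    Limits.pullback.fst M.str B.str z = x ∧ Limits.pullback.snd M.str B.str z = b}

/-- The fibre of `φ` over a general closed point is connected. (For dominant `φ` over `k` this
is the definition of a rational fibration.) -/
def HasConnectedGeneralFiber (φ : M.X ⤏ B.X) [φ.IsOver (Spec (.of k))] : Prop :=
  ∃ U : B.X.Opens, (U : Set B.X).Nonempty ∧
    ∀ b ∈ U, IsClosed ({b} : Set B.X) → _root_.IsConnected (fiber φ b)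

end Fibrations

section Bir

variable {k : Type u} [Field k]

/-- `Bir(M)`: the birational automorphisms of `M` over `k`, i.e. the rational maps `M ⤏ M`
given by a `k`-isomorphism between two dense open subschemes of `M`. -/
structure Bir (M : NormalProjVariety k) where
  map : M.X ⤏ M.X
  exists_partialIso : ∃ e : M.X.PartialIso M.X, e.IsOver M.str M.str ∧ e.toRationalMap = map

namespace Bir

variable {M : NormalProjVariety k} (f : Bir M)

instance : f.map.IsDominant := by
  obtain ⟨e, -, he⟩ := f.exists_partialIso
  rw [← he, Scheme.PartialMap.isDominant_toRationalMap_iff]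
  have := Opens.isDominant_ι e.dense_target
  dsimp only [Scheme.PartialIso.toPartialMap]
  infer_instance

/-- The iterates of `f`, as rational maps. -/
def iterate : ℕ → (M.X ⤏ M.X)
  | 0 => Scheme.RationalMap.id M.X
  | n + 1 => f.map.comp (iterate n)

/-- `f` has finite order in `Bir(M)`. -/
def HasFiniteOrder : Prop := ∃ n : ℕ, 0 < n ∧ f.iterate n = Scheme.RationalMap.id M.X

/-- `f` is imprimitive: there are a normal projective variety `B` with `0 < dim B < dim M`, a
dominant rational map `φ : M ⤏ B` with connected general fibre, and a rational map
`f_B : B ⤏ B` such that `φ ∘ f = f_B ∘ φ`. (Here `g.comp h` is "first `g`, then `h`".) -/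
def IsImprimitive : Prop :=
  ∃ (B : NormalProjVariety k) (φ : M.X ⤏ B.X) (_ : φ.IsDominant)
    (_ : φ.IsOver (Spec (.of k))) (fB : B.X ⤏ B.X) (_ : fB.IsOver (Spec (.of k))),
    HasConnectedGeneralFiber φ ∧ 0 < B.dim ∧ B.dim < M.dim ∧ f.map.comp φ = φ.comp fB

def IsPrimitive : Prop := ¬ f.IsImprimitive

/-- `f ∈ Aut(M)`. -/
def IsRegular : Prop :=
  ∃ g : M.X ≅ M.X, g.hom ≫ M.str = M.str ∧ g.hom.toRationalMap = f.map

/-- `f` is isomorphic in codimension one: it restricts to an isomorphism `M ∖ V ≅ M ∖ W` with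
`V`, `W` closed of codimension `≥ 2`. -/
def IsIsoInCodimOne : Prop :=
  ∃ e : M.X.PartialIso M.X, e.IsOver M.str M.str ∧ e.toRationalMap = f.map ∧
    M.CodimComplGeTwo e.source ∧ M.CodimComplGeTwo e.target

end Bir

end Bir

/-! ### Cartier divisors, the Picard group, complete linear systems

The group of Cartier divisors is `Γ(M, K*/O*)`, and it is written multiplicatively below: `D * E`
is the divisor `D + E`. The Picard group of the (integral) scheme `M` is the group of Cartier
divisors modulo principal divisors. -/

section Divisors

variable {k : Type u} [Field k] (M : NormalProjVariety k)

/-- The units of the local ring at `x`, inside the units of the function field. -/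
def localUnits (x : M.X) : Subgroup M.Kˣ :=
  (M.localRing x).toSubmonoid.units

/-- The stalk `K*/O_x*`. -/
def DivisorGerm (x : M.X) : Type u := M.Kˣ ⧸ localUnits M x

instance (x : M.X) : CommGroup (DivisorGerm M x) :=
  QuotientGroup.Quotient.commGroup (localUnits M x)

/-- The class in `K*/O_x*` of a nonzero rational function. -/
def germClass (x : M.X) : M.Kˣ →* DivisorGerm M x := QuotientGroup.mk' (localUnits M x)

/-- Cartier divisors: global sections of the sheaf `K*/O*`, i.e. families of elements of
`K*/O_x*`, one for each point `x`, that are locally given by one rational function. -/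
def CartierDivisor : Subgroup ((x : M.X) → DivisorGerm M x) where
  carrier := {D | ∀ x, ∃ V : M.X.Opens, x ∈ V ∧ ∃ d : M.Kˣ, ∀ y ∈ V, D y = germClass M y d}
  one_mem' := fun x ↦ ⟨⊤, trivial, 1, fun _ _ ↦ (map_one _).symm⟩
  mul_mem' := by
    intro D E hD hE x
    obtain ⟨V, hV, d, hd⟩ := hD x
    obtain ⟨W, hW, e, he⟩ := hE x
    refine ⟨V ⊓ W, ⟨hV, hW⟩, d * e, fun y hy ↦ ?_⟩
    rw [Pi.mul_apply, hd y hy.1, he y hy.2, map_mul]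
  inv_mem' := by
    intro D hD x
    obtain ⟨V, hV, d, hd⟩ := hD x
    refine ⟨V, hV, d⁻¹, fun y hy ↦ ?_⟩
    rw [Pi.inv_apply, hd y hy, map_inv]

variable {M}

/-- `d` is a local equation of `D` at `x`. -/
def IsLocalEquation (D : CartierDivisor M) (x : M.X) (d : M.Kˣ) : Prop :=
  D.1 x = germClass M x d

/-- `D` is effective: its local equations are regular. -/
def IsEffective (D : CartierDivisor M) : Prop :=
  ∀ (x : M.X) (d : M.Kˣ), IsLocalEquation D x d →
    (d : M.K) ∈ M.localRing x

variable (M) in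
/-- The principal divisor of a nonzero rational function. -/
def principal : M.Kˣ →* CartierDivisor M where
  toFun h := ⟨fun x ↦ germClass M x h, fun _ ↦ ⟨⊤, trivial, h, fun _ _ ↦ rfl⟩⟩
  map_one' := Subtype.ext (funext fun x ↦ map_one (germClass M x))
  map_mul' g h := Subtype.ext (funext fun x ↦ map_mul (germClass M x) g h)

variable (M) in
/-- The Picard group of `M`. -/
abbrev Pic : Type u := CartierDivisor M ⧸ (principal M).range

instance : CommGroup (Pic M) := QuotientGroup.Quotient.commGroup (principal M).range

/-- The complete linear system `|L|`: the effective Cartier divisors in the class `L`. -/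
def completeLinearSystem (L : Pic M) : Set (CartierDivisor M) :=
  {E | IsEffective E ∧ (E : Pic M) = L}

/-- The `k`-vector space `H⁰(M, O(D))` of the rational functions `h` such that `h = 0` or
`div h + D` is effective. So `|D|` is the projective space of lines in `H⁰(M, O(D))`, through
`h ↦ div h + D`. -/
def globalSections (D : CartierDivisor M) : Submodule k M.K where
  carrier := {h | ∀ (x : M.X) (d : M.Kˣ), IsLocalEquation D x d →
    h * (d : M.K) ∈ M.localRing x}
  zero_mem' := fun x d _ ↦ by simpa only [zero_mul] using zero_mem _
  add_mem' := fun {a b} ha hb x d hd ↦ by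
    simpa only [add_mul] using add_mem (ha x d hd) (hb x d hd)
  smul_mem' := fun c h hh x d hd ↦ by
    rw [Algebra.smul_def, mul_assoc]
    exact mul_mem (M.algebraMap_mem_localRing c x) (hh x d hd)

/-- `dim |D| ≥ 1`, i.e. `dim H⁰(M, O(D)) ≥ 2`. -/
def LinearSystemDimGeOne (D : CartierDivisor M) : Prop :=
  2 ≤ Module.rank k (globalSections D)

/-- The homomorphism of local rings `O_{M, f(x)} → O_{M, x}` given by a rational map `f`, at a
point `x` of its domain of definition. -/
def localPullback (f : M.X ⤏ M.X) (x : f.toPartialMap.domain) :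
    M.X.presheaf.stalk (f.toPartialMap.hom x) →+* M.X.presheaf.stalk x.1 :=
  ((f.toPartialMap.domain.stalkIso x).hom.hom).comp (f.toPartialMap.hom.stalkMap x).hom

/-- `f^* D = D'`. On the domain of definition `U` of `f`, whose complement has codimension
`≥ 2`, the local equations of `D'` are the pull-backs of those of `D` under `f : U → M`, up to
units: if `D` has the local equation `a / b` at `f(x)`, then `D'` has the local equation
`f^*(a) / f^*(b)` at `x`. As `M` is normal, `D'` is determined by `D`. -/
def Bir.IsPullback (f : Bir M) (D D' : CartierDivisor M) : Prop :=
  ∀ (x : f.map.toPartialMap.domain) (d d' : M.Kˣ)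
    (a b : M.X.presheaf.stalk (f.map.toPartialMap.hom x)),
    IsLocalEquation D (f.map.toPartialMap.hom x) d → IsLocalEquation D' x.1 d' → b ≠ 0 →
    (d : M.K) * M.toK _ b = M.toK _ a →
    ∃ u ∈ localUnits M x.1,
      (d' : M.K) * M.toK x.1 (localPullback f.map x b) =
        M.toK x.1 (localPullback f.map x a) * (u : M.K)

/-- `f^* : |D| → |D|` is a well-defined projective automorphism: `E ↦ f^* E` is a bijection of
`|D|` to itself, induced by a `k`-linear automorphism of `H⁰(M, O(D))`. -/
def Bir.ActsOnLinearSystem (f : Bir M) (D : CartierDivisor M) : Prop :=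
  ∃ F : completeLinearSystem (D : Pic M) ≃ completeLinearSystem (D : Pic M),
    (∀ E, f.IsPullback E.1 (F E).1) ∧
    ∃ A : globalSections D ≃ₗ[k] globalSections D,
      ∀ (E : completeLinearSystem (D : Pic M)) (h : M.Kˣ) (hh : (h : M.K) ∈ globalSections D),
        E.1 = D * principal M h →
        ∃ h' : M.Kˣ, (h' : M.K) = A ⟨h, hh⟩ ∧ (F E).1 = D * principal M h'

/-- `α` is the automorphism `f^*` of the Picard group: every Cartier divisor `D` has a pull-back
`f^* D`, and `α` maps the class of `D` to the class of `f^* D`. -/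
def Bir.IsPicPullback (f : Bir M) (α : MulAut (Pic M)) : Prop :=
  ∀ D : CartierDivisor M, ∃ D' : CartierDivisor M,
    f.IsPullback D D' ∧ α (D : Pic M) = (D' : Pic M)

end Divisors

end PrimBir

end

set_option linter.unusedSectionVars false

/-! ### Geometric irreducibility of polynomials -/

section GeometricIrreducibility

open Polynomial TensorProduct

variable {F E : Type*} [Field F] [Field E] [Algebra F E]

/-! Let `K` be the function field of `M` and `τ` the pull-back by `f` on `K`. All three statements
reduce to one criterion, `isImprimitive_of_pullbackK_mem_adjoin`: if some non-constant `x` in `K`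
satisfies `τ x ∈ k(x)`, then `f` is imprimitive. Indeed the algebraic closure `L` of `k(x)` in `K`
is finitely generated, of transcendence degree one and stable under `τ`. It is the function field of
a normal projective curve `B` (`exists_curve`), the inclusion `L ⊆ K` is a dominant rational map `φ
: M ⤏ B`, and the restriction of `τ` to `L` is a rational self-map of `B`. The square commutes
because it does so on function fields, and `0 < dim B ≤ 1 < dim M`.

Such an `x` comes from linear algebra in the first two statements. Suppose an injective operator `A`
on a space of sections of finite dimension at least two satisfies `A t / A s = c τ(t / s)` with
constants `c`. Triangularising `A` gives an eigenvector `s` and some `t ∉ k s` with `A t = m t + b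
s`, so `τ` sends `x = t / s` to an affine function of `x` (`exists_map_eq_affine`). For a linear
system preserved by `f` the operator is part of the data, and `c` is constant because it is a unit
at every point of codimension at most one. For `f^*` of finite order on the Picard group, the sum
`D` of the pull-backs of a hyperplane section over one period satisfies `f^* D = D + div g`, and `s
↦ g τ(s)` acts on the sections of `D`. For `f` of finite order, the coefficients of `∏ (X - τ^i z)`
are invariant, and they are not all constant when `z` is not.

The delicate point is the connectedness of the general fibre, since in positive characteristic `K`
need not be separable over `L`. However, `K` is purely inseparable over `L(t)(y)`, with `t` a
transcendence basis and `y` separable over `L(t)`. As `L` is algebraically closed in `K`, the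
minimal polynomial of `y` stays irreducible over every finite extension of `L`
(`eq_one_of_mul_eq_map_minpoly`), hence modulo almost all maximal ideals of an affine chart of `B`
(Bertini–Noether, `exists_forall_irreducible_map`). So over a general closed point the fibre of a
suitable dense open `W ⊆ M` has a generic point (`exists_generic_point_of_fiber`). By Krull's
principal ideal theorem, for almost all points of the curve the fibre of the closed graph is the
closure of its part over `W` (`exists_finite_forall_exists_specializes`). It is therefore
irreducible, and its image in `M` is connected. -/

theorem Polynomial.irreducible_map_of_algebraicallyClosedIn
    (hcl : ∀ x : E, IsAlgebraic F x → x ∈ (algebraMap F E).range) {m : F[X]} (hm : m.Monic)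
    (hirr : Irreducible m) : Irreducible (m.map (algebraMap F E)) := by
  have key : ∀ f : E[X], f.Monic → f ∣ m.map (algebraMap F E) →
      ∃ f₀ : F[X], f₀.map (algebraMap F E) = f ∧ f₀.Monic := by
    intro f hf hd
    -- The coefficients of a monic factor are integral over `F`, hence algebraic, hence in `F`; so a
    -- factorisation over `E` is already one over `F`.
    have h := integralClosure.mem_lifts_of_monic_of_dvd_map E hm hf hd
    have h' : f ∈ lifts (algebraMap F E) := by
      rw [lifts_iff_coeff_lifts] at h ⊢
      intro n
      obtain ⟨c, hc⟩ := h n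
      rw [← hc]
      exact hcl _ (isAlgebraic_iff_isIntegral.mpr c.2)
    obtain ⟨q, hq, -, hq'⟩ := lifts_and_natDegree_eq_and_monic h' hf
    exact ⟨q, hq, hq'⟩
  have h1 : m.map (algebraMap F E) ≠ 1 := by
    intro h
    exact hirr.ne_one (map_injective _ (algebraMap F E).injective (by simpa using h))
  rw [irreducible_of_monic (hm.map _) h1]
  intro f g hf hg hfg
  obtain ⟨f₀, rfl, hf₀⟩ := key f hf ⟨g, hfg.symm⟩
  obtain ⟨g₀, rfl, hg₀⟩ := key g hg ⟨_, by rw [mul_comm]; exact hfg.symm⟩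
  rw [← Polynomial.map_mul] at hfg
  have hfg' := map_injective _ (algebraMap F E).injective hfg
  rcases (irreducible_of_monic hm hirr.ne_one).mp hirr f₀ g₀ hf₀ hg₀ hfg' with h | h
  · left; simp [h]
  · right; simp [h]

/-- By the primitive element theorem `F₁ = F[X]/(m)`, so the tensor product is `E[X]/(m)`, and `m`
stays prime over `E`. -/
theorem isDomain_tensorProduct_of_algebraicallyClosedIn
    (hcl : ∀ x : E, IsAlgebraic F x → x ∈ (algebraMap F E).range)
    (F₁ : Type*) [Field F₁] [Algebra F F₁] [FiniteDimensional F F₁] [Algebra.IsSeparable F F₁] :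
    IsDomain (E ⊗[F] F₁) := by
  let pb := Field.powerBasisOfFiniteOfSeparable F F₁
  let m := minpoly F pb.gen
  have hint : IsIntegral F pb.gen := Algebra.IsIntegral.isIntegral _
  have hirr := Polynomial.irreducible_map_of_algebraicallyClosedIn hcl
    (minpoly.monic hint) (minpoly.irreducible hint)
  let e₀ : AdjoinRoot m ≃ₐ[F] F₁ := AdjoinRoot.equiv' m pb (by simp [m]) (by simp [m])
  -- `AdjoinRoot.tensorAlgEquiv` has its polynomial over `E ⊗[F] F`; the isomorphism `r` carries
  -- primality over from `E`.
  let q : (E ⊗[F] F)[X] := m.map Algebra.TensorProduct.includeRight.toRingHom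
  let r : (E ⊗[F] F) ≃+* E := (Algebra.TensorProduct.rid F F E).toRingEquiv
  have hq : (Polynomial.mapEquiv r) q = m.map (algebraMap F E) := by
    simp only [q, Polynomial.mapEquiv_apply, Polynomial.map_map]
    congr 1
    ext x
    simp [r, Algebra.algebraMap_eq_smul_one]
  have hqp : Prime q := by
    have : Prime ((Polynomial.mapEquiv r) q) := hq ▸ hirr.prime
    refine comap_prime (Polynomial.mapRingHom r.toRingHom) (Polynomial.mapRingHom r.symm.toRingHom)
      (fun a ↦ ?_) this
    simp [Polynomial.map_map]
  have := AdjoinRoot.isDomain_of_prime hqp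
  let e₁ : E ⊗[F] AdjoinRoot m ≃ₐ[E] AdjoinRoot q := AdjoinRoot.tensorAlgEquiv m q rfl
  let e₂ : E ⊗[F] AdjoinRoot m ≃ₐ[E] E ⊗[F] F₁ := Algebra.TensorProduct.congr AlgEquiv.refl e₀
  exact MulEquiv.isDomain (AdjoinRoot q) (e₂.symm.trans e₁).toMulEquiv

variable {σ : Type*} [Algebra (MvPolynomial σ F) E] [IsScalarTower F (MvPolynomial σ F) E]

/-- Applying a linear functional to the coefficients of a polynomial over an extension field. -/
theorem exists_coeff_functional {F₁ : Type*} [Field F₁] [Algebra F F₁] (l : F₁ →ₗ[F] F) (y : E)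
    (Θ : (MvPolynomial σ F₁)[X] →+* E ⊗[F] F₁)
    (hX : Θ X = y ⊗ₜ 1) (ht : ∀ i, Θ (C (MvPolynomial.X i)) =
      algebraMap (MvPolynomial σ F) E (MvPolynomial.X i) ⊗ₜ 1)
    (hC : ∀ a, Θ (C (MvPolynomial.C a)) = 1 ⊗ₜ a) (z : (MvPolynomial σ F₁)[X]) :
    ∃ w : (MvPolynomial σ F)[X],
      (∀ j m, (w.coeff j).coeff m = l ((z.coeff j).coeff m)) ∧
      TensorProduct.rid F E (LinearMap.lTensor E l (Θ z)) = aeval y w := by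
  induction z using Polynomial.induction_on' with
  | add p q hp hq =>
    obtain ⟨p', h1, h2⟩ := hp
    obtain ⟨q', h3, h4⟩ := hq
    refine ⟨p' + q', fun j m ↦ by simp [h1, h3], by simp [h2, h4]⟩
  | monomial n a =>
    induction a using MvPolynomial.induction_on' with
    | add p q hp hq =>
      obtain ⟨p', h1, h2⟩ := hp
      obtain ⟨q', h3, h4⟩ := hq
      exact ⟨p' + q', fun j m ↦ by simp [h1, h3], by simp [h2, h4]⟩
    | monomial s a =>
      have hs : ∀ s : σ →₀ ℕ, Θ (C (MvPolynomial.monomial s 1)) =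
          algebraMap (MvPolynomial σ F) E (MvPolynomial.monomial s 1) ⊗ₜ 1 := by
        intro s
        rw [MvPolynomial.monomial_eq, MvPolynomial.monomial_eq]
        simp only [map_one, one_mul, Finsupp.prod, map_prod, map_pow, ht,
          Algebra.TensorProduct.tmul_pow, one_pow]
        induction s.support using Finset.cons_induction with
        | empty => simp [Algebra.TensorProduct.one_def]
        | cons a s ha ih =>
          rw [Finset.prod_cons, ih, Finset.prod_cons, Algebra.TensorProduct.tmul_mul_tmul, one_mul]
      refine ⟨monomial n (MvPolynomial.monomial s (l a)), fun j m ↦ ?_, ?_⟩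
      · classical
        simp only [coeff_monomial]
        split_ifs with h
        · simp only [MvPolynomial.coeff_monomial]
          split_ifs <;> simp
        · simp
      · have e1 : (monomial n (MvPolynomial.monomial s a) : (MvPolynomial σ F₁)[X]) =
            C (MvPolynomial.C a) * C (MvPolynomial.monomial s 1) * X ^ n := by
          rw [← C_mul, MvPolynomial.C_mul_monomial, mul_one, C_mul_X_pow_eq_monomial]
        have e2 : MvPolynomial.monomial s (l a) = (l a) • MvPolynomial.monomial s (1 : F) := by
          rw [MvPolynomial.smul_monomial, smul_eq_mul, mul_one]
        rw [e1]
        simp only [map_mul, map_pow, hC, hs, hX, Algebra.TensorProduct.tmul_pow,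
          Algebra.TensorProduct.tmul_mul_tmul, one_mul, mul_one, one_pow, LinearMap.lTensor_tmul,
          TensorProduct.rid_tmul, aeval_monomial]
        rw [e2, Algebra.smul_def, Algebra.smul_def, map_mul, ← IsScalarTower.algebraMap_apply, mul_assoc]

/-- The ring `E ⊗ F₁` is a domain in which `u(y) v(y) = 0`, so one factor vanishes there, say `u(y)
= 0`. Applying a linear functional `F₁ → F` to the coefficients of `u` gives a polynomial over
`F[t]` of the same degree that kills `y`. Hence `deg u` is at least the degree of the minimal
polynomial, and `v = 1`. -/
theorem eq_one_of_mul_eq_map_minpoly_of_isSeparable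
    (hcl : ∀ x : E, IsAlgebraic F x → x ∈ (algebraMap F E).range)
    (hinj : Function.Injective (algebraMap (MvPolynomial σ F) E)) {y : E}
    (hy : IsIntegral (MvPolynomial σ F) y)
    (F₁ : Type*) [Field F₁] [Algebra F F₁] [FiniteDimensional F F₁] [Algebra.IsSeparable F F₁]
    {u v : (MvPolynomial σ F₁)[X]} (hu : u.Monic) (hv : v.Monic)
    (huv : u * v = (minpoly (MvPolynomial σ F) y).map (MvPolynomial.map (algebraMap F F₁))) :
    u = 1 ∨ v = 1 := by
  have := isDomain_tensorProduct_of_algebraicallyClosedIn hcl F₁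
  have : FaithfulSMul (MvPolynomial σ F) E := (faithfulSMul_iff_algebraMap_injective _ _).mpr hinj
  let θ : MvPolynomial σ F₁ →+* E ⊗[F] F₁ :=
    MvPolynomial.eval₂Hom (Algebra.TensorProduct.includeRight : F₁ →ₐ[F] E ⊗[F] F₁).toRingHom
      (fun i ↦ algebraMap (MvPolynomial σ F) E (MvPolynomial.X i) ⊗ₜ 1)
  let Θ : (MvPolynomial σ F₁)[X] →+* E ⊗[F] F₁ := Polynomial.eval₂RingHom θ (y ⊗ₜ 1)
  have hX : Θ X = y ⊗ₜ 1 := by simp [Θ]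
  have ht : ∀ i, Θ (C (MvPolynomial.X i)) =
      algebraMap (MvPolynomial σ F) E (MvPolynomial.X i) ⊗ₜ 1 := by simp [Θ, θ]
  have hC : ∀ a, Θ (C (MvPolynomial.C a)) = 1 ⊗ₜ a := by simp [Θ, θ]
  have hcomp : Θ.comp (Polynomial.mapRingHom (MvPolynomial.map (algebraMap F F₁))) =
      (Algebra.TensorProduct.includeLeftRingHom : E →+* E ⊗[F] F₁).comp
        (aeval (R := MvPolynomial σ F) y).toRingHom := by
    refine Polynomial.ringHom_ext' (MvPolynomial.ringHom_ext (fun a ↦ ?_) fun i ↦ ?_) ?_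
    · simp only [RingHom.comp_apply, coe_mapRingHom, map_C, MvPolynomial.map_C, hC]
      have e : algebraMap (MvPolynomial σ F) E (MvPolynomial.C a) = algebraMap F E a := by
        rw [IsScalarTower.algebraMap_apply F (MvPolynomial σ F) E, MvPolynomial.algebraMap_eq]
      change _ = (aeval y (C (MvPolynomial.C a))) ⊗ₜ 1
      rw [aeval_C, e, Algebra.TensorProduct.tmul_one_eq_one_tmul]
    · simp [ht]
    · simp [hX]
  have h0 : Θ u * Θ v = 0 := by
    rw [← map_mul, huv]
    have := RingHom.congr_fun hcomp (minpoly (MvPolynomial σ F) y)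
    simpa using this
  -- The normalisation `l 1 = 1` preserves the leading coefficient of a monic polynomial, so `l`
  -- does not lower the degree.
  obtain ⟨l, hl⟩ : ∃ l : F₁ →ₗ[F] F, l 1 = 1 := by
    obtain ⟨l, hl⟩ := LinearMap.exists_leftInverse_of_injective (Algebra.linearMap F F₁)
      (LinearMap.ker_eq_bot.mpr (algebraMap F F₁).injective)
    exact ⟨l, by simpa using LinearMap.congr_fun hl 1⟩
  have hdeg : (minpoly (MvPolynomial σ F) y).natDegree = u.natDegree + v.natDegree := by
    rw [← hu.natDegree_mul hv, huv, (minpoly.monic hy).natDegree_map]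
  have key : ∀ w : (MvPolynomial σ F₁)[X], w.Monic → Θ w = 0 →
      (minpoly (MvPolynomial σ F) y).natDegree ≤ w.natDegree := by
    intro w hw hw0
    obtain ⟨w₀, h1, h2⟩ := exists_coeff_functional l y Θ hX ht hC w
    rw [hw0, map_zero, map_zero] at h2
    have hc : w₀.coeff w.natDegree = 1 := by
      classical
      ext m
      rw [h1, hw.coeff_natDegree, MvPolynomial.coeff_one, MvPolynomial.coeff_one]
      split_ifs <;> simp [hl]
    have hne : w₀ ≠ 0 := by
      rintro rfl
      simp at hc
    have hle : w₀.natDegree ≤ w.natDegree := by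
      rw [natDegree_le_iff_coeff_eq_zero]
      intro N hN
      ext m
      rw [h1, coeff_eq_zero_of_natDegree_lt hN]
      simp
    exact (natDegree_le_natDegree
      (minpoly.IsIntegrallyClosed.degree_le_of_ne_zero hne h2.symm)).trans hle
  rcases mul_eq_zero.mp h0 with h | h
  · have := key u hu h
    right
    exact hv.natDegree_eq_zero.mp (by omega)
  · have := key v hv h
    left
    exact hu.natDegree_eq_zero.mp (by omega)

/-- Take `q = p ^ n`, with `p` the exponential characteristic and `n` the exponent of the extension.
The elements whose `q`-th power descends form a subring, the preimage of one under Frobenius, so it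
suffices to check constants and variables. -/
theorem exists_pow_mem_range_map_map {F₁ F₂ : Type*} [Field F₁] [Field F₂] [Algebra F₁ F₂]
    [IsPurelyInseparable.HasExponent F₁ F₂] :
    ∃ q : ℕ, 0 < q ∧ ∀ z : (MvPolynomial σ F₂)[X], ∃ w : (MvPolynomial σ F₁)[X],
      w.map (MvPolynomial.map (algebraMap F₁ F₂)) = z ^ q := by
  obtain ⟨p, hp⟩ := ExpChar.exists F₁
  have := expChar_of_injective_algebraMap (algebraMap F₁ F₂).injective p
  have : ExpChar (MvPolynomial σ F₂) p :=
    expChar_of_injective_algebraMap (MvPolynomial.C_injective σ F₂) p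
  have : ExpChar (MvPolynomial σ F₂)[X] p :=
    expChar_of_injective_algebraMap (R := MvPolynomial σ F₂) C_injective p
  let n := IsPurelyInseparable.exponent F₁ F₂
  refine ⟨p ^ n, pow_pos (expChar_pos F₁ p) _, fun z ↦ ?_⟩
  let φ := Polynomial.mapRingHom (MvPolynomial.map (σ := σ) (algebraMap F₁ F₂))
  suffices h : z ∈ φ.range.comap (iterateFrobenius (MvPolynomial σ F₂)[X] p n) by
    obtain ⟨w, hw⟩ := h
    exact ⟨w, by simpa [φ, iterateFrobenius_def] using hw⟩
  induction z using Polynomial.induction_on' with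
  | add a b ha hb => exact add_mem ha hb
  | monomial m a =>
    rw [← C_mul_X_pow_eq_monomial]
    have hX : (X : (MvPolynomial σ F₂)[X]) ∈
        φ.range.comap (iterateFrobenius (MvPolynomial σ F₂)[X] p n) :=
      ⟨X ^ p ^ n, by simp [φ, iterateFrobenius_def]⟩
    refine mul_mem ?_ (pow_mem hX _)
    induction a using MvPolynomial.induction_on with
    | C a =>
      obtain ⟨b, hb⟩ := IsPurelyInseparable.exponent_def' F₁ p a
      refine ⟨C (MvPolynomial.C b), ?_⟩
      simp [φ, iterateFrobenius_def, hb, n]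
    | add a b ha hb => rw [C_add]; exact add_mem ha hb
    | mul_X a i ha =>
      rw [C_mul]
      exact mul_mem ha ⟨C (MvPolynomial.X i) ^ p ^ n, by simp [φ, iterateFrobenius_def]⟩

/-- If `F` is algebraically closed in `E`, a monic separable irreducible polynomial over
`F[t]` with a root in `E ⊇ F[t]` remains irreducible over every finite extension of `F`. -/
theorem eq_one_of_mul_eq_map_minpoly
    (hcl : ∀ x : E, IsAlgebraic F x → x ∈ (algebraMap F E).range)
    (hinj : Function.Injective (algebraMap (MvPolynomial σ F) E)) {y : E}
    (hy : IsIntegral (MvPolynomial σ F) y)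
    (hsep : ((minpoly (MvPolynomial σ F) y).map (algebraMap (MvPolynomial σ F) E)).Separable)
    (F₂ : Type*) [Field F₂] [Algebra F F₂] [FiniteDimensional F F₂]
    {u v : (MvPolynomial σ F₂)[X]} (hu : u.Monic) (hv : v.Monic)
    (huv : u * v = (minpoly (MvPolynomial σ F) y).map (MvPolynomial.map (algebraMap F F₂))) :
    u = 1 ∨ v = 1 := by
  -- `F₂ / F` is a separable extension followed by a purely inseparable one. The separable step
  -- keeps `g` prime. In the inseparable step the powers `u ^ q` and `v ^ q` descend to `F₁`, where
  -- the prime `g₁` divides one of them.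
  let F₁ := separableClosure F F₂
  let g := minpoly (MvPolynomial σ F) y
  have hg : g.Monic := minpoly.monic hy
  let g₁ := g.map (MvPolynomial.map (algebraMap F F₁))
  let ψ := MvPolynomial.map (σ := σ) (algebraMap F₁ F₂)
  have hg₂ : g₁.map ψ = u * v := by
    rw [huv, Polynomial.map_map]
    congr 1
    exact RingHom.ext fun x ↦ by simp [ψ, MvPolynomial.map_map, ← IsScalarTower.algebraMap_eq]
  have hψ : Function.Injective (Polynomial.map ψ) :=
    map_injective _ (MvPolynomial.map_injective _ (algebraMap F₁ F₂).injective)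
  by_cases hg1 : g₁ = 1
  · rw [hg1, Polynomial.map_one] at hg₂
    left
    exact (hu.isUnit_iff).mp (IsUnit.of_mul_eq_one _ hg₂.symm)
  have hprime : Prime g₁ := by
    rw [← irreducible_iff_prime, irreducible_of_monic (hg.map _) hg1]
    intro a b ha hb hab
    exact eq_one_of_mul_eq_map_minpoly_of_isSeparable hcl hinj hy F₁ ha hb hab
  obtain ⟨q, hq, hpow⟩ := exists_pow_mem_range_map_map (σ := σ) (F₁ := F₁) (F₂ := F₂)
  obtain ⟨u₁, hu₁⟩ := hpow u
  obtain ⟨v₁, hv₁⟩ := hpow v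
  have h12 : u₁ * v₁ = g₁ ^ q := by
    apply hψ
    rw [Polynomial.map_mul, Polynomial.map_pow, hg₂, mul_pow, hu₁, hv₁]
  -- `u` and `v` are coprime over the field of fractions
  let Q₂ := FractionRing (MvPolynomial σ F₂)
  let ι := algebraMap (MvPolynomial σ F₂) Q₂
  have hι : Function.Injective ι := IsFractionRing.injective _ _
  let χ : FractionRing (MvPolynomial σ F) →+* Q₂ :=
    IsFractionRing.lift (g := ι.comp (MvPolynomial.map (algebraMap F F₂)))
      (hι.comp (MvPolynomial.map_injective _ (algebraMap F F₂).injective))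
  -- This is where separability of the minimal polynomial enters: it rules out that `u v` is a power
  -- of one polynomial.
  have hcop : IsCoprime (u.map ι) (v.map ι) := by
    apply Separable.isCoprime
    rw [← Polynomial.map_mul, huv]
    have hsep' : ((minpoly (MvPolynomial σ F) y).map
        (algebraMap (MvPolynomial σ F) (FractionRing (MvPolynomial σ F)))).Separable := by
      rw [← separable_map (IsFractionRing.lift hinj : FractionRing (MvPolynomial σ F) →+* E),
        Polynomial.map_map]
      have e : (IsFractionRing.lift hinj).comp (algebraMap (MvPolynomial σ F)
          (FractionRing (MvPolynomial σ F))) = algebraMap (MvPolynomial σ F) E :=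
        RingHom.ext fun x ↦ by simp
      rw [e]
      exact hsep
    have h := hsep'.map (f := χ)
    rw [Polynomial.map_map] at h ⊢
    have e : χ.comp (algebraMap (MvPolynomial σ F) (FractionRing (MvPolynomial σ F))) =
        ι.comp (MvPolynomial.map (algebraMap F F₂)) := RingHom.ext fun x ↦ by simp [χ]
    rwa [e] at h
  have fin : ∀ a b : (MvPolynomial σ F₂)[X], b.Monic → IsCoprime (a.map ι) (b.map ι) →
      b ∣ a ^ q → b = 1 := by
    intro a b hb hab hd
    have h1 : b.map ι ∣ (a.map ι) ^ q := by
      rw [← Polynomial.map_pow]; exact Polynomial.map_dvd ι hd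
    have h2 : IsUnit (b.map ι) := (hab.symm.pow_right (n := q)).isUnit_of_dvd' dvd_rfl h1
    have h3 := (hb.map ι).isUnit_iff.mp h2
    exact map_injective _ hι (by simpa using h3)
  have hd : g₁ ∣ u₁ * v₁ := h12 ▸ dvd_pow_self _ hq.ne'
  rcases hprime.dvd_or_dvd hd with h | h
  · right
    have := Polynomial.map_dvd ψ h
    rw [hg₂, hu₁] at this
    exact fin u v hv hcop ((dvd_mul_left _ _).trans this)
  · left
    have := Polynomial.map_dvd ψ h
    rw [hg₂, hv₁] at this
    exact fin v u hu hcop.symm ((dvd_mul_right _ _).trans this)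

end GeometricIrreducibility

/-! ### Irreducibility modulo almost all primes (Bertini–Noether) -/

section BertiniNoether

open Polynomial TensorProduct

/-- The monic polynomial in `X` of degree `d` whose lower coefficients are the polynomials in `t`
with exponents at most `N` and with coefficients prescribed by `c`. -/
noncomputable def genericMonic {σ B : Type*} [Fintype σ] [DecidableEq σ] [CommRing B] (d N : ℕ)
    (c : Fin d × (σ → Fin (N + 1)) → B) : (MvPolynomial σ B)[X] :=
  X ^ d + ∑ j : Fin d, C (∑ s : σ → Fin (N + 1),
    MvPolynomial.monomial (Finsupp.equivFunOnFinite.symm fun i ↦ (s i : ℕ)) (c (j, s))) * X ^ (j : ℕ)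

section

variable {σ B B' : Type*} [Fintype σ] [DecidableEq σ] [CommRing B] [CommRing B'] {d N : ℕ}

theorem map_genericMonic (φ : B →+* B') (c : Fin d × (σ → Fin (N + 1)) → B) :
    (genericMonic d N c).map (MvPolynomial.map φ) = genericMonic d N (φ ∘ c) := by
  simp [genericMonic, Polynomial.map_sum, MvPolynomial.map_monomial]

theorem degree_genericMonic_aux (c : Fin d × (σ → Fin (N + 1)) → B) :
    (∑ j : Fin d, C (∑ s : σ → Fin (N + 1), MvPolynomial.monomial
      (Finsupp.equivFunOnFinite.symm fun i ↦ (s i : ℕ)) (c (j, s))) * X ^ (j : ℕ)).degree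
      < (d : WithBot ℕ) := by
  refine mem_degreeLT.mp (Submodule.sum_mem _ fun j _ ↦ mem_degreeLT.mpr ?_)
  exact (degree_C_mul_X_pow_le _ _).trans_lt (by exact_mod_cast j.2)

theorem genericMonic_monic (c : Fin d × (σ → Fin (N + 1)) → B) : (genericMonic d N c).Monic :=
  monic_X_pow_add (degree_genericMonic_aux c)

theorem natDegree_genericMonic [Nontrivial B] (c : Fin d × (σ → Fin (N + 1)) → B) :
    (genericMonic d N c).natDegree = d := by
  rw [genericMonic, natDegree_add_eq_left_of_degree_lt]
  · simp
  · rw [degree_X_pow]; exact degree_genericMonic_aux c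

theorem exists_eq_genericMonic [Nontrivial B] {u : (MvPolynomial σ B)[X]} (hu : u.Monic)
    (hN : ∀ j i, (u.coeff j).degreeOf i ≤ N) :
    ∃ c, u = genericMonic u.natDegree N c := by
  classical
  refine ⟨fun p ↦ (u.coeff p.1).coeff (Finsupp.equivFunOnFinite.symm fun i ↦ (p.2 i : ℕ)), ?_⟩
  conv_lhs => rw [hu.as_sum]
  rw [genericMonic, Finset.sum_range]
  congr 1
  refine Finset.sum_congr rfl fun j _ ↦ ?_
  congr 2
  ext m
  rw [MvPolynomial.coeff_sum]
  simp only [MvPolynomial.coeff_monomial]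
  by_cases hm : ∀ i, m i ≤ N
  · rw [Finset.sum_eq_single (fun i ↦ ⟨m i, Nat.lt_succ_of_le (hm i)⟩)]
    · rw [if_pos]
      · congr 1
        exact Finsupp.ext fun i ↦ rfl
      · exact Finsupp.ext fun i ↦ rfl
    · intro s _ hs
      rw [if_neg]
      rintro rfl
      exact hs (by ext i; simp)
    · simp
  · push Not at hm
    obtain ⟨i, hi⟩ := hm
    rw [Finset.sum_eq_zero]
    · rw [← MvPolynomial.notMem_support_iff]
      intro hmem
      exact absurd ((MvPolynomial.le_degreeOf_of_mem_support i hmem).trans (hN j i)) (by omega)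
    · intro s _
      rw [if_neg]
      rintro rfl
      simp only [Finsupp.equivFunOnFinite_symm_apply_apply] at hi
      have := (s i).2
      omega

end

variable {A F : Type u} [CommRing A] [IsDomain A] [Field F] [Algebra A F] [IsFractionRing A F]
  {σ : Type u} [Fintype σ] [DecidableEq σ]

/-- Factorisations of `g` of the given shape are the points of an affine `A`-scheme `Spec Q` of
finite type. If `A → Q` were injective, `F ⊗ Q` would be nonzero and have a point over a finite
extension of `F`, against `hgeom`. So some `a ≠ 0` in `A` dies in `Q`, and no field in which `a` is
nonzero carries such a factorisation. -/
theorem exists_forall_ne_genericMonic_mul (g : (MvPolynomial σ A)[X])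
    (hgeom : ∀ (F' : Type u) [Field F'] [Algebra A F'] [Algebra F F'] [IsScalarTower A F F']
      [FiniteDimensional F F'] (u v : (MvPolynomial σ F')[X]), u.Monic → v.Monic →
      u * v = g.map (MvPolynomial.map (algebraMap A F')) → u = 1 ∨ v = 1)
    {d₁ d₂ : ℕ} (h₁ : d₁ ≠ 0) (h₂ : d₂ ≠ 0) (N : ℕ) :
    ∃ a : A, a ≠ 0 ∧ ∀ {k : Type u} [Field k] (φ : A →+* k), φ a ≠ 0 → ∀ c₁ c₂,
      genericMonic d₁ N c₁ * genericMonic d₂ N c₂ ≠ g.map (MvPolynomial.map φ) := by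
  let ι := (Fin d₁ × (σ → Fin (N + 1))) ⊕ (Fin d₂ × (σ → Fin (N + 1)))
  let W := MvPolynomial ι A
  let univ : (MvPolynomial σ W)[X] :=
    genericMonic d₁ N (fun p ↦ (MvPolynomial.X (Sum.inl p) : W)) *
      genericMonic d₂ N (fun p ↦ (MvPolynomial.X (Sum.inr p) : W)) -
      g.map (MvPolynomial.map (algebraMap A W))
  let I : Ideal W := Ideal.span (Set.range fun p : ℕ × (σ →₀ ℕ) ↦ (univ.coeff p.1).coeff p.2)
  obtain ⟨Q, _, _, π, hπs, hπ⟩ : ∃ (Q : Type u) (_ : CommRing Q) (_ : Algebra A Q) (π : W →ₐ[A] Q),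
      Function.Surjective π ∧ ∀ w, π w = 0 ↔ w ∈ I :=
    ⟨W ⧸ I, inferInstance, inferInstance, Ideal.Quotient.mkₐ A I, Ideal.Quotient.mkₐ_surjective A I,
      fun w ↦ Ideal.Quotient.eq_zero_iff_mem⟩
  have : Algebra.FiniteType A Q := Algebra.FiniteType.of_surjective π hπs
  have huniv : ∀ {B : Type u} [CommRing B] (ψ : W →+* B),
      univ.map (MvPolynomial.map ψ) =
        genericMonic d₁ N (fun p ↦ ψ (MvPolynomial.X (Sum.inl p))) *
        genericMonic d₂ N (fun p ↦ ψ (MvPolynomial.X (Sum.inr p))) -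
        g.map (MvPolynomial.map (ψ.comp (algebraMap A W))) := by
    intro B _ ψ
    simp only [univ, Polynomial.map_sub, Polynomial.map_mul, map_genericMonic, Polynomial.map_map]
    congr 2
    exact RingHom.ext fun x ↦ MvPolynomial.map_map _ _ x
  have hI : ∀ {B : Type u} [CommRing B] (ψ : W →+* B),
      (∀ w ∈ I, ψ w = 0) ↔ univ.map (MvPolynomial.map ψ) = 0 := by
    intro B _ ψ
    have : (∀ w ∈ I, ψ w = 0) ↔ I ≤ RingHom.ker ψ := Iff.rfl
    rw [this, Ideal.span_le]
    constructor
    · intro h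
      ext j m
      have := h ⟨(j, m), rfl⟩
      simpa [MvPolynomial.coeff_map] using this
    · rintro h _ ⟨⟨j, m⟩, rfl⟩
      have := congrArg (fun z ↦ MvPolynomial.coeff m (Polynomial.coeff z j)) h
      simpa [MvPolynomial.coeff_map] using this
  by_cases hinj : Function.Injective (algebraMap A Q)
  · exfalso
    have := IsLocalization.flat F (nonZeroDivisors A)
    have hnt : Nontrivial (F ⊗[A] Q) := by
      have h := Module.Flat.lTensor_preserves_injective_linearMap (M := F)
        (Algebra.linearMap A Q) hinj
      have : Nontrivial (F ⊗[A] A) := (TensorProduct.rid A F).toEquiv.nontrivial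
      exact h.nontrivial
    -- Nullstellensatz: the residue field of a maximal ideal of a finite type `F`-algebra is finite
    -- over `F`.
    obtain ⟨F', _, _, ρ, hfin⟩ : ∃ (F' : Type u) (_ : Field F') (_ : Algebra F F')
        (_ : F ⊗[A] Q →ₐ[F] F'), Module.Finite F F' := by
      obtain ⟨m, hm⟩ := Ideal.exists_maximal (F ⊗[A] Q)
      let _ : Field ((F ⊗[A] Q) ⧸ m) := Ideal.Quotient.field m
      exact ⟨(F ⊗[A] Q) ⧸ m, Ideal.Quotient.field m, inferInstance, Ideal.Quotient.mkₐ F m,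
        finite_of_finite_type_of_isJacobsonRing F _⟩
    let _ : Algebra A F' := ((algebraMap F F').comp (algebraMap A F)).toAlgebra
    have : IsScalarTower A F F' := IsScalarTower.of_algebraMap_eq' rfl
    let ψ : W →+* F' := ρ.toRingHom.comp
      ((Algebra.TensorProduct.includeRight : Q →ₐ[A] F ⊗[A] Q).toRingHom.comp π.toRingHom)
    have h0 : univ.map (MvPolynomial.map ψ) = 0 := by
      rw [← hI]
      intro w hw
      simp [ψ, (hπ w).mpr hw]
    have hψ : ψ.comp (algebraMap A W) = algebraMap A F' := by
      ext a
      change ρ ((Algebra.TensorProduct.includeRight : Q →ₐ[A] F ⊗[A] Q)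
        (π (algebraMap A W a))) = _
      rw [AlgHom.commutes, AlgHom.commutes, IsScalarTower.algebraMap_apply A F (F ⊗[A] Q),
        AlgHom.commutes]
      rfl
    rw [huniv, hψ, sub_eq_zero] at h0
    rcases hgeom F' _ _ (genericMonic_monic _) (genericMonic_monic _) h0 with h | h
    · have := congrArg natDegree h
      rw [natDegree_genericMonic, natDegree_one] at this
      exact h₁ this
    · have := congrArg natDegree h
      rw [natDegree_genericMonic, natDegree_one] at this
      exact h₂ this
  · rw [injective_iff_map_eq_zero] at hinj
    push Not at hinj
    obtain ⟨a, ha, ha0⟩ := hinj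
    refine ⟨a, ha0, fun φ hφ c₁ c₂ hc ↦ hφ ?_⟩
    let ψ : W →+* _ := MvPolynomial.eval₂Hom φ (Sum.elim c₁ c₂)
    have hψ : ψ.comp (algebraMap A W) = φ := by ext x; simp [ψ, W, MvPolynomial.algebraMap_eq]
    have h0 : univ.map (MvPolynomial.map ψ) = 0 := by
      rw [huniv, hψ, sub_eq_zero, ← hc]
      simp [ψ, W]
    have := (hI ψ).mpr h0 (algebraMap A W a) ((hπ _).mp (by rw [AlgHom.commutes, ha]))
    rw [← hψ]
    exact this

theorem totalDegree_map_le' {σ B B' : Type*} [CommRing B] [CommRing B'] (φ : B →+* B')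
    (p : MvPolynomial σ B) : (MvPolynomial.map φ p).totalDegree ≤ p.totalDegree :=
  Finset.sup_mono (MvPolynomial.support_map_subset φ p)

/-- **Bertini–Noether**: a polynomial that stays irreducible over every finite extension of the
field of fractions of `A` is irreducible modulo almost all primes of `A`. -/
theorem exists_forall_irreducible_map {g : (MvPolynomial σ A)[X]} (hg : g.Monic) (hg1 : g ≠ 1)
    (hgeom : ∀ (F' : Type u) [Field F'] [Algebra A F'] [Algebra F F'] [IsScalarTower A F F']
      [FiniteDimensional F F'] (u v : (MvPolynomial σ F')[X]), u.Monic → v.Monic →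
      u * v = g.map (MvPolynomial.map (algebraMap A F')) → u = 1 ∨ v = 1) :
    ∃ a : A, a ≠ 0 ∧ ∀ {k : Type u} [Field k] (φ : A →+* k), φ a ≠ 0 →
      Irreducible (g.map (MvPolynomial.map φ)) := by
  classical
  -- The total degree counts `X` and the `t` together. It is additive on products over a field and
  -- does not grow under specialisation, so `N` bounds the `t`-degrees of every factor of every
  -- specialisation of `g`.
  let N := ((MvPolynomial.optionEquivLeft A σ).symm g).totalDegree
  let d := g.natDegree
  have H : ∀ p : ℕ × ℕ, ∃ a : A, a ≠ 0 ∧ (p.1 ≠ 0 → p.2 ≠ 0 →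
      ∀ {k : Type u} [Field k] (φ : A →+* k), φ a ≠ 0 → ∀ c₁ c₂,
      genericMonic p.1 N c₁ * genericMonic p.2 N c₂ ≠ g.map (MvPolynomial.map φ)) := by
    rintro ⟨d₁, d₂⟩
    by_cases h₁ : d₁ = 0
    · exact ⟨1, one_ne_zero, fun h ↦ absurd h₁ h⟩
    by_cases h₂ : d₂ = 0
    · exact ⟨1, one_ne_zero, fun _ h ↦ absurd h₂ h⟩
    obtain ⟨a, ha, h⟩ := exists_forall_ne_genericMonic_mul (F := F) g hgeom h₁ h₂ N
    exact ⟨a, ha, fun _ _ ↦ h⟩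
  choose a ha0 ha using H
  -- Only finitely many pairs of degrees can occur; the product excludes all of them at once.
  refine ⟨∏ p ∈ Finset.range (d + 1) ×ˢ Finset.range (d + 1), a p,
    Finset.prod_ne_zero_iff.mpr fun p _ ↦ ha0 p, fun {k} _ φ hφ ↦ ?_⟩
  rw [map_prod, Finset.prod_ne_zero_iff] at hφ
  have hgk1 : g.map (MvPolynomial.map φ) ≠ 1 := by
    intro h
    apply hg1
    rw [← hg.natDegree_eq_zero, ← hg.natDegree_map (MvPolynomial.map φ), h, natDegree_one]
  rw [irreducible_of_monic (hg.map _) hgk1]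
  intro u v hu hv huv
  by_contra! hne
  have hdeg : u.natDegree + v.natDegree = d := by
    rw [← hu.natDegree_mul hv, huv, hg.natDegree_map]
  have hu0 : u.natDegree ≠ 0 := fun h ↦ hne.1 (hu.natDegree_eq_zero.mp h)
  have hv0 : v.natDegree ≠ 0 := fun h ↦ hne.2 (hv.natDegree_eq_zero.mp h)
  let e := MvPolynomial.optionEquivLeft k σ
  have htot : (e.symm u).totalDegree + (e.symm v).totalDegree ≤ N := by
    rw [← MvPolynomial.totalDegree_mul_of_isDomain, ← map_mul, huv]
    · have : e.symm (g.map (MvPolynomial.map φ)) =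
          MvPolynomial.map φ ((MvPolynomial.optionEquivLeft A σ).symm g) := by
        rw [AlgEquiv.symm_apply_eq]
        generalize hq : (MvPolynomial.optionEquivLeft A σ).symm g = q
        rw [AlgEquiv.symm_apply_eq] at hq
        rw [hq]
        clear hq
        induction q using MvPolynomial.induction_on with
        | C a => simp [e, MvPolynomial.optionEquivLeft_C]
        | add p q hp hq => simp only [map_add, Polynomial.map_add, hp, hq]
        | mul_X p i hp =>
          simp only [map_mul, Polynomial.map_mul, hp]
          cases i <;> simp [e, MvPolynomial.optionEquivLeft_X_none, MvPolynomial.optionEquivLeft_X_some]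
      rw [this]
      exact totalDegree_map_le' _ _
    · simpa using hu.ne_zero
    · simpa using hv.ne_zero
  have hbound : ∀ w : (MvPolynomial σ k)[X], (e.symm w).totalDegree ≤ N →
      ∀ j i, (w.coeff j).degreeOf i ≤ N := by
    intro w hw j i
    refine (MvPolynomial.degreeOf_le_totalDegree _ _).trans (le_trans ?_ hw)
    by_cases hwj : w.coeff j = 0
    · simp [hwj]
    have := MvPolynomial.totalDegree_coeff_optionEquivLeft_add_le k σ (e.symm w) j
    simp only [e, AlgEquiv.apply_symm_apply] at this
    refine (Nat.le_add_right _ j).trans (this ?_)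
    have h1 := MvPolynomial.natDegree_optionEquivLeft k (e.symm w)
    simp only [e, AlgEquiv.apply_symm_apply] at h1
    exact (le_natDegree_of_ne_zero hwj).trans
      (h1.trans_le (MvPolynomial.degreeOf_le_totalDegree _ _))
  obtain ⟨c₁, hc₁⟩ := exists_eq_genericMonic hu (hbound u (by omega))
  obtain ⟨c₂, hc₂⟩ := exists_eq_genericMonic hv (hbound v (by omega))
  refine ha (u.natDegree, v.natDegree) hu0 hv0 φ (hφ _ ?_) c₁ c₂ ?_
  · simp only [Finset.mem_product, Finset.mem_range]
    omega
  · rw [← hc₁, ← hc₂, huv]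

end BertiniNoether

/-! ### Generic points up to purely inseparable extensions -/

section GenericPoint

open Polynomial

/-- Let `E` be the field of fractions of `R ⊇ P`, and let the `q`-th powers of the elements of `R`
be in `P[y, 1/ν]`, where `g` is the monic minimal polynomial of `y`. If `P[y] / I = D` is a domain,
the zero set of `I` in `R[1/ν]` has a generic point. -/
theorem exists_least_prime_of_pow_mem {P R E D : Type*} [CommRing P] [CommRing R] [Field E]
    [CommRing D] [IsDomain D] [Algebra P R] [Algebra P E] [Algebra R E] [IsScalarTower P R E]
    (hRE : Function.Injective (algebraMap R E)) {y : E} {g : P[X]}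
    (hker : ∀ f : P[X], aeval y f = 0 → g ∣ f) (p n : ℕ) [ExpChar E p] {ν : P}
    (hpow : ∀ r : R, ∃ (N : ℕ) (f : P[X]),
      aeval y f = algebraMap P E ν ^ N * algebraMap R E r ^ p ^ n)
    (hy : ∃ r : R, algebraMap R E r = algebraMap P E ν * y) (I : Ideal P) (θ : P[X] →+* D)
    (hθg : θ g = 0) (hθI : ∀ i ∈ I, θ (C i) = 0) (hθν : θ (C ν) ≠ 0)
    (hgy : aeval y g = 0)
    (hθ : ∀ f, θ f = 0 → f ∈ I.map C ⊔ Ideal.span {g}) :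
    ∃ 𝔓 : Ideal R, 𝔓.IsPrime ∧ I ≤ 𝔓.comap (algebraMap P R) ∧ algebraMap P R ν ∉ 𝔓 ∧
      ∀ Q : Ideal R, Q.IsPrime → I ≤ Q.comap (algebraMap P R) → algebraMap P R ν ∉ Q → 𝔓 ≤ Q := by
  have hq : p ^ n ≠ 0 := (pow_pos (expChar_pos E p) n).ne'
  have heq : ∀ f₁ f₂ : P[X], aeval y f₁ = aeval y f₂ → θ f₁ = θ f₂ := by
    intro f₁ f₂ h
    obtain ⟨c, hc⟩ := hker (f₁ - f₂) (by rw [map_sub, h, sub_self])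
    rw [← sub_eq_zero, ← map_sub, hc, map_mul, hθg, zero_mul]
  -- An element belongs to `𝔓` when its `p ^ n`-th power, after clearing powers of `ν`, is a
  -- polynomial in `y` that vanishes in `D`. Closure under addition holds because Frobenius is
  -- additive.
  let 𝔓 : Ideal R :=
    { carrier := {r | ∃ (N : ℕ) (f : P[X]),
        aeval y f = algebraMap P E ν ^ N * algebraMap R E r ^ p ^ n ∧ θ f = 0}
      zero_mem' := ⟨0, 0, by simp [zero_pow hq], by simp⟩
      add_mem' := by
        rintro a b ⟨N₁, f₁, h₁, h₁'⟩ ⟨N₂, f₂, h₂, h₂'⟩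
        refine ⟨N₁ + N₂, C (ν ^ N₂) * f₁ + C (ν ^ N₁) * f₂, ?_, by simp [h₁', h₂']⟩
        simp only [map_add, map_mul, aeval_C, h₁, h₂, add_pow_expChar_pow, map_pow]
        ring
      smul_mem' := by
        rintro s a ⟨N₁, f₁, h₁, h₁'⟩
        obtain ⟨N₂, f₂, h₂⟩ := hpow s
        refine ⟨N₁ + N₂, f₁ * f₂, ?_, by simp [h₁']⟩
        simp only [map_mul, h₁, h₂, smul_eq_mul]
        ring }
  -- Membership does not depend on the representing polynomial: two of them agree up to powers of
  -- `ν`, and `ν` is nonzero in the domain `D`.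
  have hmem : ∀ (r : R) (N : ℕ) (f : P[X]),
      aeval y f = algebraMap P E ν ^ N * algebraMap R E r ^ p ^ n → r ∈ 𝔓 → θ f = 0 := by
    rintro r N f hf ⟨N', f', hf', h0⟩
    have := heq (C (ν ^ N') * f) (C (ν ^ N) * f') (by
      simp only [map_mul, aeval_C, hf, hf', map_pow]; ring)
    simp only [map_mul, h0, mul_zero, map_pow] at this
    exact (mul_eq_zero.mp this).resolve_left (pow_ne_zero _ hθν)
  have hν : algebraMap P R ν ∉ 𝔓 := by
    intro h
    have := hmem _ 0 (C (ν ^ p ^ n)) (by simp [← IsScalarTower.algebraMap_apply]) h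
    rw [C_pow, map_pow] at this
    exact pow_ne_zero _ hθν this
  refine ⟨𝔓, ⟨fun h ↦ hν (h ▸ trivial), ?_⟩, ?_, hν, ?_⟩
  · intro r s hrs
    obtain ⟨N₁, f₁, h₁⟩ := hpow r
    obtain ⟨N₂, f₂, h₂⟩ := hpow s
    have := hmem _ (N₁ + N₂) (f₁ * f₂) (by simp only [map_mul, h₁, h₂]; ring) hrs
    rw [map_mul, mul_eq_zero] at this
    exact this.imp (fun h ↦ ⟨N₁, f₁, h₁, h⟩) (fun h ↦ ⟨N₂, f₂, h₂, h⟩)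
  · intro i hi
    refine ⟨0, C (i ^ p ^ n), by simp [← IsScalarTower.algebraMap_apply], ?_⟩
    rw [C_pow, map_pow, hθI i hi, zero_pow hq]
  · intro Q hQ hIQ hνQ r ⟨N, f, hf, hf0⟩
    obtain ⟨ry, hry⟩ := hy
    have hall : ∀ f : P[X], ∃ (M : ℕ) (r : R),
        algebraMap R E r = algebraMap P E ν ^ M * aeval y f := by
      intro f
      induction f using Polynomial.induction_on' with
      | add a b ha hb =>
        obtain ⟨M₁, r₁, h₁⟩ := ha
        obtain ⟨M₂, r₂, h₂⟩ := hb
        refine ⟨M₁ + M₂, algebraMap P R ν ^ M₂ * r₁ + algebraMap P R ν ^ M₁ * r₂, ?_⟩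
        simp only [map_add, map_mul, map_pow, h₁, h₂, ← IsScalarTower.algebraMap_apply]
        ring
      | monomial m a =>
        refine ⟨m, algebraMap P R a * ry ^ m, ?_⟩
        simp only [map_mul, map_pow, hry, ← IsScalarTower.algebraMap_apply, aeval_monomial]
        ring
    -- Minimality of `𝔓`: a polynomial vanishing in `D` lies in `(I, g)`, so a `ν`-multiple of its
    -- value at `y` lies in every `Q` that contains `I`.
    have hI : ∀ f ∈ I.map (C : P →+* P[X]) ⊔ Ideal.span {g}, ∃ (M : ℕ), ∃ r ∈ Q,
        algebraMap R E r = algebraMap P E ν ^ M * aeval y f := by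
      rw [Ideal.map, ← Ideal.span_union]
      intro f hf
      induction hf using Submodule.span_induction with
      | mem f hf =>
        rcases hf with ⟨i, hi, rfl⟩ | hf
        · exact ⟨0, algebraMap P R i, hIQ hi, by simp [← IsScalarTower.algebraMap_apply]⟩
        · rw [Set.mem_singleton_iff.mp hf]
          exact ⟨0, 0, zero_mem _, by simp [hgy]⟩
      | zero => exact ⟨0, 0, zero_mem _, by simp⟩
      | add a b _ _ ha hb =>
        obtain ⟨M₁, r₁, h₁', h₁⟩ := ha
        obtain ⟨M₂, r₂, h₂', h₂⟩ := hb
        refine ⟨M₁ + M₂, algebraMap P R ν ^ M₂ * r₁ + algebraMap P R ν ^ M₁ * r₂,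
          add_mem (Q.mul_mem_left _ h₁') (Q.mul_mem_left _ h₂'), ?_⟩
        simp only [map_add, map_mul, map_pow, h₁, h₂, ← IsScalarTower.algebraMap_apply]
        ring
      | smul a b _ hb =>
        obtain ⟨M₁, r₁, h₁⟩ := hall a
        obtain ⟨M₂, r₂, h₂', h₂⟩ := hb
        refine ⟨M₁ + M₂, r₁ * r₂, Q.mul_mem_left _ h₂', ?_⟩
        simp only [map_mul, h₁, h₂, smul_eq_mul]
        ring
    obtain ⟨M, r', hr', hr'f⟩ := hI f (hθ f hf0)
    have : r' = algebraMap P R ν ^ (M + N) * r ^ p ^ n := by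
      apply hRE
      simp only [map_mul, map_pow, hr'f, hf, ← IsScalarTower.algebraMap_apply]
      ring
    rw [this] at hr'
    rcases hQ.mem_or_mem hr' with h | h
    · exact absurd (hQ.mem_of_pow_mem _ h) hνQ
    · exact hQ.mem_of_pow_mem _ h

/-- A finite extension `E` of the field of fractions `K` of `P` contains a separable `y`, integral
over `P` with minimal polynomial over `P`, such that `E` is purely inseparable over `K(y)`. -/
theorem exists_separable_generator (P K E : Type*) [CommRing P] [IsDomain P] [Field K] [Field E]
    [Algebra P K] [IsFractionRing P K] [Algebra K E] [FiniteDimensional K E] :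
    ∃ (y : E) (g : P[X]), g.Monic ∧ g.map (algebraMap P K) = minpoly K y ∧ IsSeparable K y ∧
      ∃ p n : ℕ, ExpChar E p ∧ ∀ z : E, z ^ p ^ n ∈ Algebra.adjoin K {y} := by
  let S := separableClosure K E
  obtain ⟨y₀, hy₀⟩ := Field.exists_primitive_element K S
  have hy₀i : IsIntegral K (y₀ : E) := Algebra.IsIntegral.isIntegral _
  -- Scaling the primitive element by a common denominator of its minimal polynomial moves all
  -- coefficients into `P`.
  let c := IsLocalization.commonDenom (nonZeroDivisors P) (minpoly K (y₀ : E)).support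
    (minpoly K (y₀ : E)).coeff
  have hc : algebraMap P K c ≠ 0 := by
    simp
  have hlift := IsLocalization.scaleRoots_commonDenom_mem_lifts (nonZeroDivisors P)
    (minpoly K (y₀ : E)) (by rw [minpoly.monic hy₀i]; exact one_mem _)
  obtain ⟨g, hg, -, hgm⟩ := lifts_and_natDegree_eq_and_monic hlift
    ((monic_scaleRoots_iff _).mpr (minpoly.monic hy₀i))
  refine ⟨algebraMap P K c • (y₀ : E), g, hgm, ?_, ?_, ?_⟩
  · rw [hg, IsIntegrallyClosed.minpoly_smul hc hy₀i]
  · have : algebraMap P K c • (y₀ : E) = ((algebraMap P K c • y₀ : S) : E) := rfl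
    rw [this]
    exact mem_separableClosure_iff.mp (Subtype.mem _)
  · obtain ⟨p, hp⟩ := ExpChar.exists S
    have hpE := expChar_of_injective_algebraMap (algebraMap S E).injective p
    refine ⟨p, IsPurelyInseparable.exponent S E, hpE, fun z ↦ ?_⟩
    obtain ⟨w, hw⟩ := IsPurelyInseparable.exponent_def' S p z
    rw [← hw]
    have hw1 : w ∈ IntermediateField.adjoin K {y₀} := hy₀ ▸ trivial
    rw [← IntermediateField.mem_toSubalgebra,
      IntermediateField.adjoin_simple_toSubalgebra_of_isAlgebraic (Algebra.IsAlgebraic.isAlgebraic _)] at hw1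
    have h2 : (w : E) ∈ (Algebra.adjoin K {y₀}).map S.val := ⟨w, hw1, rfl⟩
    rw [AlgHom.map_adjoin, Set.image_singleton] at h2
    refine Algebra.adjoin_le (S := Algebra.adjoin K {algebraMap P K c • (y₀ : E)}) ?_ h2
    rw [Set.singleton_subset_iff]
    have := Subalgebra.smul_mem (Algebra.adjoin K {algebraMap P K c • (y₀ : E)})
      (Algebra.self_mem_adjoin_singleton K _) (algebraMap P K c)⁻¹
    rwa [inv_smul_smul₀ hc] at this

end GenericPoint

/-! ### The fibre over a general maximal ideal -/

section GenericFibre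

open Polynomial

/-- Let `R` be a domain of finite type over `A` such that the field of fractions `F` of `A` is
algebraically closed in that of `R`. Over a general maximal ideal of `A`, the fibre of a suitable
principal open subset of `Spec R` is irreducible: it has a generic point. -/
theorem exists_least_prime_over_general_maximal (A R F E : Type u) [CommRing A] [IsDomain A]
    [CommRing R] [IsDomain R] [Algebra A R] [Algebra.FiniteType A R] [Field F] [Algebra A F]
    [IsFractionRing A F] [Field E] [Algebra R E] [IsFractionRing R E] [Algebra A E]
    [IsScalarTower A R E] [Algebra F E] [IsScalarTower A F E]
    (hcl : ∀ x : E, IsAlgebraic F x → x ∈ (algebraMap F E).range) :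
    ∃ h : R, h ≠ 0 ∧ ∃ a : A, a ≠ 0 ∧ ∀ 𝔟 : Ideal A, 𝔟.IsMaximal → a ∉ 𝔟 →
      ∃ 𝔓 : Ideal R, 𝔓.IsPrime ∧ 𝔟 ≤ 𝔓.comap (algebraMap A R) ∧ h ∉ 𝔓 ∧
        ∀ Q : Ideal R, Q.IsPrime → 𝔟 ≤ Q.comap (algebraMap A R) → h ∉ Q → 𝔓 ≤ Q := by
  classical
  have hRE : Function.Injective (algebraMap R E) := IsFractionRing.injective R E
  have hAE : Function.Injective (algebraMap A E) := by
    rw [IsScalarTower.algebraMap_eq A F E]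
    exact (algebraMap F E).injective.comp (IsFractionRing.injective A F)
  have hAR : Function.Injective (algebraMap A R) := by
    have := hAE
    rw [IsScalarTower.algebraMap_eq A R E, RingHom.coe_comp] at this
    exact this.of_comp
  have : FaithfulSMul A R := (faithfulSMul_iff_algebraMap_injective _ _).mpr hAR
  obtain ⟨s, hs⟩ := ‹Algebra.FiniteType A R›.out
  have : Algebra.IsAlgebraic (Algebra.adjoin A (s : Set R)) R :=
    ⟨fun x ↦ isAlgebraic_algebraMap (⟨x, hs ▸ trivial⟩ : Algebra.adjoin A (s : Set R))⟩
  -- A transcendence basis taken among the generators keeps `P = A[t]` inside `R`, with `R`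
  -- algebraic over `P`.
  obtain ⟨t, hts, ht⟩ := exists_isTranscendenceBasis_subset (R := A) (s : Set R)
  have : Finite t := s.finite_toSet.subset hts
  have := Fintype.ofFinite t
  let P := MvPolynomial t A
  let PF := MvPolynomial t F
  let K := FractionRing PF
  let _ : Algebra P R := (MvPolynomial.aeval (Subtype.val : t → R)).toAlgebra
  have hPR : Function.Injective (algebraMap P R) := ht.1
  have hX : ∀ i, algebraMap P R (MvPolynomial.X i) = i := fun i ↦ MvPolynomial.aeval_X _ i
  have : IsScalarTower A P R := IsScalarTower.of_algebraMap_eq fun x ↦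
    ((MvPolynomial.aeval (Subtype.val : t → R)).commutes x).symm
  let _ : Algebra P E := ((algebraMap R E).comp (algebraMap P R)).toAlgebra
  have : IsScalarTower P R E := IsScalarTower.of_algebraMap_eq' rfl
  have : IsScalarTower A P E := IsScalarTower.of_algebraMap_eq fun x ↦ by
    rw [IsScalarTower.algebraMap_apply P R E, ← IsScalarTower.algebraMap_apply A P R,
      ← IsScalarTower.algebraMap_apply A R E]
  have hPE : Function.Injective (algebraMap P E) := hRE.comp hPR
  let _ : Algebra PF E := (MvPolynomial.aeval (fun i : t ↦ algebraMap R E i)).toAlgebra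
  have : IsScalarTower F PF E := IsScalarTower.of_algebraMap_eq fun x ↦
    ((MvPolynomial.aeval (fun i : t ↦ algebraMap R E i)).commutes x).symm
  have hXE : ∀ i, algebraMap PF E (MvPolynomial.X i) = algebraMap R E i :=
    fun i ↦ MvPolynomial.aeval_X _ i
  let _ : Algebra P PF := MvPolynomial.algebraMvPolynomial
  have : IsScalarTower P PF E := by
    refine IsScalarTower.of_algebraMap_eq' (MvPolynomial.ringHom_ext (fun a ↦ ?_) fun i ↦ ?_)
    · change algebraMap P E (algebraMap A P a) = algebraMap PF E (MvPolynomial.map _ (MvPolynomial.C a))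
      rw [MvPolynomial.map_C, ← IsScalarTower.algebraMap_apply, IsScalarTower.algebraMap_apply A F E]
      exact IsScalarTower.algebraMap_apply F PF E _
    · change algebraMap P E (MvPolynomial.X i) = algebraMap PF E (MvPolynomial.map _ (MvPolynomial.X i))
      rw [MvPolynomial.map_X, hXE, IsScalarTower.algebraMap_apply P R E, hX]
  have hloc : IsLocalization ((nonZeroDivisors A).map (MvPolynomial.C : A →+* P)) PF :=
    MvPolynomial.isLocalization (nonZeroDivisors A) F
  have hPPF : Function.Injective (algebraMap P PF) := by
    have := hPE
    rw [IsScalarTower.algebraMap_eq P PF E, RingHom.coe_comp] at this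
    exact this.of_comp
  have hPFE : Function.Injective (algebraMap PF E) := by
    rw [injective_iff_map_eq_zero]
    intro z hz
    obtain ⟨⟨x, s⟩, hxs⟩ := IsLocalization.surj
      ((nonZeroDivisors A).map (MvPolynomial.C : A →+* P)) z
    have hs0 : (s : P) ≠ 0 := by
      obtain ⟨_, c, hc, rfl⟩ := s
      simpa using nonZeroDivisors.ne_zero hc
    have h1 : algebraMap P E x = 0 := by
      rw [IsScalarTower.algebraMap_apply P PF E, ← hxs, map_mul, hz, zero_mul]
    rw [(map_eq_zero_iff _ hPE).mp h1, map_zero] at hxs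
    exact (mul_eq_zero.mp hxs).resolve_right ((map_ne_zero_iff _ hPPF).mpr hs0)
  have : FaithfulSMul PF E := (faithfulSMul_iff_algebraMap_injective _ _).mpr hPFE
  let _ : Algebra K E := FractionRing.liftAlgebra PF E
  have : IsScalarTower PF K E := FractionRing.isScalarTower_liftAlgebra PF E
  have : IsScalarTower P PF K := inferInstance
  have : IsScalarTower P K E := IsScalarTower.of_algebraMap_eq fun x ↦ by
    rw [IsScalarTower.algebraMap_apply P PF K, ← IsScalarTower.algebraMap_apply PF K E,
      ← IsScalarTower.algebraMap_apply P PF E]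
  have : FaithfulSMul P K := by
    rw [faithfulSMul_iff_algebraMap_injective, IsScalarTower.algebraMap_eq P PF K]
    exact (IsFractionRing.injective PF K).comp hPPF
  -- `K` is built from `F[t]`, where geometric irreducibility is known, but `y` must be integral
  -- over `A[t]`, where reduction modulo `𝔟` takes place. So `K` is needed as the fraction field of
  -- both.
  have hfrac : IsFractionRing P K := by
    refine IsFractionRing.of_field P K fun z ↦ ?_
    obtain ⟨a, b, hb, rfl⟩ := IsFractionRing.div_surjective (A := PF) z
    obtain ⟨⟨a', s⟩, ha⟩ := IsLocalization.surj
      ((nonZeroDivisors A).map (MvPolynomial.C : A →+* P)) a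
    obtain ⟨⟨b', s'⟩, hb'⟩ := IsLocalization.surj
      ((nonZeroDivisors A).map (MvPolynomial.C : A →+* P)) b
    have hs0 : ∀ s : ((nonZeroDivisors A).map (MvPolynomial.C : A →+* P)),
        algebraMap P K s ≠ 0 := by
      rintro ⟨_, c, hc, rfl⟩
      rw [Ne, map_eq_zero_iff _ (FaithfulSMul.algebraMap_injective P K)]
      exact (MvPolynomial.C_eq_zero (σ := t)).not.mpr (nonZeroDivisors.ne_zero hc)
    refine ⟨a' * s', b' * s, ?_⟩
    have ha2 := congrArg (algebraMap PF K) ha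
    have hb2 := congrArg (algebraMap PF K) hb'
    simp only [map_mul, ← IsScalarTower.algebraMap_apply] at ha2 hb2 ⊢
    rw [← ha2, ← hb2]
    have h1 := hs0 s
    have h2 := hs0 s'
    have h3 : algebraMap PF K b ≠ 0 := by
      simpa using nonZeroDivisors.ne_zero hb
    rw [div_eq_div_iff h3 (mul_ne_zero (mul_ne_zero h3 h2) h1)]
    ring
  have : IsScalarTower A K E := IsScalarTower.of_algebraMap_eq fun x ↦ by
    rw [IsScalarTower.algebraMap_apply A P K, ← IsScalarTower.algebraMap_apply P K E,
      ← IsScalarTower.algebraMap_apply A P E]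
  have halgPR : Algebra.IsAlgebraic P R := by
    refine ⟨fun r ↦ ?_⟩
    obtain ⟨f, hf, hfr⟩ := ht.isAlgebraic.isAlgebraic r
    let e := ht.1.aevalEquiv
    refine ⟨f.map e.symm.toRingHom, ?_, ?_⟩
    · rwa [Ne, Polynomial.map_eq_zero_iff e.symm.injective]
    · rw [aeval_def, eval₂_map]
      rw [aeval_def] at hfr
      have he : (algebraMap P R).comp e.symm.toRingHom =
          algebraMap (Algebra.adjoin A (Set.range (Subtype.val : t → R))) R := by
        refine RingHom.ext fun x ↦ ?_
        obtain ⟨w, rfl⟩ := e.surjective x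
        change algebraMap P R (e.symm (e w)) = _
        rw [AlgEquiv.symm_apply_apply]
        rfl
      rwa [he]
  have : Algebra.IsAlgebraic R E := 
    (IsFractionRing.comap_isAlgebraic_iff (A := R) (K := E) (C := E)).mpr inferInstance
  have : Algebra.IsAlgebraic P E := Algebra.IsAlgebraic.trans P R E
  have : Algebra.IsAlgebraic K E :=
    (IsFractionRing.comap_isAlgebraic_iff (A := P) (K := K) (C := E)).mp inferInstance
  have : Algebra.EssFiniteType R E := Algebra.EssFiniteType.of_isLocalization E (nonZeroDivisors R)
  have : Algebra.EssFiniteType A E := Algebra.EssFiniteType.comp A R E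
  have : Algebra.EssFiniteType K E := Algebra.EssFiniteType.of_comp A K E
  have : FiniteDimensional K E := Algebra.finite_of_essFiniteType_of_isAlgebraic
  obtain ⟨y, g, hg, hgK, hsep, p, n, hp, hpow⟩ := exists_separable_generator P K E
  have hgy : aeval y g = 0 := by
    have := minpoly.aeval K y
    rw [← hgK, aeval_map_algebraMap] at this
    exact this
  have hyint : IsIntegral PF y := ⟨g.map (algebraMap P PF), hg.map _, by
    rw [← aeval_def, aeval_map_algebraMap, hgy]⟩
  have hgPF : g.map (algebraMap P PF) = minpoly PF y := by
    apply map_injective _ (IsFractionRing.injective PF K)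
    rw [Polynomial.map_map, ← IsScalarTower.algebraMap_eq, hgK,
      ← minpoly.isIntegrallyClosed_eq_field_fractions' K hyint]
  have hg1 : g ≠ 1 := by
    rintro rfl
    simp at hgy
  obtain ⟨a, ha, hirr⟩ := exists_forall_irreducible_map (A := A) (F := F) hg hg1 (by
    intro F' _ _ _ _ _ u v hu hv huv
    refine eq_one_of_mul_eq_map_minpoly hcl hPFE hyint ?_ F' hu hv ?_
    · rw [IsScalarTower.algebraMap_eq PF K E, ← Polynomial.map_map,
        ← minpoly.isIntegrallyClosed_eq_field_fractions' K hyint]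
      exact Polynomial.Separable.map hsep
    · rw [huv, ← hgPF, Polynomial.map_map]
      congr 1
      refine RingHom.ext fun x ↦ ?_
      change _ = MvPolynomial.map _ (MvPolynomial.map _ x)
      rw [MvPolynomial.map_map, ← IsScalarTower.algebraMap_eq])
  have hclear : ∀ z : E, ∃ d : P, d ≠ 0 ∧ ∃ f : P[X], aeval y f = algebraMap P E d * z ^ p ^ n := by
    intro z
    obtain ⟨f, hf⟩ : ∃ f : K[X], aeval y f = z ^ p ^ n := by
      have := hpow z
      rwa [Algebra.adjoin_singleton_eq_range_aeval] at this
    obtain ⟨b, hb, hbf⟩ := IsLocalization.integerNormalization_spec (nonZeroDivisors P) f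
    refine ⟨b, nonZeroDivisors.ne_zero hb, IsLocalization.integerNormalization (nonZeroDivisors P) f, ?_⟩
    rw [← aeval_map_algebraMap K, hbf, ← IsScalarTower.algebraMap_smul K b f, map_smul, hf,
      Algebra.smul_def, ← IsScalarTower.algebraMap_apply]
  choose d hd0 fd hfd using hclear
  obtain ⟨ν₁, hν₁, r₁, hr₁⟩ : ∃ ν₁ : P, ν₁ ≠ 0 ∧ ∃ r : R, algebraMap R E r = algebraMap P E ν₁ * y := by
    obtain ⟨r₁, r₂, hr₂, rfl⟩ := IsFractionRing.div_surjective (A := R) y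
    obtain ⟨c, ν, hν, h⟩ := Algebra.IsAlgebraic.exists_smul_eq_mul P r₁ (nonZeroDivisors.ne_zero hr₂)
    refine ⟨ν, hν, c, ?_⟩
    have h1 := congrArg (algebraMap R E) h
    rw [Algebra.smul_def, map_mul, map_mul, ← IsScalarTower.algebraMap_apply] at h1
    have h2 : algebraMap R E r₂ ≠ 0 := by simpa using nonZeroDivisors.ne_zero hr₂
    field_simp
    rw [h1, mul_comm]
  -- `ν` clears the denominators of `y` and of the `p ^ n`-th powers of all generators of `R`; this
  -- is enough, since Frobenius is a ring homomorphism.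
  let ν : P := ν₁ * ∏ r ∈ s, d (algebraMap R E r)
  have hν0 : ν ≠ 0 := mul_ne_zero hν₁ (Finset.prod_ne_zero_iff.mpr fun r _ ↦ hd0 _)
  have hall : ∀ r : R, ∃ (N : ℕ) (f : P[X]),
      aeval y f = algebraMap P E ν ^ N * algebraMap R E r ^ p ^ n := by
    intro r
    have hr : r ∈ Algebra.adjoin A (s : Set R) := hs ▸ trivial
    induction hr using Algebra.adjoin_induction with
    | mem r hr =>
      refine ⟨1, C (ν₁ * ∏ x ∈ s.erase r, d (algebraMap R E x)) * fd (algebraMap R E r), ?_⟩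
      simp only [map_mul, aeval_C, hfd, ν, ← Finset.mul_prod_erase s _ hr, pow_one]
      ring
    | algebraMap a =>
      refine ⟨0, C (algebraMap A P a ^ p ^ n), ?_⟩
      simp [← IsScalarTower.algebraMap_apply]
    | add a b _ _ ha hb =>
      obtain ⟨N₁, f₁, h₁⟩ := ha
      obtain ⟨N₂, f₂, h₂⟩ := hb
      refine ⟨N₁ + N₂, C (ν ^ N₂) * f₁ + C (ν ^ N₁) * f₂, ?_⟩
      simp only [map_add, map_mul, aeval_C, h₁, h₂, add_pow_expChar_pow, map_pow]
      ring
    | mul a b _ _ ha hb =>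
      obtain ⟨N₁, f₁, h₁⟩ := ha
      obtain ⟨N₂, f₂, h₂⟩ := hb
      refine ⟨N₁ + N₂, f₁ * f₂, ?_⟩
      simp only [map_mul, h₁, h₂]
      ring
  obtain ⟨m, hm⟩ := MvPolynomial.ne_zero_iff.mp hν0
  -- The factor `a` keeps `g` irreducible modulo `𝔟`; the nonzero coefficient of `ν` keeps `ν`
  -- nonzero modulo `𝔟`.
  refine ⟨algebraMap P R ν, (map_ne_zero_iff _ hPR).mpr hν0, a * ν.coeff m, mul_ne_zero ha hm,
    fun 𝔟 h𝔟 ha𝔟 ↦ ?_⟩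
  let _ : Field (A ⧸ 𝔟) := Ideal.Quotient.field 𝔟
  let π : A →+* A ⧸ 𝔟 := Ideal.Quotient.mk 𝔟
  have hπ : ∀ x, π x = 0 ↔ x ∈ 𝔟 := fun x ↦ Ideal.Quotient.eq_zero_iff_mem
  have haπ : π (a * ν.coeff m) ≠ 0 := by rwa [Ne, hπ]
  rw [map_mul] at haπ
  have hgb := hirr π (left_ne_zero_of_mul haπ)
  set gb := g.map (MvPolynomial.map π) with hgb_def
  have := AdjoinRoot.isDomain_of_prime hgb.prime
  let Θ : P[X] →+* (MvPolynomial t (A ⧸ 𝔟))[X] := Polynomial.mapRingHom (MvPolynomial.map π)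
  have hker : RingHom.ker (MvPolynomial.map π : P →+* _) = 𝔟.map MvPolynomial.C := by
    rw [MvPolynomial.ker_map, Ideal.mk_ker]
  obtain ⟨𝔓, h1, h2, h3, h4⟩ := exists_least_prime_of_pow_mem (P := P) (D := AdjoinRoot gb) hRE (y := y) (g := g)
    (by
      intro f hf
      rw [← map_dvd_map _ (IsFractionRing.injective P K) hg, hgK]
      exact minpoly.dvd K y (by rwa [aeval_map_algebraMap]))
    p n hall ⟨r₁ * algebraMap P R (∏ r ∈ s, d (algebraMap R E r)), by
      simp only [ν, map_mul, hr₁, ← IsScalarTower.algebraMap_apply]; ring⟩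
    (𝔟.map (MvPolynomial.C : A →+* P)) ((AdjoinRoot.mk gb).comp Θ)
    (by simp [Θ, ← hgb_def])
    (by
      intro i hi
      rw [← hker, RingHom.mem_ker] at hi
      simp [Θ, hi])
    (by
      intro h0
      have h0' : AdjoinRoot.mk gb (C (MvPolynomial.map π ν)) = 0 := by simpa [Θ] using h0
      rw [AdjoinRoot.mk_eq_zero] at h0'
      have hne : MvPolynomial.map π ν ≠ 0 := by
        intro h
        have := congrArg (MvPolynomial.coeff m) h
        rw [MvPolynomial.coeff_map] at this
        exact right_ne_zero_of_mul haπ this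
      -- `ν` is constant in `X`, whereas the monic irreducible `gb` has positive degree in `X`.
      refine (hg.map _).not_dvd_of_natDegree_lt (C_ne_zero.mpr hne) ?_ h0'
      rw [natDegree_C]
      exact Nat.pos_of_ne_zero fun h ↦ hgb.ne_one ((hg.map _).natDegree_eq_zero.mp h))
    hgy
    (by
      intro f hf
      rw [RingHom.comp_apply, AdjoinRoot.mk_eq_zero] at hf
      obtain ⟨c, hc⟩ := hf
      obtain ⟨c', rfl⟩ := (Polynomial.map_surjective (MvPolynomial.map π : P →+* _)
        (MvPolynomial.map_surjective _ Ideal.Quotient.mk_surjective)) c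
      have : f - g * c' ∈ RingHom.ker Θ := by
        rw [RingHom.mem_ker, map_sub, hc, map_mul]
        simp [Θ, hgb_def]
      rw [Polynomial.ker_mapRingHom, hker] at this
      have h := Ideal.add_mem _ (Ideal.mem_sup_left this)
        (Ideal.mem_sup_right (Ideal.mul_mem_right c' _ (Ideal.mem_span_singleton_self g)))
      rwa [sub_add_cancel] at h)
  have hconv : ∀ Q : Ideal R, 𝔟.map (MvPolynomial.C : A →+* P) ≤ Q.comap (algebraMap P R) ↔
      𝔟 ≤ Q.comap (algebraMap A R) := by
    intro Q
    rw [Ideal.map_le_iff_le_comap, Ideal.comap_comap, IsScalarTower.algebraMap_eq A P R]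
    rfl
  exact ⟨𝔓, h1, (hconv 𝔓).mp h2, h3, fun Q hQ h𝔟Q hνQ ↦ h4 Q hQ ((hconv Q).mpr h𝔟Q) hνQ⟩

end GenericFibre

/-! ### Finiteness of integral closure over a perfect field -/

section IntegralClosure

/-- The iterated Frobenius endomorphism of a polynomial ring over a perfect field is finite. -/
theorem MvPolynomial.finite_iterateFrobenius (k : Type*) [Field k] [PerfectField k] (σ : Type*)
    [Finite σ] (p n : ℕ) [ExpChar k p] [ExpChar (MvPolynomial σ k) p] :
    (iterateFrobenius (MvPolynomial σ k) p n).Finite := by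
  have : PerfectRing k p := PerfectField.toPerfectRing p
  let f := iterateFrobenius (MvPolynomial σ k) p n
  have hint : f.IsIntegral := fun x ↦
    ⟨Polynomial.X ^ p ^ n - Polynomial.C x, Polynomial.monic_X_pow_sub_C _ (pow_pos (expChar_pos k p) n).ne', by
      simp [f, iterateFrobenius_def]⟩
  refine hint.to_finite ?_
  let _ := f.toAlgebra
  have := Fintype.ofFinite σ
  classical
  refine ⟨⟨Finset.univ.image MvPolynomial.X, top_le_iff.mp fun x _ ↦ ?_⟩⟩
  induction x using MvPolynomial.induction_on with
  | C a =>
    obtain ⟨b, hb⟩ := (bijective_iterateFrobenius k p n).2 a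
    have : MvPolynomial.C a = algebraMap (MvPolynomial σ k) (MvPolynomial σ k) (MvPolynomial.C b) := by
      change _ = iterateFrobenius _ _ _ _
      rw [← hb, iterateFrobenius_def, iterateFrobenius_def, map_pow]
    rw [this]
    exact Subalgebra.algebraMap_mem _ _
  | add a b ha hb => exact add_mem (ha trivial) (hb trivial)
  | mul_X a i ha => exact mul_mem (ha trivial) (Algebra.subset_adjoin (by simp))

/-- Restriction of scalars along `f` makes `D` a finite module over the noetherian ring `P`, with
`C` embedded in it. It is meant for `f` a power of Frobenius. -/
theorem Module.Finite.of_injective_semilinear {P Q C D : Type*} [CommRing P] [IsNoetherianRing P]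
    [CommRing Q] [AddCommGroup C] [Module P C] [AddCommGroup D] [Module Q D] [Module.Finite Q D]
    {f : P →+* Q} (hf : f.Finite) (F : C →ₛₗ[f] D) (hF : Function.Injective F) :
    Module.Finite P C := by
  let _ := f.toAlgebra
  let _ := Module.compHom D f
  have : IsScalarTower P Q D := IsScalarTower.of_algebraMap_smul fun _ _ ↦ rfl
  have : Module.Finite P Q := hf
  have : Module.Finite P D := Module.Finite.trans Q D
  exact Module.Finite.of_injective
    ({ toFun := F, map_add' := map_add F, map_smul' := fun c x ↦ F.map_smulₛₗ c x } : C →ₗ[P] D) hF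

/-- The integral closure of a polynomial ring over a perfect field in a finite extension of its
field of fractions is finite. -/
theorem MvPolynomial.finite_of_isIntegralClosure {k : Type*} [Field k] [PerfectField k] {σ : Type*}
    [Finite σ] (K E C : Type*) [Field K] [Algebra (MvPolynomial σ k) K]
    [IsFractionRing (MvPolynomial σ k) K] [Field E] [Algebra K E] [FiniteDimensional K E]
    [Algebra (MvPolynomial σ k) E] [IsScalarTower (MvPolynomial σ k) K E] [CommRing C]
    [Algebra (MvPolynomial σ k) C] [Algebra C E] [IsScalarTower (MvPolynomial σ k) C E]
    [IsIntegralClosure C (MvPolynomial σ k) E] : Module.Finite (MvPolynomial σ k) C := by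
  let P := MvPolynomial σ k
  let S := separableClosure K E
  obtain ⟨p, hpk⟩ := ExpChar.exists k
  have : ExpChar P p := expChar_of_injective_algebraMap (MvPolynomial.C_injective σ k) p
  have : ExpChar K p := expChar_of_injective_algebraMap (IsFractionRing.injective P K) p
  have : ExpChar S p := expChar_of_injective_algebraMap (algebraMap K S).injective p
  have : ExpChar E p := expChar_of_injective_algebraMap (algebraMap K E).injective p
  have hCE : Function.Injective (algebraMap C E) := IsIntegralClosure.algebraMap_injective C P E
  have : ExpChar C p := by
    refine expChar_of_injective_algebraMap (R := P) (A := C) ?_ p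
    have h : Function.Injective (algebraMap P E) := by
      rw [IsScalarTower.algebraMap_eq P K E]
      exact (algebraMap K E).injective.comp (IsFractionRing.injective P K)
    rw [IsScalarTower.algebraMap_eq P C E, RingHom.coe_comp] at h
    exact h.of_comp
  have : IsScalarTower P S E := IsScalarTower.of_algebraMap_eq fun _ ↦ rfl
  let n := IsPurelyInseparable.exponent S E
  let CS := integralClosure P S
  have : Module.Finite P CS := IsIntegralClosure.finite P K S CS
  let f := iterateFrobenius P p n
  have hf : f.Finite := MvPolynomial.finite_iterateFrobenius k σ p n
  -- Raising to the power `p ^ n` sends `C` into the integral closure in the separable part, whose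
  -- finiteness is classical. This map is semilinear over Frobenius on `P`, which is finite because
  -- `k` is perfect.
  have hF : ∀ c : C, ∃ d : CS, ((d : S) : E) = algebraMap C E c ^ p ^ n := by
    intro c
    obtain ⟨w, hw⟩ := IsPurelyInseparable.exponent_def' S p (algebraMap C E c)
    refine ⟨⟨w, ?_⟩, hw⟩
    have hint : IsIntegral P (algebraMap S E w) := by
      rw [hw]
      exact (IsIntegralClosure.isIntegral_iff.mpr ⟨c, rfl⟩ : IsIntegral P (algebraMap C E c)).pow _
    exact (isIntegral_algebraMap_iff (algebraMap S E).injective).mp hint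
  choose F hF using hF
  have hinj : Function.Injective (fun d : CS ↦ ((d : S) : E)) :=
    Subtype.val_injective.comp Subtype.val_injective
  refine Module.Finite.of_injective_semilinear hf
    ({ toFun := F, map_add' := fun a b ↦ hinj ?_, map_smul' := fun a b ↦ hinj ?_ } : C →ₛₗ[f] CS) ?_
  · change ((F (a + b) : S) : E) = ((F a : S) : E) + ((F b : S) : E)
    rw [hF, hF, hF, map_add, add_pow_expChar_pow]
  · change ((F (a • b) : S) : E) = ((f a • F b : CS) : S)
    rw [hF]
    have : ((f a • F b : CS) : S) = algebraMap P S (f a) * (F b : S) := by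
      rw [← Algebra.smul_def]; rfl
    rw [this]
    change _ = (algebraMap P S (f a) : E) * ((F b : S) : E)
    have h2 : (algebraMap P S (f a) : E) = algebraMap P E (f a) :=
      (IsScalarTower.algebraMap_apply P S E _).symm
    rw [h2, hF, Algebra.smul_def, map_mul, ← IsScalarTower.algebraMap_apply, mul_pow]
    simp [f, iterateFrobenius_def]
  · intro a b hab
    have h : algebraMap C E a ^ p ^ n = algebraMap C E b ^ p ^ n := by
      rw [← hF, ← hF]
      exact congrArg (fun d : CS ↦ ((d : S) : E)) hab
    exact hCE (iterateFrobenius_inj E p n (by simpa [iterateFrobenius_def] using h))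

/-- A finite type domain over a perfect field has finite integral closure. -/
theorem finite_integralClosure_fractionRing (k S : Type*) [Field k] [PerfectField k] [CommRing S]
    [IsDomain S] [Algebra k S] [Algebra.FiniteType k S] :
    Module.Finite S (integralClosure S (FractionRing S)) := by
  obtain ⟨s, g, hg, hfin⟩ := exists_finite_inj_algHom_of_fg k S
  let P := MvPolynomial (Fin s) k
  let E := FractionRing S
  let _ : Algebra P S := g.toRingHom.toAlgebra
  have : Module.Finite P S := hfin
  have hPS : Function.Injective (algebraMap P S) := hg
  have : FaithfulSMul P S := (faithfulSMul_iff_algebraMap_injective _ _).mpr hPS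
  let K := FractionRing P
  let _ : Algebra K E := FractionRing.liftAlgebra P E
  have : IsScalarTower P K E := FractionRing.isScalarTower_liftAlgebra P E
  have : Algebra.IsIntegral P S := inferInstance
  have : Algebra.IsAlgebraic S E :=
    (IsFractionRing.comap_isAlgebraic_iff (A := S) (K := E) (C := E)).mpr inferInstance
  have : Algebra.IsAlgebraic P E := Algebra.IsAlgebraic.trans P S E
  have : Algebra.IsAlgebraic K E :=
    (IsFractionRing.comap_isAlgebraic_iff (A := P) (K := K) (C := E)).mp inferInstance
  have : Algebra.EssFiniteType S E := Algebra.EssFiniteType.of_isLocalization E (nonZeroDivisors S)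
  have : Algebra.EssFiniteType P E := Algebra.EssFiniteType.comp P S E
  have : Algebra.EssFiniteType K E := Algebra.EssFiniteType.of_comp P K E
  have : FiniteDimensional K E := Algebra.finite_of_essFiniteType_of_isAlgebraic
  let C := integralClosure S E
  -- With `P` a Noether normalisation, `S` is integral over `P`, so the two integral closures
  -- coincide.
  have : IsIntegralClosure C P E := by
    refine ⟨Subtype.val_injective, fun {x} ↦ ⟨fun h ↦ ⟨⟨x, h.tower_top⟩, rfl⟩, ?_⟩⟩
    rintro ⟨y, rfl⟩
    exact isIntegral_trans (R := P) (A := S) _ y.2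
  have : Module.Finite P C := MvPolynomial.finite_of_isIntegralClosure K E C
  exact Module.Finite.of_restrictScalars_finite P S C

end IntegralClosure

/-! ### Triangularising an operator on sections -/

section EigenvectorPair

/-- If `A` is an injective endomorphism of a finite-dimensional space `V ⊆ K`, `dim V ≥ 2`, with
`A t / A s = c τ(t / s)`, then `τ` maps a non-constant function to an affine function of it. -/
theorem exists_map_eq_affine {k K : Type*} [Field k] [IsAlgClosed k] [Field K] [Algebra k K]
    (τ : K →ₐ[k] K) (V : Submodule k K) [FiniteDimensional k V] (hV : 2 ≤ Module.finrank k V)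
    (A : V →ₗ[k] V) (hA : Function.Injective A)
    (h : ∀ s t : V, s ≠ 0 → t ≠ 0 → ∃ c : k,
      (A t : K) * τ s = algebraMap k K c * ((A s : K) * τ t)) :
    ∃ x : K, x ∉ (algebraMap k K).range ∧ ∃ α β : k, τ x = algebraMap k K α * x + algebraMap k K β := by
  have : Nontrivial V := Module.nontrivial_of_finrank_pos (R := k) (by omega)
  obtain ⟨l, hl⟩ := Module.End.exists_eigenvalue A
  obtain ⟨s, hs, hs0⟩ := hl.exists_hasEigenvector
  rw [Module.End.mem_eigenspace_iff] at hs
  let N : Submodule k V := k ∙ s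
  have hN : N ≤ N.comap A := by
    rw [Submodule.span_singleton_le_iff_mem, Submodule.mem_comap, hs]
    exact N.smul_mem _ (Submodule.mem_span_singleton_self s)
  have hfin : Module.finrank k N = 1 := finrank_span_singleton hs0
  have : Nontrivial (V ⧸ N) := by
    rw [Submodule.Quotient.nontrivial_iff]
    intro h
    rw [h, finrank_top] at hfin
    omega
  -- A second eigenvector need not exist in `V`, but one exists modulo `s`. It lifts to `t ∉ k s`
  -- with `A t = m t + b s`.
  obtain ⟨m, hm⟩ := Module.End.exists_eigenvalue (N.mapQ N A hN)
  obtain ⟨t', ht, ht0⟩ := hm.exists_hasEigenvector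
  obtain ⟨t, rfl⟩ := N.mkQ_surjective t'
  rw [Module.End.mem_eigenspace_iff] at ht
  have ht1 : A t - m • t ∈ N := by
    rw [← Submodule.Quotient.mk_eq_zero, Submodule.Quotient.mk_sub, Submodule.Quotient.mk_smul, sub_eq_zero]
    exact ht
  have htN : t ∉ N := fun h ↦ ht0 (by simpa using h)
  obtain ⟨b, hb⟩ := Submodule.mem_span_singleton.mp ht1
  have ht00 : t ≠ 0 := fun h ↦ htN (h ▸ N.zero_mem)
  have hAt : (A t : K) = algebraMap k K m * t + algebraMap k K b * s := by
    have : A t = m • t + b • s := by rw [hb]; abel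
    rw [this]
    simp [Algebra.smul_def]
  have hAs : (A s : K) = algebraMap k K l * s := by rw [hs]; simp [Algebra.smul_def]
  have hsK : (s : K) ≠ 0 := by simpa using hs0
  have htK : (t : K) ≠ 0 := by simpa using ht00
  obtain ⟨c, hc⟩ := h s t hs0 ht00
  have hτs : τ s ≠ 0 := by simpa using hsK
  have hAt0 : (A t : K) ≠ 0 := by
    simpa using (map_ne_zero_iff A hA).mpr ht00
  have hl0 : (A s : K) ≠ 0 := by
    simpa using (map_ne_zero_iff A hA).mpr hs0
  have hc0 : algebraMap k K c ≠ 0 := by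
    intro h0
    rw [h0, zero_mul] at hc
    exact mul_ne_zero hAt0 hτs hc
  rw [hAs] at hl0
  have hl1 := left_ne_zero_of_mul hl0
  refine ⟨t / s, ?_, m / (c * l), b / (c * l), ?_⟩
  · rintro ⟨a, ha⟩
    apply htN
    refine Submodule.mem_span_singleton.mpr ⟨a, Subtype.ext ?_⟩
    rw [Submodule.coe_smul, Algebra.smul_def, ha, div_mul_cancel₀ _ hsK]
  · rw [hAt, hAs] at hc
    rw [map_div₀, map_div₀, map_div₀, map_mul]
    field_simp
    linear_combination (-1) * hc

end EigenvectorPair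

/-! ### A denominator for the integral closure -/

section Conductor

/-- The conductor of a noetherian domain with finite integral closure is nonzero. -/
theorem exists_conductor (S : Type*) [CommRing S] [IsDomain S] [IsNoetherianRing S]
    [Module.Finite S (integralClosure S (FractionRing S))] :
    ∃ s : S, s ≠ 0 ∧ ∀ a b : S, a ≠ 0 → ∀ I : Ideal S, a ∈ I → (∀ x ∈ I, ∃ y ∈ I, b * x = a * y) →
      ∃ d, s * b = d * a := by
  classical
  let F := FractionRing S
  obtain ⟨T, hT⟩ := Module.Finite.fg_top (R := S) (M := integralClosure S F)
  obtain ⟨s, hs⟩ := IsLocalization.exist_integer_multiples_of_finset (nonZeroDivisors S)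
    (T.image (Subtype.val : integralClosure S F → F))
  have hle : Submodule.span S (T : Set (integralClosure S F)) ≤
      (LinearMap.range (Algebra.linearMap S F)).comap
        ((LinearMap.lsmul S F s).comp (integralClosure S F).val.toLinearMap) := by
    rw [Submodule.span_le]
    intro x hx
    obtain ⟨d, hd⟩ := hs x (Finset.mem_image_of_mem _ hx)
    exact ⟨d, hd⟩
  refine ⟨s, nonZeroDivisors.coe_ne_zero s, fun a b ha I haI hI ↦ ?_⟩
  have haF : algebraMap S F a ≠ 0 := by simpa using ha
  -- `b / a` preserves the nonzero finitely generated module `I`, hence is integral. The element `s`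
  -- clears the denominators of generators of the integral closure.
  have hint : IsIntegral S (algebraMap S F b / algebraMap S F a) := by
    refine isIntegral_of_smul_mem_submodule (M := F) (Submodule.map (Algebra.linearMap S F) I) ?_
      ((IsNoetherian.noetherian I).map _) _ ?_
    · intro h
      have : algebraMap S F a ∈ Submodule.map (Algebra.linearMap S F) I := ⟨a, haI, rfl⟩
      rw [h, Submodule.mem_bot] at this
      exact haF this
    · rintro _ ⟨x, hx, rfl⟩
      obtain ⟨y, hy, h⟩ := hI x hx
      refine ⟨y, hy, ?_⟩
      rw [Algebra.linearMap_apply, Algebra.linearMap_apply, smul_eq_mul, div_mul_eq_mul_div,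
        eq_div_iff haF, ← map_mul, ← map_mul, h, mul_comm]
  obtain ⟨d, hd⟩ := hle (hT ▸ trivial : (⟨_, hint⟩ : integralClosure S F) ∈ _)
  refine ⟨d, IsFractionRing.injective S F ?_⟩
  change algebraMap S F d = (s : S) • (algebraMap S F b / algebraMap S F a) at hd
  rw [map_mul, map_mul, hd, Algebra.smul_def, mul_assoc, div_mul_cancel₀ _ haF]

end Conductor

/-! ### Finiteness of sections of `O(m)` by means of a graded ring -/

section GradedSubalgebra

open Polynomial

variable {k K : Type*} [Field k] [Field K] [Algebra k K]

/-- The graded algebra `⨁ Wⁿ Tⁿ ⊆ K[T]` generated by `W T`. -/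
noncomputable def gradedSubalgebra (W : Submodule k K) : Subalgebra k K[X] where
  carrier := {p | ∀ n, p.coeff n ∈ W ^ n}
  add_mem' := fun ha hb n ↦ by rw [coeff_add]; exact add_mem (ha n) (hb n)
  mul_mem' := fun {a b} ha hb n ↦ by
    rw [coeff_mul]
    refine sum_mem fun x hx ↦ ?_
    rw [← Finset.HasAntidiagonal.mem_antidiagonal.mp hx, pow_add]
    exact Submodule.mul_mem_mul (ha _) (hb _)
  algebraMap_mem' := fun c n ↦ by
    rw [Polynomial.algebraMap_apply, coeff_C]
    split_ifs with h
    · rw [h, pow_zero]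
      exact Submodule.algebraMap_mem c
    · exact zero_mem _

theorem monomial_mem_gradedSubalgebra {W : Submodule k K} {n : ℕ} {w : K} (hw : w ∈ W ^ n) :
    monomial n w ∈ gradedSubalgebra W := fun m ↦ by
  rw [coeff_monomial]
  split_ifs with h
  · exact h ▸ hw
  · exact zero_mem _

/-- `Wⁿ` is spanned by products of `n` elements of `s`. For finite `s` this makes the graded algebra
finitely generated, hence noetherian. -/
theorem gradedSubalgebra_span (s : Set K) :
    gradedSubalgebra (Submodule.span k s) = Algebra.adjoin k (monomial 1 '' s) := by
  refine le_antisymm (fun p hp ↦ ?_) (Algebra.adjoin_le ?_)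
  · rw [p.as_sum_support]
    suffices h : ∀ n, ∀ w ∈ Submodule.span k s ^ n,
        monomial n w ∈ Algebra.adjoin k (monomial 1 '' s) from sum_mem fun n _ ↦ h n _ (hp n)
    intro n w hw
    induction n generalizing w with
    | zero =>
      rw [pow_zero, Submodule.mem_one] at hw
      obtain ⟨c, rfl⟩ := hw
      exact Subalgebra.algebraMap_mem _ c
    | succ n ih =>
      rw [pow_succ] at hw
      induction hw using Submodule.mul_induction_on' with
      | mem_mul_mem a ha b hb =>
        rw [← monomial_mul_monomial]
        refine mul_mem (ih a ha) ?_
        induction hb using Submodule.span_induction with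
        | mem x hx => exact Algebra.subset_adjoin ⟨x, hx, rfl⟩
        | zero => simp
        | add x y _ _ hx hy => rw [map_add]; exact add_mem hx hy
        | smul c x _ hx => rw [← smul_monomial]; exact Subalgebra.smul_mem _ hx c
      | add x _ y _ hx hy => rw [map_add]; exact add_mem hx hy
  · rintro _ ⟨x, hx, rfl⟩
    exact monomial_mem_gradedSubalgebra (by rw [pow_one]; exact Submodule.subset_span hx)

/-- Pigeonhole: a monomial of large degree in the `ξ` contains a high power of some `ξ i`, and that
power absorbs `z`. -/
theorem exists_forall_mul_mem_pow {ι : Type*} [Fintype ι] (ξ : ι → K) {z : K} {m : ℕ}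
    (hz : ∀ i, ∃ N, z * ξ i ^ N ∈ Submodule.span k (Set.range ξ) ^ (N + m)) :
    ∃ e, ∀ n, e ≤ n → ∀ w ∈ Submodule.span k (Set.range ξ) ^ n,
      z * w ∈ Submodule.span k (Set.range ξ) ^ (n + m) := by
  classical
  set W := Submodule.span k (Set.range ξ)
  have hξ : ∀ i, ξ i ∈ W := fun i ↦ Submodule.subset_span ⟨i, rfl⟩
  choose N hN using hz
  let N₀ := ∑ i, N i
  refine ⟨Fintype.card ι * N₀ + 1, fun n hn w hw ↦ ?_⟩
  rw [Submodule.span_pow] at hw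
  induction hw using Submodule.span_induction with
  | mem w hw =>
    obtain ⟨g, rfl⟩ := Set.mem_pow.mp hw
    choose g' hg' using fun j ↦ (g j).2
    rw [List.prod_ofFn]
    have : ∏ j, ((g j : K)) = ∏ j, ξ (g' j) := Finset.prod_congr rfl fun j _ ↦ (hg' j).symm
    rw [this]
    obtain ⟨i, -, hi⟩ := Finset.exists_lt_card_fiber_of_mul_lt_card_of_maps_to (s := Finset.univ)
      (t := Finset.univ) (f := g') (n := N₀) (fun _ _ ↦ Finset.mem_univ _) (by simp; omega)
    have hNi : N i ≤ N₀ := Finset.single_le_sum (fun _ _ ↦ Nat.zero_le _) (Finset.mem_univ i)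
    obtain ⟨s, hs, hsc⟩ := Finset.exists_subset_card_eq (hNi.trans hi.le)
    rw [← Finset.prod_mul_prod_compl s]
    have h1 : ∏ j ∈ s, ξ (g' j) = ξ i ^ N i := by
      rw [← hsc]
      exact Finset.prod_eq_pow_card fun j hj ↦ by rw [(Finset.mem_filter.mp (hs hj)).2]
    have h2 : ∀ t : Finset (Fin n), ∏ j ∈ t, ξ (g' j) ∈ W ^ t.card := by
      intro t
      induction t using Finset.induction_on with
      | empty => simp
      | insert a t hat ih =>
        rw [Finset.prod_insert hat, Finset.card_insert_of_notMem hat, pow_succ']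
        exact Submodule.mul_mem_mul (hξ _) ih
    rw [h1, ← mul_assoc]
    have h3 : n + m = (N i + m) + sᶜ.card := by
      rw [Finset.card_compl, hsc, Fintype.card_fin]
      have := Finset.card_le_univ s
      rw [hsc, Fintype.card_fin] at this
      omega
    rw [h3, pow_add]
    exact Submodule.mul_mem_mul (hN i) (h2 _)
  | zero => simp
  | add x y _ _ hx hy => rw [mul_add]; exact add_mem hx hy
  | smul c x _ hx => rw [mul_smul_comm]; exact Submodule.smul_mem _ c hx

/-- A polynomial in the ratios `ξ j / ξ i` becomes homogeneous after multiplication by a power of `ξ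
i`. -/
theorem exists_mul_pow_mem_pow {ι : Type*} (ξ : ι → K) {i : ι} (hi : ξ i ≠ 0) {h : K}
    (hh : h ∈ Algebra.adjoin k (Set.range fun j ↦ ξ j / ξ i)) :
    ∃ N, h * ξ i ^ N ∈ Submodule.span k (Set.range ξ) ^ N := by
  set W := Submodule.span k (Set.range ξ)
  have hξ : ∀ i, ξ i ∈ W := fun i ↦ Submodule.subset_span ⟨i, rfl⟩
  induction hh using Algebra.adjoin_induction with
  | mem x hx =>
    obtain ⟨j, rfl⟩ := hx
    refine ⟨1, ?_⟩
    dsimp only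
    rw [pow_one, pow_one, div_mul_cancel₀ _ hi]
    exact hξ j
  | algebraMap c => exact ⟨0, by simp⟩
  | add x y _ _ hx hy =>
    obtain ⟨N₁, h₁⟩ := hx
    obtain ⟨N₂, h₂⟩ := hy
    refine ⟨N₁ + N₂, ?_⟩
    have : (x + y) * ξ i ^ (N₁ + N₂) = x * ξ i ^ N₁ * ξ i ^ N₂ + ξ i ^ N₁ * (y * ξ i ^ N₂) := by ring
    rw [this, pow_add]
    exact add_mem (Submodule.mul_mem_mul h₁ (Submodule.pow_mem_pow W (hξ i) _))
      (Submodule.mul_mem_mul (Submodule.pow_mem_pow W (hξ i) _) h₂)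
  | mul x y _ _ hx hy =>
    obtain ⟨N₁, h₁⟩ := hx
    obtain ⟨N₂, h₂⟩ := hy
    refine ⟨N₁ + N₂, ?_⟩
    have : x * y * ξ i ^ (N₁ + N₂) = x * ξ i ^ N₁ * (y * ξ i ^ N₂) := by ring
    rw [this, pow_add]
    exact Submodule.mul_mem_mul h₁ h₂

/-- The functions that are regular multiples of `ξᵢᵐ` on the chart with coordinate ring
`k[ξⱼ / ξᵢ]`, for all `i`, form a finite-dimensional space. -/
theorem finiteDimensional_of_forall_mem_adjoin [PerfectField k] {ι : Type*} [Finite ι] (ξ : ι → K)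
    (hξ0 : ∃ i, ξ i ≠ 0) (m : ℕ) (Z : Submodule k K)
    (hZ : ∀ z ∈ Z, ∀ i, ξ i ≠ 0 → ∃ h ∈ Algebra.adjoin k (Set.range fun j ↦ ξ j / ξ i),
      z = ξ i ^ m * h) : FiniteDimensional k Z := by
  classical
  have := Fintype.ofFinite ι
  set W := Submodule.span k (Set.range ξ) with hW
  have hξ : ∀ i, ξ i ∈ W := fun i ↦ Submodule.subset_span ⟨i, rfl⟩
  let S := gradedSubalgebra W
  have hfg : Algebra.FiniteType k S := by
    refine Subalgebra.fg_iff_finiteType S |>.mp ?_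
    change (gradedSubalgebra W).FG
    rw [hW, gradedSubalgebra_span]
    exact Subalgebra.fg_def.mpr ⟨_, (Set.finite_range ξ).image _, rfl⟩
  have : IsNoetherianRing S := Algebra.FiniteType.isNoetherianRing k S
  have := finite_integralClosure_fractionRing k S
  obtain ⟨s, hs0, hs⟩ := exists_conductor S
  -- Multiplication by this coefficient of the conductor element will embed `Z` into `W ^ (m + j)`.
  obtain ⟨j, hj⟩ : ∃ j, (s : K[X]).coeff j ≠ 0 := by
    by_contra! h
    exact hs0 (Subtype.ext (Polynomial.ext fun n ↦ by simpa using h n))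
  have key : ∀ z ∈ Z, z * (s : K[X]).coeff j ∈ W ^ (m + j) := by
    intro z hz
    obtain ⟨e, he⟩ := exists_forall_mul_mem_pow (k := k) ξ (z := z) (m := m) (by
      intro i
      by_cases hi : ξ i = 0
      · exact ⟨1, by simp [hi]⟩
      obtain ⟨h, hh, rfl⟩ := hZ z hz i hi
      obtain ⟨N, hN⟩ := exists_mul_pow_mem_pow ξ hi hh
      refine ⟨N, ?_⟩
      rw [add_comm, pow_add, mul_assoc]
      exact Submodule.mul_mem_mul (Submodule.pow_mem_pow W (hξ i) _) hN)
    -- Multiplication by `z T^m` preserves the elements of `S` whose terms all have degree at least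
    -- `e`. Hence `z T^m`, written as `b / a` below, is integral over `S`, and `s` multiplies it
    -- into `S`.
    let I : Ideal S :=
      { carrier := {a | ∀ n < e, (a : K[X]).coeff n = 0}
        zero_mem' := fun n _ ↦ by simp
        add_mem' := fun {a b} ha hb n hn ↦ by
          rw [Subalgebra.coe_add, coeff_add, ha n hn, hb n hn, add_zero]
        smul_mem' := fun c a ha n hn ↦ by
          rw [smul_eq_mul, Subalgebra.coe_mul, coeff_mul]
          refine Finset.sum_eq_zero fun x hx ↦ ?_
          rw [ha x.2 (by have := Finset.HasAntidiagonal.mem_antidiagonal.mp hx; omega), mul_zero] }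
    have hmul : ∀ a ∈ I, ∃ b ∈ I, (b : K[X]) = C z * ((a : K[X]) * X ^ m) := by
      intro a ha
      refine ⟨⟨C z * ((a : K[X]) * X ^ m), fun n ↦ ?_⟩, fun n hn ↦ ?_, rfl⟩
      · rw [coeff_C_mul, coeff_mul_X_pow']
        split_ifs with hmn
        · by_cases hne : n - m < e
          · rw [ha _ hne, mul_zero]; exact zero_mem _
          · have := he (n - m) (by omega) _ (a.2 (n - m))
            rwa [Nat.sub_add_cancel hmn] at this
        · rw [mul_zero]; exact zero_mem _
      · change (C z * ((a : K[X]) * X ^ m)).coeff n = 0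
        rw [coeff_C_mul, coeff_mul_X_pow']
        split_ifs with hmn
        · rw [ha _ (by omega), mul_zero]
        · rw [mul_zero]
    obtain ⟨i, hi⟩ := hξ0
    let a : S := ⟨monomial e (ξ i ^ e), monomial_mem_gradedSubalgebra (Submodule.pow_mem_pow W (hξ i) _)⟩
    have haI : a ∈ I := fun n hn ↦ by simp only [a, coeff_monomial]; rw [if_neg (by omega)]
    have ha0' : (a : K[X]) ≠ 0 := by simp [a, hi]
    obtain ⟨b, -, hb⟩ := hmul a haI
    obtain ⟨d, hd⟩ := hs a b (fun h ↦ ha0' (by rw [h]; rfl)) I haI fun x hx ↦ by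
      obtain ⟨y, hy, hyx⟩ := hmul x hx
      exact ⟨y, hy, Subtype.ext (by simp only [Subalgebra.coe_mul, hb, hyx]; ring)⟩
    have h2 : C z * ((s : K[X]) * X ^ m) = (d : K[X]) := by
      have h3 := congrArg (Subtype.val : S → K[X]) hd
      simp only [Subalgebra.coe_mul, hb] at h3
      apply mul_right_cancel₀ ha0'
      rw [← h3]; ring
    have h4 := d.2 (m + j)
    rw [← h2, coeff_C_mul, add_comm m j, coeff_mul_X_pow, add_comm] at h4
    exact h4
  have : FiniteDimensional k (W ^ (m + j) : Submodule k K) := by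
    rw [FiniteDimensional, Module.Finite.iff_fg]
    exact (Submodule.fg_span (Set.finite_range ξ)).pow _
  let φ : Z →ₗ[k] (W ^ (m + j) : Submodule k K) :=
    LinearMap.codRestrict _ ((LinearMap.mulRight k ((s : K[X]).coeff j)).comp Z.subtype)
      fun z ↦ key z z.2
  refine FiniteDimensional.of_injective φ fun x y hxy ↦ ?_
  have := congrArg Subtype.val hxy
  exact Subtype.ext (mul_right_cancel₀ hj this)

end GradedSubalgebra

/-! ### Algebraic subextensions of finitely generated fields -/

section FiniteExtensions

theorem finiteDimensional_fractionRing (P E : Type*) [CommRing P] [IsDomain P] [Field E]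
    [Algebra P E] [FaithfulSMul P E] [Algebra.IsAlgebraic P E] [Algebra.EssFiniteType P E] :
    letI := FractionRing.liftAlgebra P E
    FiniteDimensional (FractionRing P) E := by
  let K := FractionRing P
  let _ : Algebra K E := FractionRing.liftAlgebra P E
  have : IsScalarTower P K E := FractionRing.isScalarTower_liftAlgebra P E
  have : Algebra.IsAlgebraic K E :=
    (IsFractionRing.comap_isAlgebraic_iff (A := P) (K := K) (C := E)).mp inferInstance
  have : Algebra.EssFiniteType K E := Algebra.EssFiniteType.of_comp P K E
  exact Algebra.finite_of_essFiniteType_of_isAlgebraic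

/-- An algebraic subextension of a finitely generated field extension is finite. -/
theorem finiteDimensional_of_isAlgebraic_of_essFiniteType (F L K : Type*) [Field F] [Field L] [Field K]
    [Algebra F L] [Algebra F K] [Algebra L K] [IsScalarTower F L K] [Algebra.EssFiniteType F K]
    [Algebra.IsAlgebraic F L] : FiniteDimensional F L := by
  obtain ⟨s, hs⟩ := IntermediateField.fg_top F K
  have : Algebra.IsAlgebraic (Algebra.adjoin F (s : Set K)) K := by
    rw [← IntermediateField.isAlgebraic_adjoin_iff_top, hs, Algebra.isAlgebraic_iff_isIntegral]
    exact Algebra.isIntegral_of_surjective IntermediateField.topEquiv.surjective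
  obtain ⟨t, hts, ht⟩ := exists_isTranscendenceBasis_subset (R := F) (s : Set K)
  let P := MvPolynomial t F
  let _ : Algebra P K := (MvPolynomial.aeval (Subtype.val : t → K)).toAlgebra
  have : IsScalarTower F P K := IsScalarTower.of_algebraMap_eq fun x ↦
    ((MvPolynomial.aeval (Subtype.val : t → K)).commutes x).symm
  have hPK : Function.Injective (algebraMap P K) := ht.1
  have : FaithfulSMul P K := (faithfulSMul_iff_algebraMap_injective _ _).mpr hPK
  have : Algebra.EssFiniteType P K := Algebra.EssFiniteType.of_comp F P K
  have : Algebra.IsAlgebraic P K := by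
    refine ⟨fun r ↦ ?_⟩
    obtain ⟨f, hf, hfr⟩ := ht.isAlgebraic.isAlgebraic r
    let e := ht.1.aevalEquiv
    refine ⟨f.map e.symm.toRingHom, ?_, ?_⟩
    · rwa [Ne, Polynomial.map_eq_zero_iff e.symm.injective]
    · rw [Polynomial.aeval_def, Polynomial.eval₂_map]
      rw [Polynomial.aeval_def] at hfr
      have he : (algebraMap P K).comp e.symm.toRingHom =
          algebraMap (Algebra.adjoin F (Set.range (Subtype.val : t → K))) K := by
        refine RingHom.ext fun x ↦ ?_
        obtain ⟨w, rfl⟩ := e.surjective x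
        change algebraMap P K (e.symm (e w)) = _
        rw [AlgEquiv.symm_apply_apply]
        rfl
      rwa [he]
  let _ : Algebra (FractionRing P) K := FractionRing.liftAlgebra P K
  have : IsScalarTower P (FractionRing P) K := FractionRing.isScalarTower_liftAlgebra P K
  have := finiteDimensional_fractionRing P K
  -- As `L` is algebraic over `F`, the basis `t` stays independent over `L`. So elements of `L`
  -- independent over `F` stay independent over `F[t]`, and `[L : F] ≤ [K : F(t)]`.
  have htL : AlgebraicIndependent L (Subtype.val : t → K) := ht.1.extendScalars L
  rw [FiniteDimensional, ← Module.rank_lt_aleph0_iff]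
  have hle : Module.rank F L ≤ (Module.finrank (FractionRing P) K : ℕ) := by
    refine rank_le fun v hv ↦ ?_
    have h : LinearIndependent P (fun i : (v : Finset L) ↦ algebraMap L K (i : L)) := by
      rw [Fintype.linearIndependent_iff]
      intro p hp i
      have h0 : ∑ i : v, MvPolynomial.C (i : L) * MvPolynomial.map (algebraMap F L) (p i) = 0 := by
        apply htL
        rw [map_zero, map_sum, ← hp]
        refine Finset.sum_congr rfl fun i _ ↦ ?_
        rw [map_mul, Algebra.smul_def, mul_comm, MvPolynomial.aeval_C, MvPolynomial.aeval_map_algebraMap]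
        rfl
      ext m
      have h1 := congrArg (MvPolynomial.coeff m) h0
      rw [MvPolynomial.coeff_sum, MvPolynomial.coeff_zero] at h1
      rw [Fintype.linearIndependent_iff] at hv
      refine hv (fun i ↦ (p i).coeff m) ?_ i
      rw [← h1]
      refine Finset.sum_congr rfl fun i _ ↦ ?_
      rw [MvPolynomial.coeff_C_mul, MvPolynomial.coeff_map, Algebra.smul_def, mul_comm]
    have h2 := (LinearIndependent.iff_fractionRing P (FractionRing P)).mp h
    simpa using h2.fintype_card_le_finrank
  exact hle.trans_lt (Cardinal.natCast_lt_aleph0)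

end FiniteExtensions

/-! ### The two affine rings of a curve -/

section CurveRings

open Polynomial

variable {k L : Type*} [Field k] [Field L] [Algebra k L]

/-- The integral closure of `k[y]` in `L`. -/
noncomputable def curveRing (k : Type*) {L : Type*} [Field k] [Field L] [Algebra k L] (y : L) :
    Subalgebra k L :=
  (integralClosure (Algebra.adjoin k {y}) L).restrictScalars k

theorem mem_curveRing {y z : L} : z ∈ curveRing k y ↔ IsIntegral (Algebra.adjoin k {y}) z := Iff.rfl

theorem self_mem_curveRing (y : L) : y ∈ curveRing k y :=
  isIntegral_algebraMap (x := (⟨y, Algebra.self_mem_adjoin_singleton k y⟩ : Algebra.adjoin k {y}))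

theorem mem_curveRing_of_isIntegral {y z : L} (h : IsIntegral (curveRing k y) z) :
    z ∈ curveRing k y := by
  have := isIntegral_trans (R := Algebra.adjoin k {y}) (A := integralClosure (Algebra.adjoin k {y}) L) z h
  exact this

/-- A valuation ring is integrally closed. -/
theorem curveRing_le_valuationSubring {y : L} {V : ValuationSubring L}
    (hk : ∀ c, algebraMap k L c ∈ V) (hy : y ∈ V) {z : L} (hz : z ∈ curveRing k y) : z ∈ V := by
  have h1 : ∀ a ∈ Algebra.adjoin k {y}, a ∈ V := fun a ha ↦ by
    induction ha using Algebra.adjoin_induction with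
    | mem x hx => exact (Set.mem_singleton_iff.mp hx) ▸ hy
    | algebraMap c => exact hk c
    | add x y _ _ hx hy => exact add_mem hx hy
    | mul x y _ _ hx hy => exact mul_mem hx hy
  let φ : Algebra.adjoin k {y} →+* V :=
    { toFun := fun a ↦ ⟨a, h1 a a.2⟩
      map_one' := rfl
      map_mul' := fun _ _ ↦ rfl
      map_zero' := rfl
      map_add' := fun _ _ ↦ rfl }
  have h2 : IsIntegral V z := by
    obtain ⟨f, hf, hfz⟩ := mem_curveRing.mp hz
    exact ⟨f.map φ, hf.map _, by rw [eval₂_map]; exact hfz⟩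
  obtain ⟨w, hw⟩ := IsIntegrallyClosed.isIntegral_iff.mp h2
  exact hw ▸ w.2

/-- A polynomial in `y` times a high power of `y⁻¹` is a polynomial in `y⁻¹`. Scaling the roots of
an integral equation of `z` by `y⁻¹ ^ n` multiplies its lower coefficients by such powers. This
bounds the poles when the two charts are put in one projective space. -/
theorem exists_mul_inv_pow_mem_curveRing {y : L} (hy : y ≠ 0) {z : L} (hz : z ∈ curveRing k y) :
    ∃ N, ∀ n, N ≤ n → z * (y⁻¹) ^ n ∈ curveRing k y⁻¹ := by
  have h1 : ∀ a ∈ Algebra.adjoin k {y}, ∃ N, ∀ n, N ≤ n →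
      a * (y⁻¹) ^ n ∈ Algebra.adjoin k {y⁻¹} := fun a ha ↦ by
    have hy' : y⁻¹ ∈ Algebra.adjoin k {y⁻¹} := Algebra.self_mem_adjoin_singleton k _
    induction ha using Algebra.adjoin_induction with
    | mem x hx =>
      refine ⟨1, fun n hn ↦ ?_⟩
      obtain ⟨n, rfl⟩ := Nat.exists_eq_add_of_le hn
      rw [Set.mem_singleton_iff.mp hx, pow_add, pow_one, mul_inv_cancel_left₀ hy]
      exact pow_mem hy' _
    | algebraMap c => exact ⟨0, fun n _ ↦ mul_mem (Subalgebra.algebraMap_mem _ _) (pow_mem hy' _)⟩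
    | add a b _ _ ha hb =>
      obtain ⟨N₁, h₁⟩ := ha
      obtain ⟨N₂, h₂⟩ := hb
      refine ⟨max N₁ N₂, fun n hn ↦ ?_⟩
      rw [add_mul]
      exact add_mem (h₁ n (by omega)) (h₂ n (by omega))
    | mul a b _ _ ha hb =>
      obtain ⟨N₁, h₁⟩ := ha
      obtain ⟨N₂, h₂⟩ := hb
      refine ⟨N₁ + N₂, fun n hn ↦ ?_⟩
      obtain ⟨m, rfl⟩ := Nat.exists_eq_add_of_le hn
      have := mul_mem (h₁ N₁ le_rfl) (h₂ (N₂ + m) (by omega))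
      convert this using 1
      ring
  obtain ⟨f, hf, hfz⟩ := mem_curveRing.mp hz
  choose N hN using fun i ↦ h1 (f.coeff i) (f.coeff i).2
  refine ⟨∑ i ∈ Finset.range (f.natDegree + 1), N i, fun n hn ↦ ?_⟩
  let fL := f.map (algebraMap (Algebra.adjoin k {y}) L)
  have hfL : fL.Monic := hf.map _
  have hd : fL.natDegree = f.natDegree := hf.natDegree_map _
  have hmem : fL.scaleRoots (y⁻¹ ^ n) ∈ lifts (algebraMap (Algebra.adjoin k {y⁻¹}) L) := by
    rw [lifts_iff_coeff_lifts]
    intro i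
    rw [coeff_scaleRoots]
    suffices h : fL.coeff i * (y⁻¹ ^ n) ^ (fL.natDegree - i) ∈ Algebra.adjoin k {y⁻¹} from ⟨⟨_, h⟩, rfl⟩
    rcases lt_trichotomy i fL.natDegree with hi | hi | hi
    · rw [hd] at hi ⊢
      rw [← pow_mul]
      simp only [fL, coeff_map]
      refine hN i _ ?_
      calc N i ≤ ∑ i ∈ Finset.range (f.natDegree + 1), N i :=
            Finset.single_le_sum (f := N) (fun _ _ ↦ Nat.zero_le _) (Finset.mem_range.mpr (by omega))
        _ ≤ n := hn
        _ ≤ n * (f.natDegree - i) := Nat.le_mul_of_pos_right _ (by omega)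
    · rw [hi, hfL.coeff_natDegree]
      simp
    · rw [coeff_eq_zero_of_natDegree_lt hi, zero_mul]
      exact zero_mem _
  obtain ⟨g, hg, -, hgm⟩ := lifts_and_natDegree_eq_and_monic hmem ((monic_scaleRoots_iff _).mpr hfL)
  refine ⟨g, hgm, ?_⟩
  have h3 : eval₂ (RingHom.id L) z fL = 0 := by
    simp only [fL, eval₂_map]
    exact hfz
  have := scaleRoots_eval₂_eq_zero (s := y⁻¹ ^ n) (RingHom.id L) h3
  rw [← hg, eval₂_map] at this
  rw [mul_comm]
  exact this

theorem exists_surjective_adjoin_singleton (σ : Type*) [Unique σ] (y : L) :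
    ∃ φ : MvPolynomial σ k →ₐ[k] Algebra.adjoin k {y}, Function.Surjective φ ∧
      (algebraMap (Algebra.adjoin k {y}) L).comp φ.toRingHom =
        (MvPolynomial.aeval (R := k) (fun _ : σ ↦ y)).toRingHom := by
  let φ : MvPolynomial σ k →ₐ[k] Algebra.adjoin k {y} :=
    MvPolynomial.aeval fun _ ↦ ⟨y, Algebra.self_mem_adjoin_singleton k y⟩
  have hφ : (algebraMap (Algebra.adjoin k {y}) L).comp φ.toRingHom =
      (MvPolynomial.aeval (R := k) (fun _ : σ ↦ y)).toRingHom := by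
    refine MvPolynomial.ringHom_ext (fun a ↦ ?_) fun i ↦ ?_
    · change algebraMap _ L (φ (MvPolynomial.C a)) = MvPolynomial.aeval _ (MvPolynomial.C a)
      simp only [φ, MvPolynomial.aeval_C]
      rfl
    · change algebraMap _ L (φ (MvPolynomial.X i)) = MvPolynomial.aeval _ (MvPolynomial.X i)
      simp only [φ, MvPolynomial.aeval_X]
      rfl
  refine ⟨φ, ?_, hφ⟩
  rintro ⟨a, ha⟩
  obtain ⟨f, hf⟩ : a ∈ (MvPolynomial.aeval (R := k) (fun _ : σ ↦ y)).range := by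
    rw [← Algebra.adjoin_range_eq_range_aeval]
    simpa using ha
  exact ⟨f, Subtype.ext ((congrArg (fun ψ : MvPolynomial σ k →+* L ↦ ψ f) hφ).trans hf)⟩

/-- A bridge to `MvPolynomial.finite_of_isIntegralClosure`: integral equations over `k[y]` and over
a polynomial ring surjecting onto it are the same. -/
theorem isIntegral_aeval_iff {σ : Type*} [Unique σ] {y z : L} :
    (MvPolynomial.aeval (R := k) (fun _ : σ ↦ y)).toRingHom.IsIntegralElem z ↔
      z ∈ curveRing k y := by
  obtain ⟨φ, hs, hφ⟩ := exists_surjective_adjoin_singleton (k := k) σ y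
  rw [← hφ]
  constructor
  · rintro ⟨f, hf, hfz⟩
    refine ⟨f.map φ.toRingHom, hf.map _, ?_⟩
    rwa [eval₂_map]
  · rintro ⟨f, hf, hfz⟩
    obtain ⟨g, hg, -, hgm⟩ := lifts_and_natDegree_eq_and_monic (f := φ.toRingHom) (p := f)
      (by
        rw [lifts_iff_coeff_lifts]
        exact fun n ↦ hs _) hf
    refine ⟨g, hgm, ?_⟩
    rw [← eval₂_map, hg]
    exact hfz

theorem fg_curveRing [PerfectField k] [Algebra.EssFiniteType k L] {y : L} (hy : Transcendental k y)
    (halg : Algebra.IsAlgebraic (Algebra.adjoin k {y}) L) : (curveRing k y).FG := by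
  let P := MvPolynomial Unit k
  let _ : Algebra P L := (MvPolynomial.aeval (R := k) (fun _ : Unit ↦ y)).toAlgebra
  have : IsScalarTower k P L := IsScalarTower.of_algebraMap_eq fun x ↦
    ((MvPolynomial.aeval (fun _ : Unit ↦ y)).commutes x).symm
  have : FaithfulSMul P L := (faithfulSMul_iff_algebraMap_injective _ _).mpr
    (algebraicIndependent_unique_type_iff.mpr hy : AlgebraicIndependent k (fun _ : Unit ↦ y))
  have : Algebra.EssFiniteType P L := Algebra.EssFiniteType.of_comp k P L
  have : Algebra.IsAlgebraic P L := by
    obtain ⟨φ, hs, hφ⟩ := exists_surjective_adjoin_singleton (k := k) Unit y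
    refine ⟨fun z ↦ ?_⟩
    obtain ⟨f, hf, hfz⟩ := halg.isAlgebraic z
    obtain ⟨g, hg⟩ : f ∈ lifts φ.toRingHom := by
      rw [lifts_iff_coeff_lifts]
      exact fun n ↦ hs _
    refine ⟨g, ?_, ?_⟩
    · rintro rfl
      exact hf (by simpa using hg.symm)
    · change eval₂ (MvPolynomial.aeval (R := k) (fun _ : Unit ↦ y)).toRingHom z g = 0
      rw [← hφ, ← eval₂_map]
      exact (congrArg (eval₂ (algebraMap (Algebra.adjoin k {y}) L) z) hg).trans hfz
  let _ : Algebra (FractionRing P) L := FractionRing.liftAlgebra P L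
  have : IsScalarTower P (FractionRing P) L := FractionRing.isScalarTower_liftAlgebra P L
  have := finiteDimensional_fractionRing P L
  have hfin : Module.Finite P (integralClosure P L) :=
    MvPolynomial.finite_of_isIntegralClosure (FractionRing P) L (integralClosure P L)
  have : Algebra.FiniteType k (integralClosure P L) :=
    Algebra.FiniteType.trans (S := P) inferInstance inferInstance
  have h : ((integralClosure P L).restrictScalars k).FG :=
    Subalgebra.fg_iff_finiteType _ |>.mpr this
  have heq : curveRing k y = (integralClosure P L).restrictScalars k :=
    Subalgebra.ext fun z ↦ (isIntegral_aeval_iff (k := k) (σ := Unit) (y := y) (z := z)).symm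
  rwa [heq]

/-- In the function field of a curve, nonzero primes of the integral closure of `k[y]` are maximal. -/
theorem isMaximal_of_isPrime_curveRing {y : L}
    (p : Ideal (curveRing k y)) [hp : p.IsPrime] (hp0 : p ≠ ⊥) : p.IsMaximal := by
  let _ : Algebra k[X] (curveRing k y) := (aeval (⟨y, self_mem_curveRing y⟩ : curveRing k y)).toAlgebra
  have hcomp : (algebraMap (curveRing k y) L).comp (algebraMap k[X] (curveRing k y)) =
      (aeval (R := k) y).toRingHom := by
    refine Polynomial.ringHom_ext (fun a ↦ ?_) ?_
    · change algebraMap _ L (aeval (⟨y, self_mem_curveRing y⟩ : curveRing k y) (C a)) = aeval y (C a)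
      simp only [aeval_C]
      rfl
    · change algebraMap _ L (aeval (⟨y, self_mem_curveRing y⟩ : curveRing k y) X) = aeval y X
      simp only [aeval_X]
      rfl
  have hint : Algebra.IsIntegral k[X] (curveRing k y) := by
    refine ⟨fun z ↦ ?_⟩
    obtain ⟨f, hf, hfz⟩ := mem_curveRing.mp z.2
    let φ : k[X] →ₐ[k] Algebra.adjoin k {y} :=
      aeval ⟨y, Algebra.self_mem_adjoin_singleton k y⟩
    have hφ : (algebraMap (Algebra.adjoin k {y}) L).comp φ.toRingHom =
        (aeval (R := k) y).toRingHom := by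
      refine Polynomial.ringHom_ext (fun a ↦ ?_) ?_
      · change algebraMap _ L (φ (C a)) = aeval y (C a)
        simp only [φ, aeval_C]
        rfl
      · change algebraMap _ L (φ X) = aeval y X
        simp only [φ, aeval_X]
        rfl
    have hs : Function.Surjective φ := by
      rintro ⟨a, ha⟩
      obtain ⟨g, hg⟩ : a ∈ (aeval (R := k) y).range := by
        rwa [← Algebra.adjoin_singleton_eq_range_aeval]
      exact ⟨g, Subtype.ext ((congrArg (fun ψ : k[X] →+* L ↦ ψ g) hφ).trans hg)⟩
    obtain ⟨g, hg, -, hgm⟩ := lifts_and_natDegree_eq_and_monic (f := φ.toRingHom) (p := f)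
      (by
        rw [lifts_iff_coeff_lifts]
        exact fun n ↦ hs _) hf
    refine ⟨g, hgm, ?_⟩
    apply (Subtype.val_injective : Function.Injective (algebraMap (curveRing k y) L))
    have h := hom_eval₂ g (algebraMap k[X] (curveRing k y)) (algebraMap (curveRing k y) L) z
    refine h.trans ?_
    rw [hcomp, ← hφ, ← eval₂_map, hg]
    exact hfz
  -- By integrality the contraction to the principal ideal domain `k[X]` is nonzero, hence maximal,
  -- and maximality goes back up.
  have h1 : p.comap (algebraMap k[X] (curveRing k y)) ≠ ⊥ := by
    obtain ⟨x, hx, hx0⟩ := Submodule.exists_mem_ne_zero_of_ne_bot hp0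
    exact Ideal.comap_ne_bot_of_integral_mem hx0 hx (hint.isIntegral x)
  have := IsPrime.to_maximal_ideal h1
  exact Ideal.isMaximal_of_isIntegral_of_isMaximal_comap (R := k[X]) p this

/-- Coordinates for a normal projective model of a function field of dimension one. -/
theorem exists_curve_coordinates [PerfectField k] [Algebra.EssFiniteType k L] {y : L}
    (hy : Transcendental k y) (halg : Algebra.IsAlgebraic (IntermediateField.adjoin k {y}) L) :
    ∃ (n : ℕ) (ξ : Fin (n + 1) → L) (i₀ i₁ : Fin (n + 1)), ξ i₀ ≠ 0 ∧ ξ i₁ ≠ 0 ∧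
      Algebra.adjoin k (Set.range fun j ↦ ξ j / ξ i₀) = curveRing k y ∧
      Algebra.adjoin k (Set.range fun j ↦ ξ j / ξ i₁) = curveRing k y⁻¹ := by
  have hy0 : y ≠ 0 := by rintro rfl; exact hy (isAlgebraic_zero)
  have hy' : Transcendental k y⁻¹ := fun h ↦ hy (by simpa using h.inv)
  have halg' : Algebra.IsAlgebraic (Algebra.adjoin k {y⁻¹}) L := by
    rw [← IntermediateField.isAlgebraic_adjoin_iff_top]
    have : IntermediateField.adjoin k {y⁻¹} = IntermediateField.adjoin k {y} := by
      refine le_antisymm ?_ ?_ <;> rw [IntermediateField.adjoin_simple_le_iff]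
      · exact inv_mem (IntermediateField.mem_adjoin_simple_self k y)
      · simpa using inv_mem (IntermediateField.mem_adjoin_simple_self k y⁻¹)
    rwa [this]
  have halg := (IntermediateField.isAlgebraic_adjoin_iff_top (F := k) (E := L) (s := {y})).mp halg
  obtain ⟨T₀, hT₀⟩ := fg_curveRing hy halg
  obtain ⟨T₁, hT₁⟩ := fg_curveRing hy' halg'
  have h₀ : ∀ t : T₀, (t : L) ∈ curveRing k y := fun t ↦ hT₀ ▸ Algebra.subset_adjoin t.2
  have h₁ : ∀ t : T₁, (t : L) ∈ curveRing k y⁻¹ := fun t ↦ hT₁ ▸ Algebra.subset_adjoin t.2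
  choose N₀ hN₀ using fun t ↦ exists_mul_inv_pow_mem_curveRing hy0 (h₀ t)
  choose N₁ hN₁ using fun t ↦ exists_mul_inv_pow_mem_curveRing (inv_ne_zero hy0) (h₁ t)
  simp only [inv_inv] at hN₁
  let N := ∑ t, N₀ t + ∑ t, N₁ t
  have hle₀ : ∀ t, N₀ t ≤ N := fun t ↦
    (Finset.single_le_sum (f := N₀) (fun _ _ ↦ Nat.zero_le _) (Finset.mem_univ t)).trans
      (Nat.le_add_right _ _)
  have hle₁ : ∀ t, N₁ t ≤ N := fun t ↦
    (Finset.single_le_sum (f := N₁) (fun _ _ ↦ Nat.zero_le _) (Finset.mem_univ t)).trans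
      (Nat.le_add_left _ _)
  -- The coordinates are `1`, `y ^ N`, the generators of the first ring, and those of the second
  -- times `y ^ N`. Division by `1` or by `y ^ N` gives generators of one ring, and `N` is so large
  -- that the other coordinates stay in it.
  let ξ' : Option (Option (T₀ ⊕ T₁)) → L := fun o ↦ o.elim 1 fun o ↦ o.elim (y ^ N)
    (Sum.elim (fun t ↦ (t : L)) fun t ↦ (t : L) * y ^ N)
  have hyN : y ^ N ≠ 0 := pow_ne_zero _ hy0
  let e : Fin (Fintype.card (Option (T₀ ⊕ T₁)) + 1) ≃ Option (Option (T₀ ⊕ T₁)) :=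
    (Fintype.equivFinOfCardEq (by simp)).symm
  have hr : ∀ c : L, Set.range (fun j ↦ (ξ' ∘ e) j / c) = Set.range fun o ↦ ξ' o / c := fun c ↦
    e.surjective.range_comp fun o ↦ ξ' o / c
  have hyi : y⁻¹ ∈ curveRing k y⁻¹ := self_mem_curveRing _
  refine ⟨_, ξ' ∘ e, e.symm none, e.symm (some none), by simp [ξ'], by simp [ξ', hy0], ?_, ?_⟩
  · rw [hr]
    simp only [Function.comp_apply, Equiv.apply_symm_apply]
    refine le_antisymm (Algebra.adjoin_le ?_) ?_
    · rintro _ ⟨_ | _ | t | t, rfl⟩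
      · simp [ξ']
      · simpa [ξ'] using pow_mem (self_mem_curveRing y) N
      · simpa [ξ'] using h₀ t
      · simpa [ξ'] using hN₁ t N (hle₁ t)
    · conv_lhs => rw [← hT₀]
      refine Algebra.adjoin_mono fun t ht ↦ ⟨some (some (Sum.inl ⟨t, ht⟩)), by simp [ξ']⟩
  · rw [hr]
    simp only [Function.comp_apply, Equiv.apply_symm_apply]
    refine le_antisymm (Algebra.adjoin_le ?_) ?_
    · rintro _ ⟨_ | _ | t | t, rfl⟩
      · simpa [ξ'] using pow_mem hyi N
      · simp [ξ', hy0]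
      · simpa [ξ', div_eq_mul_inv] using hN₀ t N (hle₀ t)
      · simpa [ξ', hy0] using h₁ t
    · conv_lhs => rw [← hT₁]
      refine Algebra.adjoin_mono fun t ht ↦ ⟨some (some (Sum.inr ⟨t, ht⟩)), by simp [ξ', hy0]⟩

end CurveRings

/-- Algebraic Hartogs: in a noetherian normal domain, an element of the fraction field lying in
every localization at a prime of height at most one lies in the ring. -/
theorem mem_range_of_forall_height_le_one {R K : Type*} [CommRing R] [IsDomain R]
    [IsNoetherianRing R] [IsIntegrallyClosed R] [Field K] [Algebra R K] [IsFractionRing R K]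
    (w : K) (hw : ∀ p : Ideal R, p.IsPrime → p.height ≤ 1 →
      ∃ s : R, s ∉ p ∧ ∃ r : R, algebraMap R K s * w = algebraMap R K r) :
    w ∈ (algebraMap R K).range := by
  by_contra hcon
  obtain ⟨a, b, hb, rfl⟩ := IsFractionRing.div_surjective (A := R) w
  have hb0 : b ≠ 0 := nonZeroDivisors.ne_zero hb
  have inj := IsFractionRing.injective R K
  have hbK : algebraMap R K b ≠ 0 := by
    rwa [Ne, map_eq_zero_iff _ inj]
  have hab : a ∉ Ideal.span {b} := by
    intro h
    obtain ⟨c, rfl⟩ := Ideal.mem_span_singleton'.mp h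
    exact hcon ⟨c, by rw [map_mul, mul_div_cancel_right₀ _ hbK]⟩
  have hne : (Ideal.Quotient.mk (Ideal.span {b}) a) ≠ 0 := by
    rwa [Ne, Ideal.Quotient.eq_zero_iff_mem]
  -- Were `w = a / b` not in `R`, the annihilator of `a` modulo `b` would lie in an associated prime
  -- `p = (b : c)`. Such a `p` is shown to have height at most one, which contradicts the hypothesis
  -- on `w` at `p`.
  obtain ⟨p, hp, hle⟩ := exists_le_isAssociatedPrime_of_isNoetherianRing R
    (Ideal.Quotient.mk (Ideal.span {b}) a) hne
  obtain ⟨hpp, c', hc'⟩ := isAssociatedPrime_iff.mp hp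
  obtain ⟨c, rfl⟩ := Ideal.Quotient.mk_surjective c'
  have hann : ∀ (r z : R), r ∈ (⊥ : Submodule R (R ⧸ Ideal.span {b})).colon {Ideal.Quotient.mk (Ideal.span {b}) z} ↔
      r * z ∈ Ideal.span {b} := by
    intro r z
    rw [Submodule.mem_colon_singleton, Submodule.mem_bot, ← Ideal.Quotient.eq_zero_iff_mem, map_mul]
    rfl
  have hmem : ∀ r, r ∈ p ↔ r * c ∈ Ideal.span {b} := fun r ↦ by rw [hc', hann]
  set u : K := algebraMap R K c / algebraMap R K b with hu
  have hpu : ∀ r, r ∈ p ↔ ∃ e : R, algebraMap R K r * u = algebraMap R K e := by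
    intro r
    rw [hmem, Ideal.mem_span_singleton']
    refine exists_congr fun e ↦ ?_
    rw [hu, ← mul_div_assoc, div_eq_iff hbK, ← map_mul, ← map_mul, inj.eq_iff, eq_comm]
  have hbp : b ∈ p := (hmem b).2 (Ideal.mem_span_singleton'.2 ⟨c, mul_comm _ _⟩)
  -- If `u = c / b` mapped `p` into itself, it would be integral, hence in `R`, and `1` would lie in
  -- `p`.
  have hout : ∃ t ∈ p, ∃ v ∉ p, algebraMap R K t * u = algebraMap R K v := by
    by_contra! hno
    have hint : IsIntegral R u := by
      refine isIntegral_of_smul_mem_submodule (Submodule.map (Algebra.linearMap R K) p) ?_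
        ((IsNoetherian.noetherian p).map _) u ?_
      · intro h0
        have : algebraMap R K b ∈ Submodule.map (Algebra.linearMap R K) p := ⟨b, hbp, rfl⟩
        rw [h0] at this
        exact hbK this
      · rintro _ ⟨r, hr, rfl⟩
        obtain ⟨e, he⟩ := (hpu r).1 hr
        have hep : e ∈ p := by_contra fun h ↦ hno r hr e h he
        exact ⟨e, hep, by simp [← he, mul_comm]⟩
    obtain ⟨e, he⟩ := IsIntegrallyClosed.isIntegral_iff.mp hint
    exact hpp.ne_top ((Ideal.eq_top_iff_one p).2 ((hpu 1).2 ⟨e, by simp [he]⟩))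
  obtain ⟨t, htp, v, hvp, htv⟩ := hout
  -- From `t u = v` with `v ∉ p`, every `x ∈ p` satisfies `x v ∈ (t)`; so `p` is minimal over `(t)`,
  -- and Krull's theorem bounds its height.
  have hmin : p ∈ (Ideal.span {t}).minimalPrimes := by
    refine ⟨⟨hpp, (Ideal.span_singleton_le_iff_mem _).2 htp⟩, fun Q hQ hQp x hx ↦ ?_⟩
    obtain ⟨e, he⟩ := (hpu x).1 hx
    have hxv : x * v = e * t := inj (by rw [map_mul, map_mul, ← he, ← htv]; ring)
    have : x * v ∈ Q := hxv ▸ Ideal.mul_mem_left _ _ (hQ.2 (Ideal.mem_span_singleton_self t))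
    exact (hQ.1.mem_or_mem this).resolve_right fun h ↦ hvp (hQp h)
  obtain ⟨s, hs, r, hr⟩ := hw p hpp
    (Ideal.height_le_one_of_isPrincipal_of_mem_minimalPrimes _ p hmin)
  refine hs (hle ?_)
  rw [hann, Ideal.mem_span_singleton']
  exact ⟨r, inj (by rw [map_mul, ← hr, map_mul]; field_simp)⟩

/-! ### Local rings, function fields and pull-back along rational maps -/

namespace AlgebraicGeometry

lemma exists_eq_specMap_comp_fromSpecStalk {X : Scheme.{u}} {R : CommRingCat.{u}} [IsLocalRing R]
    (g : Spec R ⟶ X) {x : X} (hx : g (IsLocalRing.closedPoint R) = x) :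
    ∃ θ : X.presheaf.stalk x ⟶ R, IsLocalHom θ.hom ∧ g = Spec.map θ ≫ X.fromSpecStalk x := by
  subst hx
  exact ⟨Scheme.stalkClosedPointTo g, inferInstance, (Scheme.Spec_stalkClosedPointTo_fromSpecStalk g).symm⟩

lemma specMap_comp_fromSpecStalk_injective {X : Scheme.{u}} {R : CommRingCat.{u}} {x : X}
    {θ θ' : X.presheaf.stalk x ⟶ R}
    (h : Spec.map θ ≫ X.fromSpecStalk x = Spec.map θ' ≫ X.fromSpecStalk x) : θ = θ' :=
  Spec.map_injective ((cancel_mono _).mp h)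

namespace Scheme

variable {X Y Z : Scheme.{u}} [IsIntegral X] [IsIntegral Y]

/-- The inclusion of the generic point, as a morphism from the spectrum of the function field. -/
noncomputable abbrev genericMap (X : Scheme.{u}) [IsIntegral X] : Spec X.functionField ⟶ X :=
  X.fromSpecStalk (genericPoint X)

/-- The inclusion of a local ring into the function field. -/
noncomputable def stalkToFunctionField (x : X) : X.presheaf.stalk x ⟶ X.functionField :=
  X.presheaf.stalkSpecializes ((genericPoint_spec X).specializes trivial)

lemma specMap_stalkToFunctionField (x : X) :
    Spec.map (stalkToFunctionField x) ≫ X.fromSpecStalk x = X.genericMap :=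
  SpecMap_stalkSpecializes_fromSpecStalk _

lemma specMap_stalkToFunctionField_assoc (x : X) {W : Scheme.{u}} (h : X ⟶ W) :
    Spec.map (stalkToFunctionField x) ≫ X.fromSpecStalk x ≫ h = X.genericMap ≫ h := by
  rw [← specMap_stalkToFunctionField x, Category.assoc]

lemma PartialMap.genericPoint_mem_domain (g : X.PartialMap Z) : genericPoint X ∈ g.domain :=
  (genericPoint_specializes _).mem_open g.domain.2 g.dense_domain.nonempty.choose_spec

lemma PartialMap.specMap_stalkToFunctionField_comp (g : X.PartialMap Z) {x : X}
    (hx : x ∈ g.domain) :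
    Spec.map (stalkToFunctionField x) ≫ g.fromSpecStalkOfMem hx = g.fromFunctionField := by
  dsimp only [PartialMap.fromFunctionField, PartialMap.fromSpecStalkOfMem]
  rw [← Category.assoc]
  congr 1
  rw [← cancel_mono g.domain.ι, Category.assoc, Opens.fromSpecStalkOfMem_ι,
    Opens.fromSpecStalkOfMem_ι]
  exact specMap_stalkToFunctionField x

/-- The homomorphism of local rings given by a partial map. -/
noncomputable def PartialMap.localMap (g : X.PartialMap Z) (x : g.domain) :
    Z.presheaf.stalk (g.hom x) ⟶ X.presheaf.stalk x.1 :=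
  g.hom.stalkMap x ≫ (g.domain.stalkIso x).hom

lemma Opens.fromSpecStalkOfMem_eq (U : X.Opens) (y : U.toScheme) :
    U.fromSpecStalkOfMem y.1 y.2 = Spec.map (U.stalkIso y).hom ≫ U.toScheme.fromSpecStalk y := by
  rw [← cancel_mono U.ι, Opens.fromSpecStalkOfMem_ι, Category.assoc]
  have h₁ : Spec.map (U.stalkIso y).inv ≫ X.fromSpecStalk y.1 = U.toScheme.fromSpecStalk y ≫ U.ι :=
    (congrArg (Spec.map · ≫ X.fromSpecStalk y.1) (U.stalkIso_inv y)).trans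
      (SpecMap_stalkMap_fromSpecStalk U.ι)
  rw [← h₁, ← Spec.map_comp_assoc, Iso.inv_hom_id, Spec.map_id, Category.id_comp]

lemma PartialMap.specMap_localMap (g : X.PartialMap Z) (x : g.domain) :
    Spec.map (g.localMap x) ≫ Z.fromSpecStalk (g.hom x) = g.fromSpecStalkOfMem x.2 := by
  let y : g.domain.toScheme := x
  have h : Spec.map (g.hom.stalkMap y ≫ (g.domain.stalkIso y).hom) ≫ Z.fromSpecStalk (g.hom y) =
      (Spec.map (g.domain.stalkIso y).hom ≫ g.domain.toScheme.fromSpecStalk y) ≫ g.hom := by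
    rw [Spec.map_comp, Category.assoc, SpecMap_stalkMap_fromSpecStalk, Category.assoc]
  rw [← Opens.fromSpecStalkOfMem_eq] at h
  exact h

lemma apply_genericPoint_of_isDominant (f : X ⟶ Y) [IsDominant f] :
    f (genericPoint X) = genericPoint Y := by
  apply ((genericPoint_spec Y).eq _).symm
  have := (genericPoint_spec X).image f.continuous
  rwa [Set.image_univ, f.denseRange.closure_range] at this

lemma PartialMap.hom_genericPoint (g : X.PartialMap Y) [IsDominant g.hom] :
    g.hom ⟨genericPoint X, g.genericPoint_mem_domain⟩ = genericPoint Y := by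
  have : Nonempty g.domain := ⟨⟨_, g.genericPoint_mem_domain⟩⟩
  rw [← apply_genericPoint_of_isDominant g.hom]
  congr 1
  exact Subtype.ext (genericPoint_eq_of_isOpenImmersion g.domain.ι).symm

lemma RationalMap.exists_pullback (f : X ⤏ Y) [f.IsDominant] :
    ∃ θ : Y.functionField ⟶ X.functionField, f.fromFunctionField = Spec.map θ ≫ Y.genericMap := by
  obtain ⟨g, rfl⟩ := f.exists_rep
  have : IsDominant g.hom := (PartialMap.isDominant_toRationalMap_iff g).1 inferInstance
  have h := g.specMap_localMap ⟨genericPoint X, g.genericPoint_mem_domain⟩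
  -- The image point is only propositionally the generic point; generalising it avoids transport
  -- between stalks.
  have key : ∀ y (hy : y = genericPoint Y) (θ : Y.presheaf.stalk y ⟶ X.functionField),
      ∃ θ' : Y.functionField ⟶ X.functionField,
        Spec.map θ ≫ Y.fromSpecStalk y = Spec.map θ' ≫ Y.genericMap := by
    rintro _ rfl θ
    exact ⟨θ, rfl⟩
  obtain ⟨θ, hθ⟩ := key _ g.hom_genericPoint (g.localMap ⟨genericPoint X, g.genericPoint_mem_domain⟩)
  exact ⟨θ, h.symm.trans hθ⟩

/-- The pull-back of rational functions under a dominant rational map. -/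
noncomputable def RationalMap.pullback (f : X ⤏ Y) [f.IsDominant] :
    Y.functionField ⟶ X.functionField := f.exists_pullback.choose

lemma RationalMap.specMap_pullback (f : X ⤏ Y) [f.IsDominant] :
    Spec.map f.pullback ≫ Y.genericMap = f.fromFunctionField :=
  f.exists_pullback.choose_spec.symm

lemma RationalMap.eq_pullback (f : X ⤏ Y) [f.IsDominant] {θ : Y.functionField ⟶ X.functionField}
    (h : Spec.map θ ≫ Y.genericMap = f.fromFunctionField) : θ = f.pullback :=
  specMap_comp_fromSpecStalk_injective (h.trans f.specMap_pullback.symm)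

/-- This lets pull-backs of germs be computed in the function field. -/
lemma PartialMap.stalkToFunctionField_localMap (g : X.PartialMap Y) (f : X ⤏ Y) [f.IsDominant]
    (hf : g.toRationalMap = f) (x : g.domain) (a : Y.presheaf.stalk (g.hom x)) :
    stalkToFunctionField x.1 (g.localMap x a) = f.pullback (stalkToFunctionField _ a) := by
  have : g.localMap x ≫ stalkToFunctionField x.1 = stalkToFunctionField _ ≫ f.pullback := by
    apply specMap_comp_fromSpecStalk_injective
    rw [Spec.map_comp, Category.assoc, g.specMap_localMap, g.specMap_stalkToFunctionField_comp,
      Spec.map_comp, Category.assoc, specMap_stalkToFunctionField, f.specMap_pullback, ← hf]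
    rfl
  exact congr($this a)

lemma Opens.fromSpecStalkOfMem_isoImage_inv (U : X.Opens) (W : U.toScheme.Opens) (x : X)
    (hx : x ∈ U.ι ''ᵁ W) (hU : x ∈ U) :
    (U.ι ''ᵁ W).fromSpecStalkOfMem x hx ≫ (U.ι.isoImage W).inv ≫ W.ι =
      U.fromSpecStalkOfMem x hU := by
  rw [← cancel_mono U.ι]
  simp only [Category.assoc, Opens.fromSpecStalkOfMem_ι]
  rw [Hom.isoImage_inv_ι, Opens.fromSpecStalkOfMem_ι]

/-- Composition can be tested at the generic point; identities between rational maps thus become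
identities between field homomorphisms. -/
lemma RationalMap.fromFunctionField_comp (f : X ⤏ Y) [f.IsDominant] (g : Y ⤏ Z) :
    (f.comp g).fromFunctionField = Spec.map f.pullback ≫ g.fromFunctionField := by
  obtain ⟨g, rfl⟩ := g.exists_rep
  obtain ⟨F, rfl⟩ := f.exists_rep
  have : IsDominant F.hom := (PartialMap.isDominant_toRationalMap_iff F).1 inferInstance
  rw [RationalMap.toRationalMap_comp]
  have hx : genericPoint X ∈ F.domain.ι ''ᵁ F.hom ⁻¹ᵁ g.domain :=
    (F.comp g).genericPoint_mem_domain
  have h₁ : (F.domain.ι ''ᵁ F.hom ⁻¹ᵁ g.domain).fromSpecStalkOfMem _ hx ≫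
      (F.domain.ι.isoImage _).inv ≫ F.hom ∣_ g.domain =
      Spec.map F.toRationalMap.pullback ≫ g.domain.fromSpecStalkOfMem _ g.genericPoint_mem_domain := by
    rw [← cancel_mono g.domain.ι, Category.assoc, Category.assoc, morphismRestrict_ι,
      Category.assoc, Opens.fromSpecStalkOfMem_ι, RationalMap.specMap_pullback]
    have := congr($(Opens.fromSpecStalkOfMem_isoImage_inv F.domain (F.hom ⁻¹ᵁ g.domain) _ hx
      F.genericPoint_mem_domain) ≫ F.hom)
    rw [Category.assoc, Category.assoc] at this
    exact this
  have h₂ := congr($h₁ ≫ g.hom)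
  rw [Category.assoc, Category.assoc, Category.assoc] at h₂
  exact h₂

lemma RationalMap.pullback_id : (RationalMap.id X).pullback = 𝟙 X.functionField := by
  symm
  apply RationalMap.eq_pullback
  rw [Spec.map_id, Category.id_comp]
  exact ((PartialMap.fromSpecStalkOfMem_toPartialMap (𝟙 X) _).trans (Category.comp_id _)).symm

/-- The existence half of the valuative criterion, which holds for proper morphisms. -/
lemma exists_lift_of_valuationRing {S : Scheme.{u}} (p : Z ⟶ S) [IsProper p] {R K : CommRingCat.{u}}
    [IsDomain R] [ValuationRing R] (hK : IsField K) (φ : R ⟶ K)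
    (hφ : letI := φ.hom.toAlgebra; IsFractionRing R K)
    (i₁ : Spec K ⟶ Z) (i₂ : Spec R ⟶ S) (h : i₁ ≫ p = Spec.map φ ≫ i₂) :
    ∃ ℓ : Spec R ⟶ Z, Spec.map φ ≫ ℓ = i₁ ∧ ℓ ≫ p = i₂ := by
  have hv : ValuativeCriterion.Existence p := by
    have : UniversallyClosed p := inferInstance
    rw [UniversallyClosed.eq_valuativeCriterion] at this
    exact this.1
  obtain ⟨K, _⟩ := K
  obtain ⟨R, _⟩ := R
  let := hK.toField
  let := φ.hom.toAlgebra
  obtain ⟨⟨ℓ, hℓ₁, hℓ₂⟩⟩ := hv { R := R, K := K, i₁ := i₁, i₂ := i₂, commSq := ⟨h⟩ }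
  exact ⟨ℓ, hℓ₁, hℓ₂⟩

/-- A rational map to a proper scheme is defined at points whose local ring is a valuation
ring. -/
lemma RationalMap.mem_domain_of_valuationRing {S : Scheme.{u}} [X.Over S] [Z.Over S]
    [IsProper (Z ↘ S)] (f : X ⤏ Z) [hf : f.IsOver S] (x : X) [ValuationRing (X.presheaf.stalk x)] :
    x ∈ f.domain := by
  obtain ⟨g, hg, rfl⟩ := f.exists_partialMap_over S
  have hf : g.fromFunctionField ≫ (Z ↘ S) =
      Spec.map (stalkToFunctionField x) ≫ X.fromSpecStalk x ≫ (X ↘ S) := by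
    have : g.hom ≫ (Z ↘ S) = g.domain.ι ≫ X ↘ S := (PartialMap.isOver_iff (S := S)).mp hg
    change (g.domain.fromSpecStalkOfMem _ g.genericPoint_mem_domain ≫ g.hom) ≫ _ = _
    rw [Category.assoc, this, Opens.fromSpecStalkOfMem_ι_assoc, specMap_stalkToFunctionField_assoc]
  obtain ⟨ℓ, hℓ₁, hℓ₂⟩ := exists_lift_of_valuationRing (Z ↘ S) (Field.toIsField X.functionField)
    (stalkToFunctionField x) (inferInstanceAs (IsFractionRing (X.presheaf.stalk x) X.functionField))
    _ _ hf
  -- The lift on the local spectrum spreads out to a neighbourhood of `x` and agrees with `f`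
  -- generically.
  refine RationalMap.mem_domain.2 ⟨PartialMap.ofFromSpecStalk (X ↘ S) (Z ↘ S) ℓ hℓ₂,
    PartialMap.mem_domain_ofFromSpecStalk _ _ _ _, ?_⟩
  apply RationalMap.eq_of_fromFunctionField_eq
  rw [RationalMap.fromFunctionField_toRationalMap,
    ← PartialMap.specMap_stalkToFunctionField_comp _ (PartialMap.mem_domain_ofFromSpecStalk _ _ _ _),
    PartialMap.fromSpecStalkOfMem_ofFromSpecStalk]
  exact hℓ₁

end Scheme
end AlgebraicGeometry

namespace PrimBir

attribute [local instance] MvPolynomial.gradedAlgebra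
open MvPolynomial HomogeneousLocalization

/-! ### Points of projective space with values in a field -/

lemma X_mem (k : Type u) [Field k] {n : ℕ} (i : Fin (n + 1)) :
    (X i : MvPolynomial (Fin (n + 1)) k) ∈ homogeneousSubmodule (Fin (n + 1)) k 1 :=
  isHomogeneous_X k i

lemma X_mem' (k : Type u) [Field k] {n : ℕ} (i : Fin (n + 1)) :
    (X i : MvPolynomial (Fin (n + 1)) k) ∈ homogeneousSubmodule (Fin (n + 1)) k (1 • 1) :=
  isHomogeneous_X k i

lemma C_mem {k : Type u} [Field k] {n : ℕ} (c : k) :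
    (C c : MvPolynomial (Fin (n + 1)) k) ∈ homogeneousSubmodule (Fin (n + 1)) k (0 • 1) :=
  isHomogeneous_C _ c

section Points

variable {k : Type u} [Field k] {n : ℕ} {F : Type u} [Field F] [Algebra k F]

/-- Evaluation of a homogeneous fraction of degree zero at a vector. -/
noncomputable def evalAway (ξ : Fin (n + 1) → F) (f : MvPolynomial (Fin (n + 1)) k)
    (hf : aeval ξ f ≠ 0) : Away (homogeneousSubmodule (Fin (n + 1)) k) f →+* F :=
  (Localization.awayLift (aeval ξ).toRingHom f hf.isUnit).comp
    (algebraMap (Away (homogeneousSubmodule (Fin (n + 1)) k) f) (Localization.Away f))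

lemma evalAway_mk (ξ : Fin (n + 1) → F) (f : MvPolynomial (Fin (n + 1)) k)
    (hf : aeval ξ f ≠ 0) {d : ℕ} (hd : f ∈ homogeneousSubmodule (Fin (n + 1)) k d) (m : ℕ)
    (a : MvPolynomial (Fin (n + 1)) k) (ha : a ∈ homogeneousSubmodule (Fin (n + 1)) k (m • d)) :
    evalAway ξ f hf (Away.mk _ hd m a ha) = aeval ξ a / aeval ξ f ^ m := by
  simp only [evalAway, RingHom.comp_apply, HomogeneousLocalization.algebraMap_apply, Away.val_mk]
  rw [Localization.awayLift_mk (v := (aeval ξ f)⁻¹)]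
  · simp [div_eq_mul_inv]
  · simpa using mul_inv_cancel₀ hf

lemma evalAway_awayMap (ξ : Fin (n + 1) → F) (f g x : MvPolynomial (Fin (n + 1)) k) (hx : x = f * g)
    (hf : aeval ξ f ≠ 0) (hfx : aeval ξ x ≠ 0) {d e : ℕ}
    (hd : f ∈ homogeneousSubmodule (Fin (n + 1)) k d)
    (he : g ∈ homogeneousSubmodule (Fin (n + 1)) k e)
    (y : Away (homogeneousSubmodule (Fin (n + 1)) k) f) :
    evalAway ξ x hfx (awayMap _ he hx y) = evalAway ξ f hf y := by
  obtain ⟨m, a, ha, rfl⟩ := Away.mk_surjective _ hd y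
  rw [awayMap_mk, evalAway_mk, evalAway_mk]
  subst hx
  rw [map_mul] at hfx
  have hg := right_ne_zero_of_mul hfx
  simp only [map_mul, map_pow, mul_pow]
  field_simp

variable (k n) in
/-- The standard affine chart of projective space. -/
noncomputable def chart (i : Fin (n + 1)) :
    Spec (.of (Away (homogeneousSubmodule (Fin (n + 1)) k) (X i))) ⟶ projSpace k n :=
  Proj.awayι _ (X i) (X_mem k i) one_pos

instance (i : Fin (n + 1)) : IsOpenImmersion (chart k n i) := by
  unfold chart; infer_instance

variable (k n) in
/-- The standard affine open subset of projective space. -/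
noncomputable def chartOpen (i : Fin (n + 1)) : (projSpace k n).Opens :=
  Proj.basicOpen (homogeneousSubmodule (Fin (n + 1)) k) (X i)

lemma opensRange_chart (i : Fin (n + 1)) : (chart k n i).opensRange = chartOpen k n i :=
  Proj.opensRange_awayι _ _ _ _

lemma aeval_X_ne_zero {ξ : Fin (n + 1) → F} {i : Fin (n + 1)} (h : ξ i ≠ 0) :
    aeval ξ (X i : MvPolynomial (Fin (n + 1)) k) ≠ 0 := by rwa [aeval_X]

variable (k) in
/-- The `F`-valued point with homogeneous coordinates `ξ`, through the `i`-th chart. -/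
noncomputable def pointOf (ξ : Fin (n + 1) → F) (i : Fin (n + 1)) (h : ξ i ≠ 0) :
    Spec (.of F) ⟶ projSpace k n :=
  Spec.map (CommRingCat.ofHom (evalAway ξ (X i) (aeval_X_ne_zero (k := k) h))) ≫ chart k n i

/-- Both points factor through the overlap, where `X i * X j` is invertible. -/
lemma pointOf_eq (ξ : Fin (n + 1) → F) (i j : Fin (n + 1)) (hi : ξ i ≠ 0) (hj : ξ j ≠ 0) :
    pointOf k ξ i hi = pointOf k ξ j hj := by
  have hij : aeval ξ (X i * X j : MvPolynomial (Fin (n + 1)) k) ≠ 0 := by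
    simpa using mul_ne_zero hi hj
  trans Spec.map (CommRingCat.ofHom (evalAway ξ (X i * X j) hij)) ≫
    Proj.awayι (homogeneousSubmodule (Fin (n + 1)) k) (X i * X j)
      (SetLike.mul_mem_graded (X_mem k i) (X_mem k j)) Nat.two_pos
  · rw [← Proj.SpecMap_awayMap_awayι _ (X_mem k i) one_pos (X_mem k j) rfl,
      ← Category.assoc, ← Spec.map_comp, ← CommRingCat.ofHom_comp, pointOf]
    congr 3
    ext y
    exact (evalAway_awayMap ξ _ _ _ rfl _ hij (X_mem k i) (X_mem k j) _).symm
  · rw [← Proj.SpecMap_awayMap_awayι _ (X_mem k j) one_pos (X_mem k i)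
      (mul_comm _ _),
      ← Category.assoc, ← Spec.map_comp, ← CommRingCat.ofHom_comp, pointOf]
    congr 3
    ext y
    exact (evalAway_awayMap ξ _ _ _ (mul_comm _ _) _ hij (X_mem k j)
      (X_mem k i) _)

lemma chart_projSpaceStr (i : Fin (n + 1)) :
    chart k n i ≫ projSpaceStr k n = Spec.map (CommRingCat.ofHom
      ((fromZeroRingHom _ _).comp (algebraMap k (homogeneousSubmodule (Fin (n + 1)) k 0)))) := by
  rw [chart, projSpaceStr, Proj.awayι_toSpecZero_assoc, ← Spec.map_comp, ← CommRingCat.ofHom_comp]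

lemma fromZeroRingHom_algebraMap (i : Fin (n + 1)) (c : k) :
    fromZeroRingHom (homogeneousSubmodule (Fin (n + 1)) k) (Submonoid.powers (X i))
      (algebraMap k (homogeneousSubmodule (Fin (n + 1)) k 0) c) =
      Away.mk _ (X_mem k i) 0 (C c) (C_mem c) := by
  apply HomogeneousLocalization.val_injective
  rw [Away.val_mk]
  simp only [pow_zero]
  rfl

lemma pointOf_projSpaceStr (ξ : Fin (n + 1) → F) (i : Fin (n + 1)) (h : ξ i ≠ 0) :
    pointOf k ξ i h ≫ projSpaceStr k n = Spec.map (CommRingCat.ofHom (algebraMap k F)) := by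
  rw [pointOf, Category.assoc, chart_projSpaceStr, ← Spec.map_comp, ← CommRingCat.ofHom_comp]
  congr 2
  ext c
  simp only [RingHom.comp_apply]
  rw [fromZeroRingHom_algebraMap, evalAway_mk]
  simp

/-- `ξ` is a vector of homogeneous coordinates of the point `g`. -/
def IsCoord (g : Spec (.of F) ⟶ projSpace k n) (ξ : Fin (n + 1) → F) : Prop :=
  (∃ i, ξ i ≠ 0) ∧ ∀ i,
    (∀ x, g x ∈ chartOpen k n i → ξ i ≠ 0) ∧
    ∀ h : ξ i ≠ 0, g = pointOf k ξ i h

lemma mem_chartOpen_of_ne_zero (ξ : Fin (n + 1) → F) (i : Fin (n + 1)) (h : ξ i ≠ 0)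
    (x : Spec (.of F)) : pointOf k ξ i h x ∈ chartOpen k n i := by
  rw [← opensRange_chart, pointOf, Scheme.Hom.comp_apply]
  exact ⟨_, rfl⟩

lemma ne_zero_of_mem_chartOpen (ξ : Fin (n + 1) → F) (i j : Fin (n + 1)) (h : ξ i ≠ 0)
    (x : Spec (.of F)) (hj : pointOf k ξ i h x ∈ chartOpen k n j) : ξ j ≠ 0 := by
  rw [pointOf, Scheme.Hom.comp_apply] at hj
  have h2 : Spec.map (CommRingCat.ofHom (evalAway ξ (X i) (aeval_X_ne_zero (k := k) h))) x ∈ chart k n i ⁻¹ᵁ chartOpen k n j := hj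
  rw [chart, chartOpen, Proj.awayι_preimage_basicOpen _ (X_mem k i) one_pos
    (X_mem k j) one_pos] at h2
  intro h0
  apply h2
  change evalAway ξ (X i) (aeval_X_ne_zero (k := k) h)
    (Away.isLocalizationElem (X_mem k i) (X_mem k j)) ∈ PrimeSpectrum.asIdeal x
  have : evalAway ξ (X i) (aeval_X_ne_zero (k := k) h)
      (Away.isLocalizationElem (X_mem k i) (X_mem k j)) = 0 := by
    rw [Away.isLocalizationElem, evalAway_mk]
    simp [h0]
  rw [this]
  exact zero_mem _

lemma isCoord_pointOf (ξ : Fin (n + 1) → F) (i : Fin (n + 1)) (h : ξ i ≠ 0) :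
    IsCoord (pointOf k ξ i h) ξ :=
  ⟨⟨i, h⟩, fun _ ↦ ⟨fun x ↦ ne_zero_of_mem_chartOpen ξ _ _ h x, fun h' ↦ pointOf_eq ξ _ _ h h'⟩⟩

variable (k n) in
lemma adjoin_zero_range_X : Algebra.adjoin (homogeneousSubmodule (Fin (n + 1)) k 0)
    (Set.range (X : Fin (n + 1) → MvPolynomial (Fin (n + 1)) k)) = ⊤ := by
  have h : (Algebra.adjoin k (Set.range X) : Subalgebra k (MvPolynomial (Fin (n + 1)) k)) = ⊤ :=
    adjoin_range_X
  rw [eq_top_iff]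
  intro p _
  have hp : p ∈ Algebra.adjoin k (Set.range (X : Fin (n + 1) → MvPolynomial (Fin (n + 1)) k)) := by
    rw [h]; trivial
  induction hp using Algebra.adjoin_induction with
  | mem x hx => exact Algebra.subset_adjoin hx
  | algebraMap r =>
    exact Subalgebra.algebraMap_mem
      (Algebra.adjoin (homogeneousSubmodule (Fin (n + 1)) k 0) (Set.range X))
      (⟨C r, isHomogeneous_C _ r⟩ : homogeneousSubmodule (Fin (n + 1)) k 0)
  | add x y _ _ hx hy => exact add_mem (hx trivial) (hy trivial)
  | mul x y _ _ hx hy => exact mul_mem (hx trivial) (hy trivial)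

lemma iSup_chartOpen : ⨆ i, chartOpen k n i = ⊤ :=
  Proj.iSup_basicOpen_eq_top' _ _ (fun i ↦ ⟨1, X_mem k i⟩) (adjoin_zero_range_X k n)

lemma aeval_mul_of_isHomogeneous {S : Type*} [CommRing S] [Algebra k S]
    {a : MvPolynomial (Fin (n + 1)) k} {m : ℕ} (ha : a ∈ homogeneousSubmodule (Fin (n + 1)) k m)
    (u : S) (g : Fin (n + 1) → S) : aeval (fun j ↦ u * g j) a = u ^ m * aeval g a := by
  rw [aeval_def, aeval_def, eval₂_eq', eval₂_eq', Finset.mul_sum]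
  refine Finset.sum_congr rfl fun d hd ↦ ?_
  have hdm : ∑ j, d j = m := by
    have := (mem_homogeneousSubmodule m a).1 ha (mem_support_iff.1 hd)
    rwa [Finsupp.weight_apply, Finsupp.sum_fintype _ _ (by simp), Finset.sum_congr rfl
      (fun _ _ ↦ by rw [Pi.one_apply, smul_eq_mul, mul_one])] at this
  simp_rw [mul_pow]
  rw [Finset.prod_mul_distrib, Finset.prod_pow_eq_pow_sum, hdm]
  ring

/-- Dehomogenisation: the fraction `a / X i ^ m` is `a` evaluated at the ratios `X j / X i`, so
constants and these ratios generate the chart ring. -/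
lemma eval₂Hom_eq_mk (i : Fin (n + 1)) {a : MvPolynomial (Fin (n + 1)) k} {m : ℕ}
    (ha : a ∈ homogeneousSubmodule (Fin (n + 1)) k (m • 1)) :
    eval₂Hom ((fromZeroRingHom (homogeneousSubmodule (Fin (n + 1)) k) (Submonoid.powers (X i))).comp
      (algebraMap k (homogeneousSubmodule (Fin (n + 1)) k 0)))
      (fun j ↦ Away.mk _ (X_mem k i) 1 (X j) (X_mem' k j)) a = Away.mk _ (X_mem k i) m a ha := by
  apply HomogeneousLocalization.val_injective
  rw [Away.val_mk, ← HomogeneousLocalization.algebraMap_apply, map_eval₂Hom]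
  let u : Localization.Away (X i : MvPolynomial (Fin (n + 1)) k) :=
    Localization.mk 1 ⟨X i, 1, pow_one _⟩
  trans aeval (fun j ↦ u * algebraMap (MvPolynomial (Fin (n + 1)) k)
    (Localization.Away (X i : MvPolynomial (Fin (n + 1)) k)) (X j)) a
  · rw [aeval_def, coe_eval₂Hom]
    congr 1
    funext j
    rw [HomogeneousLocalization.algebraMap_apply, Away.val_mk, ← Localization.mk_one_eq_algebraMap,
      Localization.mk_mul]
    congr 1 <;> simp
  · have : aeval (fun j ↦ algebraMap (MvPolynomial (Fin (n + 1)) k)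
        (Localization.Away (X i : MvPolynomial (Fin (n + 1)) k)) (X j)) a = algebraMap _ _ a := by
      exact (aeval_algebraMap_apply _ X a).trans (by rw [aeval_X_left_apply])
    rw [aeval_mul_of_isHomogeneous ha, this, ← Localization.mk_one_eq_algebraMap,
      Localization.mk_pow, Localization.mk_mul]
    congr 1
    · simp
    · exact Subtype.ext (by simp)

lemma evalAway_eq (i : Fin (n + 1)) (ψ : Away (homogeneousSubmodule (Fin (n + 1)) k) (X i) →+* F)
    (ξ : Fin (n + 1) → F) (hξ0 : ξ i ≠ 0)
    (hc : ∀ c : k, ψ (Away.mk _ (X_mem k i) 0 (C c) (C_mem c)) = algebraMap k F c)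
    (hX : ∀ j, ψ (Away.mk _ (X_mem k i) 1 (X j) (X_mem' k j)) = ξ j / ξ i) :
    evalAway ξ (X i) (aeval_X_ne_zero (k := k) hξ0) = ψ := by
  have key : ∀ χ : Away (homogeneousSubmodule (Fin (n + 1)) k) (X i) →+* F,
      (∀ c : k, χ (Away.mk _ (X_mem k i) 0 (C c) (C_mem c)) = algebraMap k F c) →
      (∀ j, χ (Away.mk _ (X_mem k i) 1 (X j) (X_mem' k j)) = ξ j / ξ i) →
      ∀ m a ha, χ (Away.mk _ (X_mem k i) m a ha) = aeval (fun j ↦ ξ j / ξ i) a := by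
    intro χ h₁ h₂ m a ha
    rw [← eval₂Hom_eq_mk, map_eval₂Hom, aeval_def, coe_eval₂Hom]
    congr 1
    · ext c
      rw [← h₁ c, ← fromZeroRingHom_algebraMap]
      rfl
    · funext j
      exact h₂ j
  ext y
  obtain ⟨m, a, ha, rfl⟩ := Away.mk_surjective _ (X_mem k i) y
  rw [key ψ hc hX, key]
  · intro c
    rw [evalAway_mk]; simp
  · intro j
    rw [evalAway_mk]; simp

/-- In a chart containing the image point, take as coordinates the values of `X j / X i`, so that `ξ
i = 1`. -/
lemma exists_isCoord (g : Spec (.of F) ⟶ projSpace k n)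
    (hg : g ≫ projSpaceStr k n = Spec.map (CommRingCat.ofHom (algebraMap k F))) :
    ∃ ξ : Fin (n + 1) → F, IsCoord g ξ := by
  let pt : Spec (.of F) := IsLocalRing.closedPoint F
  have : g pt ∈ ⨆ i, chartOpen k n i := by
    rw [iSup_chartOpen]; trivial
  obtain ⟨i, hi⟩ := TopologicalSpace.Opens.mem_iSup.mp this
  rw [← opensRange_chart] at hi
  have hr : Set.range g ⊆ Set.range (chart k n i) := by
    rintro _ ⟨x, rfl⟩
    rwa [Subsingleton.elim x pt]
  obtain ⟨ψ, hψ⟩ := Spec.map_surjective (IsOpenImmersion.lift (chart k n i) g hr)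
  have hgψ : g = Spec.map ψ ≫ chart k n i := by rw [hψ, IsOpenImmersion.lift_fac]
  have hc : ∀ c : k, ψ (Away.mk _ (X_mem k i) 0 (C c)
      (C_mem c)) = algebraMap k F c := by
    intro c
    rw [hgψ, Category.assoc, chart_projSpaceStr, ← Spec.map_comp] at hg
    have := congr($(Spec.map_injective hg) c)
    rw [← fromZeroRingHom_algebraMap]
    exact this
  let ξ : Fin (n + 1) → F := fun j ↦ ψ (Away.mk _ (X_mem k i) 1 (X j)
    (X_mem' k j))
  have hξi : ξ i = 1 := by
    rw [← map_one ψ.hom]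
    dsimp only [ξ]
    refine congrArg ψ.hom (HomogeneousLocalization.val_injective _ ?_)
    rw [Away.val_mk, val_one]
    simp only [pow_one]
    exact Localization.mk_self (⟨X i, 1, pow_one _⟩ : Submonoid.powers (X i : MvPolynomial (Fin (n + 1)) k))
  have hξ0 : ξ i ≠ 0 := by rw [hξi]; exact one_ne_zero
  have hξ : evalAway ξ (X i) (aeval_X_ne_zero (k := k) hξ0) = ψ.hom := by
    exact evalAway_eq i ψ.hom ξ hξ0 hc fun j ↦ by simp [hξi, ξ]
  have : g = pointOf k ξ i hξ0 := by
    rw [hgψ, pointOf, hξ]; rfl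
  exact ⟨ξ, this ▸ isCoord_pointOf _ _ _⟩

lemma range_evalAway (ξ : Fin (n + 1) → F) (i : Fin (n + 1)) (h : ξ i ≠ 0) (z : F) :
    z ∈ (evalAway ξ (X i) (aeval_X_ne_zero (k := k) h)).range ↔
      z ∈ Algebra.adjoin k (Set.range fun j ↦ ξ j / ξ i) := by
  rw [Algebra.adjoin_range_eq_range_aeval]
  constructor
  · rintro ⟨y, rfl⟩
    obtain ⟨m, a, ha, rfl⟩ := Away.mk_surjective _ (X_mem k i) y
    refine ⟨a, ?_⟩
    rw [evalAway_mk, aeval_X]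
    simp_rw [div_eq_inv_mul]
    exact (aeval_mul_of_isHomogeneous ha _ _).trans (by simp [inv_pow])
  · rintro ⟨p, rfl⟩
    refine ⟨eval₂Hom ((fromZeroRingHom (homogeneousSubmodule (Fin (n + 1)) k)
      (Submonoid.powers (X i))).comp (algebraMap k (homogeneousSubmodule (Fin (n + 1)) k 0)))
      (fun j ↦ Away.mk _ (X_mem k i) 1 (X j) (X_mem' k j)) p, ?_⟩
    rw [map_eval₂Hom, coe_eval₂Hom]
    change _ = aeval _ p
    rw [aeval_def]
    congr 1
    · ext c
      rw [RingHom.comp_apply, RingHom.comp_apply, fromZeroRingHom_algebraMap, evalAway_mk]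
      simp
    · funext j
      rw [evalAway_mk]
      simp

end Points
end PrimBir

/-! ### Affine charts of an integral closed subscheme of projective space -/

namespace PrimBir

attribute [local instance] MvPolynomial.gradedAlgebra
open MvPolynomial HomogeneousLocalization

section Charts

variable {k : Type u} [Field k] {n : ℕ} {F : Type u} [Field F] [Algebra k F]
  {V : Scheme.{u}} [IsIntegral V]

open Scheme

lemma isAffineOpen_chartOpen (i : Fin (n + 1)) : IsAffineOpen (chartOpen k n i) :=
  Proj.isAffineOpen_basicOpen _ _ (X_mem k i) one_pos

variable (k n) in
/-- Homogeneous fractions as sections over a standard affine open subset. -/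
noncomputable def chartSection (i : Fin (n + 1)) :
    CommRingCat.of (Away (homogeneousSubmodule (Fin (n + 1)) k) (X i)) ⟶
      Γ(projSpace k n, chartOpen k n i) :=
  Proj.awayToSection (homogeneousSubmodule (Fin (n + 1)) k) (X i)

lemma specMap_chartSection_chart (i : Fin (n + 1)) :
    Spec.map (chartSection k n i) ≫ chart k n i =
      (isAffineOpen_chartOpen (k := k) i).fromSpec := by
  have hD := isAffineOpen_chartOpen (k := k) (n := n) i
  rw [← cancel_epi hD.isoSpec.hom, hD.isoSpec_hom_fromSpec]
  have h : hD.isoSpec.hom ≫ Spec.map (chartSection k n i) =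
    (Proj.basicOpenIsoSpec _ (X i) (X_mem k i) one_pos).hom := rfl
  rw [← Category.assoc, h, chart, Proj.awayι]
  exact Iso.hom_inv_id_assoc _ _

lemma chartSection_bijective (i : Fin (n + 1)) : Function.Bijective (chartSection k n i) := by
  exact (Proj.basicOpenIsoAway (homogeneousSubmodule (Fin (n + 1)) k) (X i) (X_mem k i)
    one_pos).commRingCatIsoToRingEquiv.bijective

variable (ι : V ⟶ projSpace k n) (φ : V.functionField ⟶ .of F) {ξ : Fin (n + 1) → F}
  (hξ : IsCoord (Spec.map φ ≫ V.genericMap ≫ ι) ξ)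

include hξ

omit hξ [Algebra k F] in
lemma genericMap_apply_eq (pt : Spec (.of F)) : V.genericMap (Spec.map φ pt) = genericPoint V := by
  have : V.genericMap (Spec.map φ pt) ∈ Set.range V.genericMap := ⟨_, rfl⟩
  rw [range_fromSpecStalk] at this
  exact (this.antisymm (genericPoint_specializes _)).eq

lemma genericPoint_mem_chart {i : Fin (n + 1)} (h : ξ i ≠ 0) :
    genericPoint V ∈ ι ⁻¹ᵁ chartOpen k n i := by
  let pt : Spec (.of F) := IsLocalRing.closedPoint F
  have h1 := mem_chartOpen_of_ne_zero (k := k) ξ i h pt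
  rwa [← (hξ.2 i).2 h, Scheme.Hom.comp_apply, Scheme.Hom.comp_apply, genericMap_apply_eq] at h1

lemma chart_eq_bot {i : Fin (n + 1)} (h : ξ i = 0) : ι ⁻¹ᵁ chartOpen k n i = ⊥ := by
  by_contra hne
  have hg : genericPoint V ∈ ι ⁻¹ᵁ chartOpen k n i :=
    ((genericPoint_spec V).mem_open_set_iff (ι ⁻¹ᵁ chartOpen k n i).isOpen).2
      (by simpa using (TopologicalSpace.Opens.ne_bot_iff_nonempty _).1 hne)
  let pt : Spec (.of F) := IsLocalRing.closedPoint F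
  refine (hξ.2 i).1 pt ?_ h
  rw [Scheme.Hom.comp_apply, Scheme.Hom.comp_apply, genericMap_apply_eq]
  exact hg

omit hξ in
lemma iSup_chart {V : Scheme.{u}} (ι : V ⟶ projSpace k n) : ⨆ i, ι ⁻¹ᵁ chartOpen k n i = ⊤ := by
  rw [← Scheme.Hom.preimage_iSup, iSup_chartOpen]; rfl

omit hξ in
lemma exists_mem_chart {V : Scheme.{u}} (ι : V ⟶ projSpace k n) (x : V) : ∃ i, x ∈ ι ⁻¹ᵁ chartOpen k n i :=
  TopologicalSpace.Opens.mem_iSup.mp (by rw [iSup_chart]; trivial)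

lemma ne_zero_of_mem_chart {i : Fin (n + 1)} {x : V} (hx : x ∈ ι ⁻¹ᵁ chartOpen k n i) :
    ξ i ≠ 0 := fun h ↦ by
  rw [chart_eq_bot ι φ hξ h] at hx
  exact hx

/-- The ring of functions on a chart, as a subring of `F`. -/
lemma range_germ_chart [IsClosedImmersion ι] {i : Fin (n + 1)} (h : ξ i ≠ 0) (z : F) :
    (∃ s : Γ(V, ι ⁻¹ᵁ chartOpen k n i),
      φ (V.presheaf.germ _ (genericPoint V) (genericPoint_mem_chart ι φ hξ h) s) = z) ↔
      z ∈ Algebra.adjoin k (Set.range fun j ↦ ξ j / ξ i) := by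
  have hD := isAffineOpen_chartOpen (k := k) (n := n) i
  have hU := hD.preimage ι
  have key : chartSection k n i ≫
      ι.app (chartOpen k n i) ≫
      V.presheaf.germ _ (genericPoint V) (genericPoint_mem_chart ι φ hξ h) ≫ φ =
      CommRingCat.ofHom (evalAway ξ (X i) (aeval_X_ne_zero (k := k) h)) := by
    apply Spec.map_injective
    rw [← cancel_mono (chart k n i)]
    have := (hξ.2 i).2 h
    rw [pointOf] at this
    rw [← this]
    simp only [Spec.map_comp, Category.assoc]
    rw [specMap_chartSection_chart]
    have h1 := hU.fromSpecStalk_eq_fromSpecStalk (genericPoint_mem_chart ι φ hξ h)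
    rw [IsAffineOpen.fromSpecStalk] at h1
    rw [genericMap, ← h1, Category.assoc, ← IsAffineOpen.SpecMap_appLE_fromSpec ι hD hU le_rfl,
      Scheme.Hom.app_eq_appLE]
  -- A closed immersion is surjective on functions over affine opens, so all functions on the chart
  -- come from projective space.
  have hsurj : Function.Surjective (chartSection k n i ≫ ι.app (chartOpen k n i)) := by
    intro s
    obtain ⟨t, rfl⟩ := ι.app_surjective (chartOpen k n i) hD s
    obtain ⟨w, rfl⟩ := (chartSection_bijective i).2 t
    exact ⟨w, rfl⟩
  rw [← range_evalAway ξ i h]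
  constructor
  · rintro ⟨s, rfl⟩
    obtain ⟨w, rfl⟩ := hsurj s
    exact ⟨w, congr($key.symm w)⟩
  · rintro ⟨w, rfl⟩
    exact ⟨_, congr($key w)⟩

lemma exists_hom_stalk {j : Fin (n + 1)} {x : V} (hx : x ∈ ι ⁻¹ᵁ chartOpen k n j) :
    ∃ χ : CommRingCat.of (Away (homogeneousSubmodule (Fin (n + 1)) k) (X j)) ⟶ V.presheaf.stalk x,
      V.fromSpecStalk x ≫ ι = Spec.map χ ≫ chart k n j ∧
      χ ≫ stalkToFunctionField x ≫ φ = CommRingCat.ofHom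
        (evalAway ξ (X j) (aeval_X_ne_zero (k := k) (ne_zero_of_mem_chart ι φ hξ hx))) := by
  have hr : Set.range (V.fromSpecStalk x ≫ ι) ⊆ Set.range (chart k n j) := by
    rintro _ ⟨y, rfl⟩
    have hy : V.fromSpecStalk x y ∈ Set.range (V.fromSpecStalk x) := ⟨y, rfl⟩
    rw [range_fromSpecStalk] at hy
    have := hy.mem_open (ι ⁻¹ᵁ chartOpen k n j).isOpen hx
    change _ ∈ (chart k n j).opensRange
    rw [opensRange_chart]
    exact this
  obtain ⟨χ, hχ⟩ := Spec.map_surjective (IsOpenImmersion.lift (chart k n j) _ hr)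
  have hχ' : V.fromSpecStalk x ≫ ι = Spec.map χ ≫ chart k n j := by
    rw [hχ, IsOpenImmersion.lift_fac]
  refine ⟨χ, hχ', Spec.map_injective ?_⟩
  rw [← cancel_mono (chart k n j)]
  have := (hξ.2 j).2 (ne_zero_of_mem_chart ι φ hξ hx)
  rw [pointOf] at this
  rw [← this, Spec.map_comp, Spec.map_comp, Category.assoc, Category.assoc, ← hχ',
    specMap_stalkToFunctionField_assoc]

/-- The ratio of two coordinates is a regular function on the chart of the denominator. -/
lemma div_mem_stalk {j : Fin (n + 1)} {x : V} (hx : x ∈ ι ⁻¹ᵁ chartOpen k n j) (i : Fin (n + 1)) :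
    ∃ s : V.presheaf.stalk x, φ (stalkToFunctionField x s) = ξ i / ξ j ∧
      (IsUnit s → x ∈ ι ⁻¹ᵁ chartOpen k n i) := by
  obtain ⟨χ, hχ, hχ'⟩ := exists_hom_stalk ι φ hξ hx
  refine ⟨χ (Away.isLocalizationElem (X_mem k j) (X_mem k i)), ?_, ?_⟩
  · have := congr($hχ' (Away.isLocalizationElem (X_mem k j) (X_mem k i)))
    refine this.trans ?_
    change evalAway ξ (X j) (aeval_X_ne_zero (k := k) (ne_zero_of_mem_chart ι φ hξ hx)) _ = _
    rw [Away.isLocalizationElem, evalAway_mk]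
    simp
  · intro hu
    let pt : Spec (V.presheaf.stalk x) := IsLocalRing.closedPoint (V.presheaf.stalk x)
    have h1 : ι x = (Spec.map χ ≫ chart k n j) pt := by
      rw [← hχ, Scheme.Hom.comp_apply, (fromSpecStalk_closedPoint : V.fromSpecStalk x pt = x)]
    change ι x ∈ chartOpen k n i
    rw [h1, Scheme.Hom.comp_apply]
    change Spec.map χ pt ∈
      chart k n j ⁻¹ᵁ chartOpen k n i
    rw [chart, chartOpen, Proj.awayι_preimage_basicOpen _ (X_mem k j) one_pos (X_mem k i) one_pos]
    change ¬ (χ (Away.isLocalizationElem (X_mem k j) (X_mem k i)) ∈ IsLocalRing.maximalIdeal _)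
    rwa [IsLocalRing.mem_maximalIdeal, mem_nonunits_iff, not_not]

/-- An element of the local ring at a point of a chart is a quotient of functions on the chart. -/
lemma exists_div_eq_stalk [IsClosedImmersion ι] {i : Fin (n + 1)} {x : V}
    (hx : x ∈ ι ⁻¹ᵁ chartOpen k n i) (s : V.presheaf.stalk x) :
    ∃ a ∈ Algebra.adjoin k (Set.range fun j ↦ ξ j / ξ i), ∃ t : V.presheaf.stalk x, IsUnit t ∧
      φ (stalkToFunctionField x t) ∈ Algebra.adjoin k (Set.range fun j ↦ ξ j / ξ i) ∧
      φ (stalkToFunctionField x s) * φ (stalkToFunctionField x t) = a := by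
  have hU := (isAffineOpen_chartOpen (k := k) (n := n) i).preimage ι
  have hi := ne_zero_of_mem_chart ι φ hξ hx
  have hloc := hU.isLocalization_stalk ⟨x, hx⟩
  have hgerm : ∀ r, φ (stalkToFunctionField x (V.presheaf.germ _ x hx r)) =
      φ (V.presheaf.germ _ (genericPoint V) (genericPoint_mem_chart ι φ hξ hi) r) := by
    intro r
    congr 1
    exact congr($(V.presheaf.germ_stalkSpecializes hx
      ((genericPoint_spec V).specializes trivial)) r)
  let := (V.presheaf.germ (ι ⁻¹ᵁ chartOpen k n i) x hx).hom.toAlgebra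
  obtain ⟨⟨a, b⟩, hab⟩ := IsLocalization.surj (hU.primeIdealOf ⟨x, hx⟩).asIdeal.primeCompl s
  have hb := IsLocalization.map_units (V.presheaf.stalk x) b
  have hab' : s * V.presheaf.germ _ x hx b.1 = V.presheaf.germ _ x hx a := hab
  refine ⟨_, (range_germ_chart ι φ hξ hi _).1 ⟨a, rfl⟩, V.presheaf.germ _ x hx b.1, hb, ?_, ?_⟩
  · rw [hgerm]
    exact (range_germ_chart ι φ hξ hi _).1 ⟨b.1, rfl⟩
  · rw [← map_mul, ← map_mul, hab', hgerm]

end Charts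
end PrimBir

/-! ### Regularity of rational functions, and codimension one -/

namespace AlgebraicGeometry.Scheme
variable {X : Scheme.{u}} [IsIntegral X]

lemma stalkToFunctionField_germ {U : X.Opens} {x : X} (hx : x ∈ U)
    (hg : genericPoint X ∈ U) (s : Γ(X, U)) :
    stalkToFunctionField x (X.presheaf.germ U x hx s) =
      X.presheaf.germ U (genericPoint X) hg s :=
  congr($(X.presheaf.germ_stalkSpecializes hx ((genericPoint_spec X).specializes trivial)) s)

lemma _root_.AlgebraicGeometry.IsAffineOpen.primeIdealOf_fromSpec {X : Scheme.{u}} {U : X.Opens}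
    (hU : IsAffineOpen U) (p : Spec Γ(X, U)) (hp : hU.fromSpec p ∈ U) :
    hU.primeIdealOf ⟨hU.fromSpec p, hp⟩ = p :=
  hU.fromSpec.isOpenEmbedding.injective (hU.fromSpec_primeIdealOf _)

lemma _root_.AlgebraicGeometry.IsAffineOpen.fromSpec_mem {X : Scheme.{u}} {U : X.Opens}
    (hU : IsAffineOpen U) (p : Spec Γ(X, U)) : hU.fromSpec p ∈ U := by
  have : hU.fromSpec p ∈ Set.range hU.fromSpec := ⟨p, rfl⟩
  rwa [hU.range_fromSpec] at this

/-- Elements of a local ring are quotients of functions on an affine neighbourhood. -/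
lemma _root_.AlgebraicGeometry.IsAffineOpen.exists_mul_germ_eq {U : X.Opens} (hU : IsAffineOpen U)
    (p : Spec Γ(X, U)) (s : X.presheaf.stalk (hU.fromSpec p)) :
    ∃ a b : Γ(X, U), b ∉ p.asIdeal ∧
      s * X.presheaf.germ U _ (hU.fromSpec_mem p) b = X.presheaf.germ U _ (hU.fromSpec_mem p) a := by
  let := (X.presheaf.germ U _ (hU.fromSpec_mem p)).hom.toAlgebra
  have : p.asIdeal.IsPrime := PrimeSpectrum.isPrime p
  have hloc := hU.isLocalization_stalk ⟨_, hU.fromSpec_mem p⟩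
  obtain ⟨⟨a, b⟩, hab⟩ := IsLocalization.surj (hU.primeIdealOf ⟨_, hU.fromSpec_mem p⟩).asIdeal.primeCompl s
  exact ⟨a, b.1, (by simpa only [hU.primeIdealOf_fromSpec] using! b.2 : b.1 ∈ p.asIdeal.primeCompl),
    hab⟩

/-- A rational function regular at all points of an affine open subset is regular on it. -/
lemma _root_.AlgebraicGeometry.IsAffineOpen.exists_germ_eq {U : X.Opens} (hU : IsAffineOpen U)
    (hg : genericPoint X ∈ U) (z : X.functionField)
    (hz : ∀ y ∈ U, ∃ s : X.presheaf.stalk y, stalkToFunctionField y s = z) :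
    ∃ a : Γ(X, U), X.presheaf.germ U (genericPoint X) hg a = z := by
  -- The ideal of denominators of `z`: regularity at each point keeps it out of every maximal ideal.
  let I : Ideal Γ(X, U) :=
    { carrier := {b | ∃ a, z * X.presheaf.germ U (genericPoint X) hg b =
        X.presheaf.germ U (genericPoint X) hg a}
      zero_mem' := ⟨0, by simp⟩
      add_mem' := by
        rintro b c ⟨a, ha⟩ ⟨d, hd⟩
        exact ⟨a + d, by rw [map_add, map_add, mul_add, ha, hd]⟩
      smul_mem' := by
        rintro c b ⟨a, ha⟩
        exact ⟨c * a, by rw [smul_eq_mul, map_mul, map_mul, ← ha]; ring⟩ }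
  have hI : I = ⊤ := by
    by_contra hne
    obtain ⟨m, hm, hIm⟩ := Ideal.exists_le_maximal I hne
    let p : Spec Γ(X, U) := ⟨m, hm.isPrime⟩
    obtain ⟨s, hs⟩ := hz _ (hU.fromSpec_mem p)
    obtain ⟨a, b, hb, hab⟩ := hU.exists_mul_germ_eq p s
    refine hb (hIm ⟨a, ?_⟩)
    have := congr(stalkToFunctionField _ $hab)
    rwa [map_mul, hs, stalkToFunctionField_germ _ hg, stalkToFunctionField_germ _ hg] at this
  obtain ⟨a, ha⟩ : (1 : Γ(X, U)) ∈ I := hI ▸ trivial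
  exact ⟨a, by rw [← ha, map_one, mul_one]⟩

/-- A rational function on a normal locally noetherian integral scheme is regular at a point if it
is regular at all its generizations of codimension at most one. -/
theorem exists_stalk_of_forall_specializes [IsLocallyNoetherian X] (y : X)
    [IsIntegrallyClosed (X.presheaf.stalk y)] (z : X.functionField)
    (hz : ∀ x : X, x ⤳ y → ringKrullDim (X.presheaf.stalk x) ≤ 1 →
      ∃ s : X.presheaf.stalk x, stalkToFunctionField x s = z) :
    ∃ s : X.presheaf.stalk y, stalkToFunctionField y s = z := by
  obtain ⟨_, ⟨U, hU, rfl⟩, hy, -⟩ := X.isBasis_affineOpens.exists_subset_of_mem_open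
    (Set.mem_univ y) isOpen_univ
  have hg : genericPoint X ∈ U := (genericPoint_specializes y).mem_open U.2 hy
  let P₀ : Spec Γ(X, U) := hU.primeIdealOf ⟨y, hy⟩
  have hP₀ : hU.fromSpec P₀ = y := hU.fromSpec_primeIdealOf ⟨y, hy⟩
  -- Algebraic Hartogs in the local ring at `y`, whose primes are the generizations of `y`; the
  -- affine `U` serves to compare heights with dimensions of stalks.
  obtain ⟨a, ha⟩ := mem_range_of_forall_height_le_one (R := X.presheaf.stalk y) z fun p hp hp1 ↦ by
    let := (X.presheaf.germ U y hy).hom.toAlgebra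
    have hloc₀ := hU.isLocalization_stalk ⟨y, hy⟩
    let q : Ideal Γ(X, U) := p.comap (X.presheaf.germ U y hy).hom
    have hq : q.IsPrime := inferInstance
    let P : Spec Γ(X, U) := ⟨q, hq⟩
    have hqP₀ : q ≤ P₀.asIdeal := by
      intro a ha
      by_contra haP
      have h₁ := IsLocalization.map_units (X.presheaf.stalk y)
        (⟨a, haP⟩ : (hU.primeIdealOf ⟨y, hy⟩).asIdeal.primeCompl)
      exact hp.ne_top (Ideal.eq_top_of_isUnit_mem _ ha h₁)
    have hPy : hU.fromSpec P ⤳ y := by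
      have h₁ : P ⤳ P₀ := (PrimeSpectrum.le_iff_specializes P P₀).1 hqP₀
      have := h₁.map hU.fromSpec.continuous
      rwa [hP₀] at this
    have hht : q.height ≤ 1 := by
      have := IsLocalization.height_under (hU.primeIdealOf ⟨y, hy⟩).asIdeal.primeCompl p
      exact this.le.trans hp1
    let := (X.presheaf.germ U _ (hU.fromSpec_mem P)).hom.toAlgebra
    have hloc := hU.isLocalization_stalk ⟨_, hU.fromSpec_mem P⟩
    rw [hU.primeIdealOf_fromSpec] at hloc
    obtain ⟨s, hs⟩ := hz (hU.fromSpec P) hPy (by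
      rw [IsLocalization.AtPrime.ringKrullDim_eq_height q (X.presheaf.stalk (hU.fromSpec P))]
      exact_mod_cast hht)
    obtain ⟨a, b, hb, hab⟩ := hU.exists_mul_germ_eq P s
    refine ⟨X.presheaf.germ U y hy b, hb, X.presheaf.germ U y hy a, ?_⟩
    have := congr(stalkToFunctionField _ $hab)
    rw [map_mul, hs, stalkToFunctionField_germ _ hg, stalkToFunctionField_germ _ hg,
      ← stalkToFunctionField_germ hy hg, ← stalkToFunctionField_germ hy hg] at this
    exact (mul_comm _ _).trans this
  exact ⟨a, ha⟩

/-- Such a ring is a field or a discrete valuation ring. -/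
lemma valuationRing_of_ringKrullDim_le_one {R : Type*} [CommRing R] [IsDomain R] [IsLocalRing R]
    [IsNoetherianRing R] [IsIntegrallyClosed R] (h : ringKrullDim R ≤ 1) : ValuationRing R := by
  have : Ring.KrullDimLE 1 R := Ring.krullDimLE_iff.2 h
  have h' : IsIntegrallyClosed R ∧ ∀ P : Ideal R, P ≠ ⊥ → P.IsPrime →
      P = IsLocalRing.maximalIdeal R :=
    ⟨‹_›, fun P hP hP' ↦ IsLocalRing.eq_maximalIdeal
      (Ring.krullDimLE_one_iff_of_noZeroDivisors.1 this P hP hP')⟩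
  exact ((tfae_of_isNoetherianRing_of_isLocalRing_of_isDomain R).out 1 3).2 h'

end AlgebraicGeometry.Scheme

/-! ### Properness, and codimension one on a normal projective variety -/

namespace PrimBir

attribute [local instance] MvPolynomial.gradedAlgebra
open Scheme

section ProjSpace
variable (k : Type u) [Field k] (n : ℕ)

lemma algebraMap_homogeneousSubmodule_zero_bijective : Function.Bijective
    (algebraMap k (MvPolynomial.homogeneousSubmodule (Fin (n + 1)) k 0)) := by
  refine ⟨fun a b h ↦ MvPolynomial.C_injective (Fin (n + 1)) k congr(($h).1), fun ⟨p, hp⟩ ↦ ?_⟩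
  rw [MvPolynomial.mem_homogeneousSubmodule, ← MvPolynomial.totalDegree_zero_iff_isHomogeneous]
    at hp
  exact ⟨_, Subtype.ext (MvPolynomial.totalDegree_eq_zero_iff_eq_C.1 hp).symm⟩

instance : IsProper (projSpaceStr k n) := by
  have : IsIso (CommRingCat.ofHom
      (algebraMap k (MvPolynomial.homogeneousSubmodule (Fin (n + 1)) k 0))) :=
    (ConcreteCategory.isIso_iff_bijective _).2 (algebraMap_homogeneousSubmodule_zero_bijective k n)
  have : Algebra.FiniteType (MvPolynomial.homogeneousSubmodule (Fin (n + 1)) k 0)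
      (MvPolynomial (Fin (n + 1)) k) := by
    exact ⟨⟨(Set.finite_range MvPolynomial.X).toFinset, by
      rw [Set.Finite.coe_toFinset, adjoin_zero_range_X]⟩⟩
  rw [projSpaceStr]
  infer_instance

end ProjSpace

namespace NormalProjVariety

variable {k : Type u} [Field k] (M : NormalProjVariety k)

instance : IsProper M.str := by
  obtain ⟨n, i, hi, h⟩ := M.projective
  rw [← h]
  infer_instance

instance : IsProper (M.X ↘ Spec (.of k)) := inferInstanceAs (IsProper M.str)

instance : IsLocallyNoetherian M.X := LocallyOfFiniteType.isLocallyNoetherian M.str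

instance : CompactSpace M.X := QuasiCompact.compactSpace_of_compactSpace M.str

/-- The identification of `M.K` with the function field. -/
noncomputable def kHom : M.X.functionField ⟶ .of M.K := 𝟙 M.X.functionField

lemma toK_injective (x : M.X) : Function.Injective (M.toK x) :=
  IsFractionRing.injective (M.X.presheaf.stalk x) M.X.functionField

lemma specMap_kHom_genericMap_str :
    Spec.map M.kHom ≫ M.X.genericMap ≫ M.str = Spec.map (CommRingCat.ofHom (algebraMap k M.K)) := by
  have h₁ : M.str = M.X.toSpecΓ ≫ Spec.map M.str.appTop ≫ Spec.map (Scheme.ΓSpecIso (.of k)).inv := by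
    rw [← toSpecΓ_naturality_assoc]
    simp
  have h₂ : CommRingCat.ofHom (algebraMap k M.K) = (Scheme.ΓSpecIso (.of k)).inv ≫ M.str.appTop ≫
      M.X.presheaf.germ ⊤ (genericPoint M.X) trivial ≫ stalkToFunctionField (genericPoint M.X) ≫
      M.kHom := rfl
  rw [h₁, h₂]
  simp only [Spec.map_comp, Category.assoc]
  rw [fromSpecStalk_toSpecΓ_assoc]
  have h₃ : stalkToFunctionField (genericPoint M.X) = 𝟙 _ :=
    TopCat.Presheaf.stalkSpecializes_refl _ _
  rw [h₃, Spec.map_id, Category.id_comp]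

/-- Homogeneous coordinates on `M`. -/
lemma exists_coord : ∃ (n : ℕ) (ι : M.X ⟶ projSpace k n) (ξ : Fin (n + 1) → M.K),
    IsClosedImmersion ι ∧ IsCoord (Spec.map M.kHom ≫ M.X.genericMap ≫ ι) ξ := by
  obtain ⟨n, ι, hι, h⟩ := M.projective
  obtain ⟨ξ, hξ⟩ := exists_isCoord (Spec.map M.kHom ≫ M.X.genericMap ≫ ι)
    (by rw [Category.assoc, Category.assoc, h, M.specMap_kHom_genericMap_str])
  exact ⟨n, ι, ξ, hι, hξ⟩

lemma isUnit_of_inv_mem {x : M.X} {s : M.X.presheaf.stalk x} (h0 : M.toK x s ≠ 0)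
    (h : (M.toK x s)⁻¹ ∈ M.localRing x) : IsUnit s := by
  obtain ⟨t, ht⟩ := h
  refine IsUnit.of_mul_eq_one t (M.toK_injective x ?_)
  rw [map_mul, ht, map_one, mul_inv_cancel₀ h0]

lemma mem_localUnits {x : M.X} {u : M.Kˣ} :
    u ∈ localUnits M x ↔ (u : M.K) ∈ M.localRing x ∧ ((u⁻¹ : M.Kˣ) : M.K) ∈ M.localRing x := by
  rfl

lemma exists_div_toK (x : M.X) (z : M.K) : ∃ a b : M.X.presheaf.stalk x, b ≠ 0 ∧
    z * M.toK x b = M.toK x a := by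
  obtain ⟨a, b, hb, h⟩ := IsFractionRing.div_surjective (A := M.X.presheaf.stalk x)
    (K := M.X.functionField) z
  have hb0 := nonZeroDivisors.ne_zero hb
  refine ⟨a, b, hb0, ?_⟩
  have h0 : M.toK x b ≠ 0 := by rwa [Ne, map_eq_zero_iff _ (M.toK_injective x)]
  exact (eq_div_iff h0).1 h.symm

theorem mem_localRing_of_forall_specializes {z : M.K} {y : M.X}
    (hz : ∀ x : M.X, x ⤳ y → ringKrullDim (M.X.presheaf.stalk x) ≤ 1 → z ∈ M.localRing x) :
    z ∈ M.localRing y :=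
  have := M.normal y
  exists_stalk_of_forall_specializes y z hz

theorem mem_localRing_of_forall {z : M.K}
    (hz : ∀ x : M.X, ringKrullDim (M.X.presheaf.stalk x) ≤ 1 → z ∈ M.localRing x) (y : M.X) :
    z ∈ M.localRing y :=
  M.mem_localRing_of_forall_specializes fun x _ ↦ hz x

/-- By normality the local ring at `x` is a valuation ring, and the valuative criterion applies. -/
lemma mem_domain_of_ringKrullDim_le_one {B : NormalProjVariety k} (f : M.X ⤏ B.X)
    [f.IsOver (Spec (.of k))] {x : M.X} (hx : ringKrullDim (M.X.presheaf.stalk x) ≤ 1) :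
    x ∈ f.domain := by
  have := M.normal x
  have := valuationRing_of_ringKrullDim_le_one hx
  exact f.mem_domain_of_valuationRing (S := Spec (.of k)) x

end NormalProjVariety
end PrimBir

/-- Dehomogenisation of a form of degree `N`, the counterpart of `exists_mul_pow_mem_pow`. -/
lemma exists_eq_pow_mul_of_mem_span_pow {k K ι : Type*} [Field k] [Field K] [Algebra k K]
    (ξ : ι → K) {i : ι} (hi : ξ i ≠ 0) {N : ℕ} {w : K}
    (hw : w ∈ Submodule.span k (Set.range ξ) ^ N) :
    ∃ h ∈ Algebra.adjoin k (Set.range fun j ↦ ξ j / ξ i), w = ξ i ^ N * h := by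
  induction N generalizing w with
  | zero =>
    rw [pow_zero] at hw
    obtain ⟨c, rfl⟩ := Submodule.mem_one.1 hw
    exact ⟨_, Subalgebra.algebraMap_mem _ c, by simp⟩
  | succ N ih =>
    rw [pow_succ] at hw
    induction hw using Submodule.mul_induction_on' with
    | mem_mul_mem a ha b hb =>
      obtain ⟨h, hh, rfl⟩ := ih ha
      have : ∃ h' ∈ Algebra.adjoin k (Set.range fun j ↦ ξ j / ξ i), b = ξ i * h' := by
        induction hb using Submodule.span_induction with
        | mem x hx =>
          obtain ⟨j, rfl⟩ := hx
          exact ⟨_, Algebra.subset_adjoin ⟨j, rfl⟩, (mul_div_cancel₀ _ hi).symm⟩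
        | zero => exact ⟨0, zero_mem _, by simp⟩
        | add x y _ _ hx hy =>
          obtain ⟨a, ha, rfl⟩ := hx
          obtain ⟨b, hb, rfl⟩ := hy
          exact ⟨a + b, add_mem ha hb, by ring⟩
        | smul c x _ hx =>
          obtain ⟨a, ha, rfl⟩ := hx
          exact ⟨c • a, Subalgebra.smul_mem _ ha c, by rw [mul_smul_comm]⟩
      obtain ⟨h', hh', rfl⟩ := this
      exact ⟨h * h', mul_mem hh hh', by ring⟩
    | add x _ y _ hx hy =>
      obtain ⟨a, ha, rfl⟩ := hx
      obtain ⟨b, hb, rfl⟩ := hy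
      exact ⟨a + b, add_mem ha hb, by ring⟩

/-! ### Finite-dimensionality of spaces of sections -/

namespace PrimBir

open Scheme

namespace NormalProjVariety

variable {k : Type u} [Field k] (M : NormalProjVariety k)

section Coord

variable {M} {n : ℕ} {ι : M.X ⟶ projSpace k n} [IsClosedImmersion ι] {ξ : Fin (n + 1) → M.K}
  (hξ : IsCoord (Spec.map M.kHom ≫ M.X.genericMap ≫ ι) ξ)

include hξ

lemma mem_adjoin_of_forall_mem_localRing {i : Fin (n + 1)} (hi : ξ i ≠ 0) {z : M.K}
    (hz : ∀ y ∈ ι ⁻¹ᵁ chartOpen k n i, z ∈ M.localRing y) :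
    z ∈ Algebra.adjoin k (Set.range fun j ↦ ξ j / ξ i) := by
  rw [← range_germ_chart ι M.kHom hξ hi]
  exact ((isAffineOpen_chartOpen i).preimage ι).exists_germ_eq
    (genericPoint_mem_chart ι M.kHom hξ hi) z hz

lemma mem_localRing_of_mem_adjoin {i : Fin (n + 1)} {z : M.K}
    (hz : z ∈ Algebra.adjoin k (Set.range fun j ↦ ξ j / ξ i)) {y : M.X}
    (hy : y ∈ ι ⁻¹ᵁ chartOpen k n i) : z ∈ M.localRing y := by
  obtain ⟨s, rfl⟩ := (range_germ_chart ι M.kHom hξ (ne_zero_of_mem_chart ι M.kHom hξ hy) z).2 hz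
  exact ⟨_, stalkToFunctionField_germ hy _ s⟩

lemma exists_div_adjoin {i : Fin (n + 1)} (hi : ξ i ≠ 0) (z : M.K) :
    ∃ a ∈ Algebra.adjoin k (Set.range fun j ↦ ξ j / ξ i),
    ∃ b ∈ Algebra.adjoin k (Set.range fun j ↦ ξ j / ξ i), b ≠ 0 ∧ z * b = a := by
  obtain ⟨a, ha, t, ht, hb, h⟩ := exists_div_eq_stalk ι M.kHom hξ
    (genericPoint_mem_chart ι M.kHom hξ hi) z
  have hz : M.kHom (stalkToFunctionField (genericPoint M.X) z) = z := by
    have h₃ : stalkToFunctionField (genericPoint M.X) = 𝟙 _ :=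
      TopCat.Presheaf.stalkSpecializes_refl _ _
    rw [h₃]; rfl
  rw [hz] at h
  refine ⟨a, ha, _, hb, ?_, h⟩
  exact ((ht.map (stalkToFunctionField (genericPoint M.X)).hom).map M.kHom.hom).ne_zero

end Coord

/-- `M.K` is the fraction field of the finitely generated coordinate ring of a chart. -/
instance essFiniteType : Algebra.EssFiniteType k M.K := by
  obtain ⟨n, ι, ξ, hι, hξ⟩ := M.exists_coord
  obtain ⟨i, hi⟩ := hξ.1
  let S := Algebra.adjoin k (Set.range fun j ↦ ξ j / ξ i)
  have : Algebra.FiniteType k S :=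
    (Subalgebra.fg_iff_finiteType _).1 ⟨(Set.finite_range fun j ↦ ξ j / ξ i).toFinset, by simp [S]⟩
  have : IsFractionRing S M.K := by
    refine IsFractionRing.of_field S M.K fun z ↦ ?_
    obtain ⟨a, ha, b, hb, hb0, h⟩ := exists_div_adjoin hξ hi z
    exact ⟨⟨a, ha⟩, ⟨b, hb⟩, (eq_div_of_mul_eq hb0 h)⟩
  have : Algebra.EssFiniteType S M.K := .of_isLocalization _ (nonZeroDivisors S)
  exact .comp k S M.K

variable {M}

lemma exists_isLocalEquation (D : CartierDivisor M) (x : M.X) : ∃ d, IsLocalEquation D x d := by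
  obtain ⟨d, hd⟩ := QuotientGroup.mk_surjective (D.1 x)
  exact ⟨d, hd.symm⟩

/-- Multiplication by one fixed function `g` embeds the sections of `D` into functions that are `ξ i
^ m` times a regular function on every chart. These form a finite-dimensional space by
`finiteDimensional_of_forall_mem_adjoin`. -/
theorem finiteDimensional_globalSections [PerfectField k] (D : CartierDivisor M) :
    FiniteDimensional k (globalSections D) := by
  classical
  obtain ⟨n, ι, ξ, hι, hξ⟩ := M.exists_coord
  choose V hV d hd using D.2
  obtain ⟨t, ht⟩ := CompactSpace.elim_nhds_subcover (fun x ↦ (V x : Set M.X))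
    (fun x ↦ (V x).isOpen.mem_nhds (hV x))
  have hr : ∀ i, ξ i ≠ 0 → ∃ w : M.K, w ≠ 0 ∧ ∃ N, w ∈ Submodule.span k (Set.range ξ) ^ N ∧
      ∀ h ∈ globalSections D, ∃ c ∈ Algebra.adjoin k (Set.range fun j ↦ ξ j / ξ i),
        w * h = ξ i ^ N * c := by
    intro i hi
    -- Finitely many local equations suffice by compactness. The product of their numerators turns
    -- every section of `D` into a regular function on the chart.
    choose a ha b hb hb0 hab using fun x ↦ exists_div_adjoin hξ hi (d x : M.K)
    have ha0 : ∀ x, a x ≠ 0 := fun x ↦ by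
      rw [← hab]
      exact mul_ne_zero (d x).ne_zero (hb0 x)
    obtain ⟨N, hN⟩ := exists_mul_pow_mem_pow ξ hi
      (Subalgebra.prod_mem _ (t := t) fun x _ ↦ ha x)
    refine ⟨_, mul_ne_zero (Finset.prod_ne_zero_iff.2 fun x _ ↦ ha0 x) (pow_ne_zero N hi), N, hN,
      fun h hh ↦ ⟨(∏ x ∈ t, a x) * h, ?_, by ring⟩⟩
    refine mem_adjoin_of_forall_mem_localRing hξ hi fun y hy ↦ ?_
    have hyt : y ∈ ⋃ x ∈ t, (V x : Set M.X) := ht ▸ Set.mem_univ y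
    simp only [Set.mem_iUnion] at hyt
    obtain ⟨x, hx, hyx⟩ := hyt
    rw [← Finset.mul_prod_erase t a hx, ← hab, mul_comm ((d x : M.K) * b x), mul_assoc]
    refine mul_mem (Subring.prod_mem _ fun z _ ↦ mem_localRing_of_mem_adjoin hξ (ha z) hy) ?_
    have : (d x : M.K) * b x * h = b x * (h * d x) := by ring
    rw [this]
    exact mul_mem (mem_localRing_of_mem_adjoin hξ (hb x) hy) (hh y (d x) (hd x y hyx))
  choose! w hw0 N hwN hw using hr
  let I : Finset (Fin (n + 1)) := Finset.univ.filter fun i ↦ ξ i ≠ 0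
  let g : M.K := ∏ i ∈ I, w i
  have hg : g ≠ 0 := Finset.prod_ne_zero_iff.2 fun i hi ↦ hw0 i (by simpa [I] using hi)
  let L : M.K →ₗ[k] M.K := LinearMap.mulLeft k g
  have hfd : FiniteDimensional k ((globalSections D).map L) := by
    refine finiteDimensional_of_forall_mem_adjoin ξ hξ.1 (∑ i ∈ I, N i) _ ?_
    rintro _ ⟨h, hh, rfl⟩ i hi
    have hiI : i ∈ I := by simpa [I] using hi
    obtain ⟨c, hc, hwc⟩ := hw i hi h hh
    have hprod : ∃ e ∈ Algebra.adjoin k (Set.range fun j ↦ ξ j / ξ i),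
        ∏ j ∈ I.erase i, w j = ξ i ^ (∑ j ∈ I.erase i, N j) * e := by
      choose! e he hwe using fun j (hj : ξ j ≠ 0) ↦
        exists_eq_pow_mul_of_mem_span_pow ξ hi (hwN j hj)
      have hI : ∀ j ∈ I.erase i, ξ j ≠ 0 := fun j hj ↦ by
        simpa [I] using Finset.mem_of_mem_erase hj
      refine ⟨∏ j ∈ I.erase i, e j, Subalgebra.prod_mem _ fun j hj ↦ he j (hI j hj), ?_⟩
      rw [Finset.prod_congr rfl fun j hj ↦ hwe j (hI j hj), Finset.prod_mul_distrib,
        Finset.prod_pow_eq_pow_sum]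
    obtain ⟨e, he, hwe⟩ := hprod
    refine ⟨e * c, mul_mem he hc, ?_⟩
    change g * h = _
    rw [← Finset.add_sum_erase I N hiI, pow_add]
    dsimp only [g]
    rw [← Finset.mul_prod_erase I w hiI, hwe]
    linear_combination (ξ i ^ (∑ j ∈ I.erase i, N j) * e) * hwc
  exact FiniteDimensional.of_injective (L.submoduleMap (globalSections D))
    fun x y hxy ↦ Subtype.ext (mul_left_cancel₀ hg congr(($hxy).1))

/-- The powers of `z` are sections of the trivial divisor, which form a finite-dimensional space; so
`z` is algebraic over `k`. -/
theorem mem_range_of_forall_mem_localRing [IsAlgClosed k] {z : M.K}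
    (hz : ∀ x : M.X, z ∈ M.localRing x) : z ∈ (algebraMap k M.K).range := by
  have hle : Subalgebra.toSubmodule (Algebra.adjoin k {z}) ≤ globalSections (1 : CartierDivisor M) := by
    intro y hy x d hd
    have hd' : d ∈ localUnits M x := (QuotientGroup.eq_one_iff d).1 hd.symm
    refine mul_mem ?_ ((mem_localUnits M).1 hd').1
    replace hy : y ∈ Algebra.adjoin k {z} := hy
    clear hd
    induction hy using Algebra.adjoin_induction with
    | mem x hx => rw [Set.mem_singleton_iff.1 hx]; exact hz _
    | algebraMap c => exact M.algebraMap_mem_localRing c _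
    | add a b _ _ ha hb => exact add_mem ha hb
    | mul a b _ _ ha hb => exact mul_mem ha hb
  have := finiteDimensional_globalSections (1 : CartierDivisor M)
  have hfin : FiniteDimensional k (Subalgebra.toSubmodule (Algebra.adjoin k {z})) :=
    Submodule.finiteDimensional_of_le hle
  have hint : _root_.IsIntegral k z := by
    refine IsIntegral.of_mem_of_fg (Algebra.adjoin k {z}) ?_ z
      (Algebra.subset_adjoin rfl)
    exact (Submodule.fg_iff_finiteDimensional _).2 hfin
  exact minpoly.mem_range_of_degree_eq_one k z
    (IsAlgClosed.degree_eq_one_of_irreducible k (minpoly.irreducible hint))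

end NormalProjVariety
end PrimBir

/-! ### The action of `f` on the function field -/

namespace PrimBir

open Scheme

namespace NormalProjVariety

variable {k : Type u} [Field k] {M B : NormalProjVariety k}

lemma fromFunctionField_str (φ : M.X ⤏ B.X) [φ.IsOver (Spec (.of k))] :
    φ.fromFunctionField ≫ B.str = M.X.genericMap ≫ M.str := by
  obtain ⟨g, hg, rfl⟩ := φ.exists_partialMap_over (Spec (.of k))
  have : g.hom ≫ B.str = g.domain.ι ≫ M.str :=
    (PartialMap.isOver_iff (S := Spec (.of k))).mp hg
  change (g.domain.fromSpecStalkOfMem _ g.genericPoint_mem_domain ≫ g.hom) ≫ _ = _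
  rw [Category.assoc, this, Opens.fromSpecStalkOfMem_ι_assoc]

variable (M) in
/-- The inclusion of the constants into the function field. -/
noncomputable def constHom : CommRingCat.of k ⟶ M.X.functionField :=
  CommRingCat.ofHom (algebraMap k M.K)

variable (M) in
lemma specMap_constHom : Spec.map M.constHom = M.X.genericMap ≫ M.str := by
  refine M.specMap_kHom_genericMap_str.symm.trans ?_
  have : Spec.map M.kHom = 𝟙 (Spec M.X.functionField) := Spec.map_id _
  exact (congr($this ≫ M.X.genericMap ≫ M.str)).trans (Category.id_comp _)

/-- The pull-back of rational functions, as a homomorphism over `k`. -/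
noncomputable def pullbackAlgHom (φ : M.X ⤏ B.X) [φ.IsDominant] [φ.IsOver (Spec (.of k))] :
    B.K →ₐ[k] M.K where
  toRingHom := φ.pullback.hom
  commutes' c := by
    have h : B.constHom ≫ φ.pullback = M.constHom := by
      apply Spec.map_injective
      rw [Spec.map_comp, specMap_constHom, specMap_constHom, ← fromFunctionField_str φ,
        ← φ.specMap_pullback, Category.assoc]
    exact congr($h c)

/-- Every local ring contains the constants, so here each is a field, and every point is generic. -/
lemma subsingleton_of_range_eq_top (h : (algebraMap k M.K).range = ⊤) : Subsingleton M.X := by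
  suffices ∀ x : M.X, x = genericPoint M.X from ⟨fun x y ↦ (this x).trans (this y).symm⟩
  intro x
  have hf : IsField (M.X.presheaf.stalk x) := by
    refine ⟨⟨0, 1, zero_ne_one⟩, mul_comm, fun {a} ha ↦ ?_⟩
    have h0 : M.toK x a ≠ 0 := by rwa [Ne, map_eq_zero_iff _ (M.toK_injective x)]
    have hu : IsUnit a := M.isUnit_of_inv_mem h0 (by
      obtain ⟨c, hc⟩ : (M.toK x a)⁻¹ ∈ (algebraMap k M.K).range := h ▸ trivial
      rw [← hc]
      exact M.algebraMap_mem_localRing c x)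
    exact ⟨_, hu.mul_val_inv⟩
  have hg : genericPoint M.X ∈ Set.range (M.X.fromSpecStalk x) := by
    rw [range_fromSpecStalk]
    exact genericPoint_specializes x
  obtain ⟨p, hp⟩ := hg
  have : Subsingleton (Spec (M.X.presheaf.stalk x)) := by
    let := hf.toField
    exact inferInstanceAs (Subsingleton (PrimeSpectrum (M.X.presheaf.stalk x)))
  rw [← hp, Subsingleton.elim p (IsLocalRing.closedPoint (M.X.presheaf.stalk x) : Spec _)]
  exact fromSpecStalk_closedPoint.symm

lemma exists_notMem_range (hM : 0 < M.dim) : ∃ z : M.K, z ∉ (algebraMap k M.K).range := by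
  by_contra! h
  have := subsingleton_of_range_eq_top (M := M) (eq_top_iff.2 fun z _ ↦ h z)
  have : Subsingleton (TopologicalSpace.IrreducibleCloseds M.X) := by
    constructor
    intro a b
    ext x
    obtain ⟨y, hy⟩ := a.isIrreducible.nonempty
    obtain ⟨z, hz⟩ := b.isIrreducible.nonempty
    rw [Subsingleton.elim y x] at hy
    rw [Subsingleton.elim z x] at hz
    exact ⟨fun _ ↦ hz, fun _ ↦ hy⟩
  exact hM.not_ge Order.krullDim_nonpos_of_subsingleton

end NormalProjVariety

namespace Bir

open NormalProjVariety

variable {k : Type u} [Field k] {M : NormalProjVariety k} (f : Bir M)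

instance : f.map.IsOver (Spec (.of k)) := by
  obtain ⟨e, he, h⟩ := f.exists_partialIso
  have : e.toPartialMap.IsOver (Spec (.of k)) := by
    rw [PartialMap.isOver_iff]
    exact (Category.assoc _ _ _).trans he
  rw [← h]
  infer_instance

/-- The pull-back of rational functions under a birational automorphism. -/
noncomputable def pullbackK : M.K →ₐ[k] M.K := pullbackAlgHom f.map

lemma toK_localPullback (x : f.map.toPartialMap.domain)
    (a : M.X.presheaf.stalk (f.map.toPartialMap.hom x)) :
    M.toK x.1 (localPullback f.map x a) = f.pullbackK (M.toK _ a) :=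
  PartialMap.stalkToFunctionField_localMap f.map.toPartialMap f.map
    (RationalMap.toRationalMap_toPartialMap _) x a

lemma isPullback_iff (D D' : CartierDivisor M) : f.IsPullback D D' ↔
    ∀ (x : f.map.toPartialMap.domain) (d d' : M.Kˣ),
      IsLocalEquation D (f.map.toPartialMap.hom x) d → IsLocalEquation D' x.1 d' →
      ∃ u ∈ localUnits M x.1, (d' : M.K) = f.pullbackK d * (u : M.K) := by
  constructor
  · intro h x d d' hd hd'
    obtain ⟨a, b, hb, hab⟩ := M.exists_div_toK (f.map.toPartialMap.hom x) d
    obtain ⟨u, hu, h⟩ := h x d d' a b hd hd' hb hab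
    refine ⟨u, hu, ?_⟩
    rw [toK_localPullback, toK_localPullback, ← hab, map_mul] at h
    have : f.pullbackK (M.toK _ b) ≠ 0 := by
      exact (map_ne_zero f.pullbackK).2 ((map_ne_zero_iff _ (M.toK_injective _)).2 hb)
    apply mul_right_cancel₀ this
    rw [h]
    ring
  · intro h x d d' a b hd hd' hb hab
    obtain ⟨u, hu, h⟩ := h x d d' hd hd'
    refine ⟨u, hu, ?_⟩
    rw [toK_localPullback, toK_localPullback, ← hab, map_mul, h]
    ring

/-- The pull-back of rational functions under the iterates of `f`. -/
noncomputable def iteratePullback : ℕ → (M.X.functionField ⟶ M.X.functionField)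
  | 0 => 𝟙 _
  | n + 1 => iteratePullback n ≫ f.map.pullback

lemma iteratePullback_apply (n : ℕ) (z : M.X.functionField) :
    f.iteratePullback n z = (f.pullbackK ^ n) z := by
  induction n with
  | zero => rfl
  | succ n ih =>
    rw [pow_succ']
    exact congr(f.pullbackK $ih)

lemma specMap_iteratePullback (n : ℕ) :
    Spec.map (f.iteratePullback n) ≫ M.X.genericMap = (f.iterate n).fromFunctionField := by
  induction n with
  | zero =>
    rw [iteratePullback, Spec.map_id, Category.id_comp]
    refine Eq.trans ?_ (RationalMap.specMap_pullback (RationalMap.id M.X))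
    rw [RationalMap.pullback_id, Spec.map_id, Category.id_comp]
  | succ n ih =>
    rw [iterate, RationalMap.fromFunctionField_comp, ← ih, iteratePullback, Spec.map_comp,
      Category.assoc]

lemma pullbackK_pow_eq_one {n : ℕ} (h : f.iterate n = RationalMap.id M.X) :
    f.pullbackK ^ n = 1 := by
  have h₁ : Spec.map (f.iteratePullback n) ≫ M.X.genericMap =
      Spec.map (f.iteratePullback 0) ≫ M.X.genericMap := by
    rw [specMap_iteratePullback, specMap_iteratePullback, h]
    rfl
  have h₂ := specMap_comp_fromSpecStalk_injective h₁
  ext z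
  refine (f.iteratePullback_apply n z).symm.trans ?_
  rw [h₂]
  rfl

open Polynomial in
-- For a non-constant `z`, the coefficients of `∏ (X - τ^i z)` over one period are `τ`-invariant. If
-- all were constant, `z` would be algebraic over the algebraically closed field `k`.
lemma exists_pullbackK_eq_self [IsAlgClosed k] (hM : 0 < M.dim) (h : f.HasFiniteOrder) :
    ∃ x : M.K, x ∉ (algebraMap k M.K).range ∧ f.pullbackK x = x := by
  obtain ⟨n, hn, h⟩ := h
  have hτ := f.pullbackK_pow_eq_one h
  obtain ⟨z, hz⟩ := exists_notMem_range hM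
  set τ := f.pullbackK
  let P : M.K[X] := ∏ i ∈ Finset.range n, (Polynomial.X - C ((τ ^ i) z))
  have hP : P.map τ.toRingHom = P := by
    dsimp only [P]
    rw [Polynomial.map_prod]
    have h₁ : ∀ i, (Polynomial.X - C ((τ ^ i) z)).map τ.toRingHom = Polynomial.X - C ((τ ^ (i + 1)) z) := fun i ↦ by
      rw [Polynomial.map_sub, map_X, map_C, pow_succ']
      rfl
    obtain ⟨n, rfl⟩ : ∃ m, n = m + 1 := ⟨n - 1, by omega⟩
    rw [Finset.prod_congr rfl fun i _ ↦ h₁ i, Finset.prod_range_succ, Finset.prod_range_succ', hτ]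
    rfl
  by_contra! hno
  have hcoeff : ∀ i, P.coeff i ∈ (algebraMap k M.K).range := by
    intro i
    by_contra hi
    refine hno _ hi ?_
    conv_rhs => rw [← hP]
    rw [coeff_map]
    rfl
  apply hz
  obtain ⟨Q, hQ⟩ := (mem_lifts (f := algebraMap k M.K) P).1
    ((lifts_iff_coeff_lifts P).2 fun i ↦ hcoeff i)
  have hPm : P.Monic := monic_prod_of_monic _ _ fun i _ ↦ monic_X_sub_C _
  have hint : IsAlgebraic k z := by
    refine ⟨Q, ?_, ?_⟩
    · rintro rfl
      rw [Polynomial.map_zero] at hQ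
      exact hPm.ne_zero hQ.symm
    · rw [aeval_def, ← Polynomial.eval_map, hQ, Polynomial.eval_prod]
      exact Finset.prod_eq_zero (Finset.mem_range.2 hn) (by simp)
  exact minpoly.mem_range_of_degree_eq_one k z
    (IsAlgClosed.degree_eq_one_of_irreducible k (minpoly.irreducible hint.isIntegral))

/-- The divisor `D + div (A s)` is the pull-back of `D + div s`, and likewise for `t`. Comparing the
two, `A t · τ s` and `A s · τ t` differ by a unit at each point of codimension at most one. Their
ratio is therefore regular everywhere, hence constant, as `exists_map_eq_affine` requires. -/
theorem exists_map_eq_affine_of_actsOnLinearSystem [IsAlgClosed k] (D : CartierDivisor M)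
    (hD : LinearSystemDimGeOne D) (hf : f.ActsOnLinearSystem D) :
    ∃ x : M.K, x ∉ (algebraMap k M.K).range ∧
      ∃ α β : k, f.pullbackK x = algebraMap k M.K α * x + algebraMap k M.K β := by
  obtain ⟨F, hF, A, hA⟩ := hf
  have := finiteDimensional_globalSections D
  have hrank : 2 ≤ Module.finrank k (globalSections D) := by
    have : 2 ≤ Module.rank k (globalSections D) := hD
    rw [← Module.finrank_eq_rank] at this
    exact_mod_cast this
  refine exists_map_eq_affine f.pullbackK (globalSections D) hrank A.toLinearMap A.injective ?_
  intro s t hs ht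
  have key : ∀ s : globalSections D, s ≠ 0 → (A s : M.K) ≠ 0 ∧
      ∀ x : f.map.toPartialMap.domain, ∀ d d' : M.Kˣ,
      IsLocalEquation D (f.map.toPartialMap.hom x) d → IsLocalEquation D x.1 d' →
      ∃ u ∈ localUnits M x.1, (d' * A s : M.K) = f.pullbackK (d * s) * (u : M.K) := by
    intro s hs
    have hs' : (s : M.K) ≠ 0 := fun h ↦ hs (Subtype.ext h)
    let h : M.Kˣ := Units.mk0 s hs'
    have hE : D * principal M h ∈ completeLinearSystem (D : Pic M) := by
      refine ⟨fun x e he ↦ ?_, ?_⟩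
      · have he' : germClass M x e = D.1 x * germClass M x h := he.symm
        obtain ⟨d, hd⟩ := exists_isLocalEquation D x
        have hd' : D.1 x = germClass M x d := hd
        rw [hd', ← map_mul] at he'
        have hu := (mem_localUnits M).1 (QuotientGroup.eq.1 he'.symm)
        have : (e : M.K) = (s * d) * (((d * h)⁻¹ * e : M.Kˣ) : M.K) := by
          change (e : M.K) = (h * d : M.Kˣ) * (((d * h)⁻¹ * e : M.Kˣ) : M.K)
          rw [← Units.val_mul]
          congr 1
          rw [mul_comm (h : M.Kˣ) d, mul_inv_cancel_left]
        rw [this]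
        exact mul_mem (s.2 x d hd) hu.1
      · exact (QuotientGroup.eq.2 (by simp)).symm
    obtain ⟨h', hh', hFE⟩ := hA ⟨_, hE⟩ h s.2 rfl
    refine ⟨by rw [← show (h' : M.K) = A s from hh']; exact h'.ne_zero, fun x d d' hd hd' ↦ ?_⟩
    have := (f.isPullback_iff _ _).1 (hF ⟨_, hE⟩) x (d * h) (d' * h') ?_ ?_
    · obtain ⟨u, hu, h⟩ := this
      refine ⟨u, hu, ?_⟩
      rw [← show (h' : M.K) = A s from hh']
      exact h
    · exact (congr($(show D.1 _ = _ from hd) * germClass M _ h)).trans (map_mul _ _ _).symm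
    · rw [hFE]
      exact (congr($(show D.1 _ = _ from hd') * germClass M _ h')).trans (map_mul _ _ _).symm
  obtain ⟨hAs, hs'⟩ := key s hs
  obtain ⟨hAt, ht'⟩ := key t ht
  have h0 : ∀ s : globalSections D, s ≠ 0 → f.pullbackK s ≠ 0 := fun s hs ↦ by
    exact (map_ne_zero f.pullbackK).2 fun h ↦ hs (Subtype.ext h)
  have hw : ∀ x : M.X, (A t : M.K) * f.pullbackK s / (A s * f.pullbackK t) ∈ M.localRing x := by
    refine M.mem_localRing_of_forall fun x hx ↦ ?_
    have hxd := M.mem_domain_of_ringKrullDim_le_one f.map hx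
    obtain ⟨d, hd⟩ := exists_isLocalEquation D (f.map.toPartialMap.hom ⟨x, hxd⟩)
    obtain ⟨d', hd'⟩ := exists_isLocalEquation D x
    obtain ⟨u, hu, h₁⟩ := hs' ⟨x, hxd⟩ d d' hd hd'
    obtain ⟨v, hv, h₂⟩ := ht' ⟨x, hxd⟩ d d' hd hd'
    have : (A t : M.K) * f.pullbackK s / (A s * f.pullbackK t) = v * (u⁻¹ : M.Kˣ) := by
      have hτd : f.pullbackK (d : M.K) ≠ 0 := (map_ne_zero f.pullbackK).2 d.ne_zero
      have := d'.ne_zero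
      have := u.ne_zero
      have := h0 s hs
      have := h0 t ht
      rw [map_mul] at h₁ h₂
      rw [Units.val_inv_eq_inv_val, ← div_eq_mul_inv, div_eq_div_iff (mul_ne_zero hAs ‹_›) ‹_›]
      apply mul_left_cancel₀ (mul_ne_zero hτd d'.ne_zero)
      linear_combination f.pullbackK d * f.pullbackK s * u * h₂ -
        f.pullbackK d * f.pullbackK t * v * h₁
    rw [this]
    exact mul_mem ((mem_localUnits M).1 hv).1 ((mem_localUnits M).1 hu).2
  obtain ⟨c, hc⟩ := mem_range_of_forall_mem_localRing hw
  refine ⟨c, ?_⟩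
  rw [hc]
  exact (div_mul_cancel₀ _ (mul_ne_zero hAs (h0 t ht))).symm

end Bir
end PrimBir

/-! ### Generic points of general fibres over an open set -/

namespace PrimBir.NormalProjVariety

open Scheme

variable {k : Type u} [Field k] {M B : NormalProjVariety k}

instance : LocallyOfFiniteType M.str := inferInstance

lemma exists_isAffineOpen_le (U : M.X.Opens) (hU : genericPoint M.X ∈ U) :
    ∃ W : M.X.Opens, IsAffineOpen W ∧ genericPoint M.X ∈ W ∧ W ≤ U := by
  obtain ⟨W, hW, hx, h⟩ := exists_isAffineOpen_mem_and_subset hU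
  exact ⟨W, hW, hx, h⟩

lemma genericPoint_mem_basicOpen {U : M.X.Opens} {a : Γ(M.X, U)}
    (ha : a ≠ 0) : genericPoint M.X ∈ M.X.basicOpen a := by
  have : (M.X.basicOpen a : Set M.X).Nonempty := by
    rw [Set.nonempty_iff_ne_empty, Ne, TopologicalSpace.Opens.coe_eq_empty, basicOpen_eq_bot_iff]
    exact ha
  exact ((genericPoint_spec M.X).mem_open_set_iff (M.X.basicOpen a).2).2 (by simpa using this)

/-- Suppose that the function field of `B` is algebraically closed in that of `M`. Then there are
dense open subsets `W ⊆ M` and `U ⊆ B` such that, for closed `b ∈ U`, the fibre of `W` over `b` has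
a generic point. -/
theorem exists_generic_point_of_fiber (φ : M.X ⤏ B.X) [φ.IsDominant] [φ.IsOver (Spec (.of k))]
    (hcl : letI := φ.pullback.hom.toAlgebra;
      ∀ x : M.X.functionField, IsAlgebraic B.X.functionField x →
        x ∈ (algebraMap B.X.functionField M.X.functionField).range) :
    ∃ (W : M.X.Opens) (U : B.X.Opens), genericPoint M.X ∈ W ∧ genericPoint B.X ∈ U ∧
      ∃ hW : W ≤ φ.toPartialMap.domain, ∀ b ∈ U, IsClosed ({b} : Set B.X) →
        ∃ (w : M.X) (hw : w ∈ W), φ.toPartialMap.hom ⟨w, hW hw⟩ = b ∧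
          ∀ (x : M.X) (hx : x ∈ W), φ.toPartialMap.hom ⟨x, hW hx⟩ = b → w ⤳ x := by
  set g := φ.toPartialMap
  have hgφ : g.toRationalMap = φ := φ.toRationalMap_toPartialMap
  have hg : g.hom ≫ B.str = g.domain.ι ≫ M.str := by
    have h : φ.toPartialMap.IsOver (Spec (.of k)) := inferInstance
    exact (PartialMap.isOver_iff (S := Spec (.of k))).mp h
  obtain ⟨UA, hA, hηA, -⟩ := exists_isAffineOpen_le (M := B) ⊤ trivial
  have hgη : g.hom ⟨genericPoint M.X, g.genericPoint_mem_domain⟩ = genericPoint B.X := by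
    have : IsDominant g.hom := by
      rw [← PartialMap.isDominant_toRationalMap_iff, hgφ]
      infer_instance
    exact g.hom_genericPoint
  obtain ⟨WR, hR, hηR, hWR⟩ := exists_isAffineOpen_le (M := M) (g.domain.ι ''ᵁ (g.hom ⁻¹ᵁ UA))
    ⟨⟨_, g.genericPoint_mem_domain⟩, by
      change g.hom _ ∈ UA
      rw [hgη]
      exact hηA, rfl⟩
  have hWdom : WR ≤ g.domain := fun x hx ↦ by
    obtain ⟨y, -, rfl⟩ := hWR hx
    exact y.2
  have hWU : ∀ x (hx : x ∈ WR), g.hom ⟨x, hWdom hx⟩ ∈ UA := fun x hx ↦ by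
    obtain ⟨y, hy, rfl⟩ := hWR hx
    exact hy
  let ℓ : Spec Γ(M.X, WR) ⟶ g.domain.toScheme := IsOpenImmersion.lift g.domain.ι hR.fromSpec (by
    rw [IsAffineOpen.range_fromSpec, Opens.range_ι]
    exact hWdom)
  have hℓ : ℓ ≫ g.domain.ι = hR.fromSpec := IsOpenImmersion.lift_fac _ _ _
  have hℓx : ∀ p, ∃ h : hR.fromSpec p ∈ WR, ℓ p = ⟨hR.fromSpec p, hWdom h⟩ := by
    intro p
    have hp : hR.fromSpec p ∈ WR := hR.fromSpec_mem p
    refine ⟨hp, Subtype.ext ?_⟩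
    exact congr($hℓ p)
  let m : Spec Γ(M.X, WR) ⟶ Spec Γ(B.X, UA) := IsOpenImmersion.lift hA.fromSpec (ℓ ≫ g.hom) (by
    rw [IsAffineOpen.range_fromSpec]
    rintro _ ⟨p, rfl⟩
    obtain ⟨h, hp⟩ := hℓx p
    rw [Scheme.Hom.comp_apply, hp]
    exact hWU _ h)
  have hm : m ≫ hA.fromSpec = ℓ ≫ g.hom := IsOpenImmersion.lift_fac _ _ _
  let ψ : Γ(B.X, UA) ⟶ Γ(M.X, WR) := Spec.preimage m
  have hψ : Spec.map ψ = m := Spec.map_preimage m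
  have hfin : ψ.hom.FiniteType := by
    rw [← HasRingHomProperty.Spec_iff (P := @LocallyOfFiniteType), hψ]
    have : LocallyOfFiniteType (m ≫ hA.fromSpec ≫ B.str) := by
      rw [← Category.assoc, hm, Category.assoc, hg, ← Category.assoc, hℓ]
      infer_instance
    exact locallyOfFiniteType_of_comp m (hA.fromSpec ≫ B.str)
  have : Nonempty UA := ⟨⟨_, hηA⟩⟩
  have : Nonempty WR := ⟨⟨_, hηR⟩⟩
  have hcomp : ψ ≫ M.X.germToFunctionField WR = B.X.germToFunctionField UA ≫ φ.pullback := by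
    apply Spec.map_injective
    rw [← cancel_mono hA.fromSpec, Spec.map_comp, Spec.map_comp, Category.assoc, Category.assoc,
      hψ, hm]
    have e₁ : Spec.map (M.X.germToFunctionField WR) ≫ hR.fromSpec = M.X.genericMap :=
      hR.fromSpecStalk_eq_fromSpecStalk hηR
    have e₂ : Spec.map (B.X.germToFunctionField UA) ≫ hA.fromSpec = B.X.genericMap :=
      hA.fromSpecStalk_eq_fromSpecStalk hηA
    have e₃ : φ.fromFunctionField =
        g.domain.fromSpecStalkOfMem _ g.genericPoint_mem_domain ≫ g.hom := by
      rw [← hgφ]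
      rfl
    rw [e₂, φ.specMap_pullback, e₃, ← Category.assoc]
    congr 1
    rw [← cancel_mono g.domain.ι, Category.assoc, hℓ, e₁, Opens.fromSpecStalkOfMem_ι]
  let := φ.pullback.hom.toAlgebra
  let := ψ.hom.toAlgebra
  let : Algebra Γ(B.X, UA) M.X.functionField :=
    ((M.X.germToFunctionField WR).hom.comp ψ.hom).toAlgebra
  have := functionField_isFractionRing_of_isAffineOpen B.X UA hA
  have := functionField_isFractionRing_of_isAffineOpen M.X WR hR
  have : IsScalarTower Γ(B.X, UA) Γ(M.X, WR) M.X.functionField := .of_algebraMap_eq' rfl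
  have : IsScalarTower Γ(B.X, UA) B.X.functionField M.X.functionField :=
    .of_algebraMap_eq fun x ↦ congr($hcomp x)
  have : Algebra.FiniteType Γ(B.X, UA) Γ(M.X, WR) := hfin
  -- The affine opens were chosen so that `φ` is a morphism of finite type between them. A least
  -- prime over a maximal ideal then is a generic point of the fibre.
  obtain ⟨h, hh, a, ha, H⟩ := exists_least_prime_over_general_maximal Γ(B.X, UA) Γ(M.X, WR)
    B.X.functionField M.X.functionField hcl
  have hWW : M.X.basicOpen h ≤ WR := M.X.basicOpen_le h
  refine ⟨M.X.basicOpen h, B.X.basicOpen a, genericPoint_mem_basicOpen hh,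
    genericPoint_mem_basicOpen ha, hWW.trans hWdom, ?_⟩
  intro b hb hbc
  have hbA := B.X.basicOpen_le a hb
  let p : Spec Γ(B.X, UA) := hA.primeIdealOf ⟨b, hbA⟩
  have hp : hA.fromSpec p = b := hA.fromSpec_primeIdealOf ⟨b, hbA⟩
  have hpm : p.asIdeal.IsMaximal := by
    rw [← PrimeSpectrum.isClosed_singleton_iff_isMaximal]
    have : ({p} : Set (Spec Γ(B.X, UA))) = hA.fromSpec ⁻¹' {b} := by
      ext q
      rw [Set.mem_singleton_iff, Set.mem_preimage, Set.mem_singleton_iff, ← hp]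
      exact ⟨congrArg _, fun h ↦ hA.fromSpec.isOpenEmbedding.injective h⟩
    have h2 : IsClosed ({p} : Set (Spec Γ(B.X, UA))) := by
      rw [this]
      exact hbc.preimage hA.fromSpec.continuous
    exact h2
  have hap : a ∉ p.asIdeal := by
    have : p ∈ hA.fromSpec ⁻¹ᵁ B.X.basicOpen a := by
      have hb' : hA.fromSpec p ∈ B.X.basicOpen a := by rwa [hp]
      exact hb'
    rw [hA.fromSpec_preimage_basicOpen] at this
    exact this
  -- As the ideal of `b` is maximal, lying over `b` only requires that its preimage contain that
  -- ideal.
  have hbase : ∀ q : Spec Γ(M.X, WR), ∀ hq : hR.fromSpec q ∈ WR,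
      (g.hom ⟨hR.fromSpec q, hWdom hq⟩ = b ↔ p.asIdeal ≤ q.asIdeal.comap ψ.hom) := by
    intro q hq
    have e₁ : g.hom ⟨hR.fromSpec q, hWdom hq⟩ = hA.fromSpec (Spec.map ψ q) := by
      rw [hψ, ← Scheme.Hom.comp_apply, hm, Scheme.Hom.comp_apply, (hℓx q).choose_spec]
    rw [e₁, ← hp, hA.fromSpec.isOpenEmbedding.injective.eq_iff]
    constructor
    · rintro h
      rw [← h]
      exact le_rfl
    · intro h
      have := hpm.eq_of_le (Ideal.comap_ne_top ψ.hom q.2.ne_top) h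
      exact (PrimeSpectrum.ext this).symm
  obtain ⟨𝔓, h𝔓, hb𝔓, hh𝔓, hmin⟩ := H p.asIdeal hpm hap
  let w : Spec Γ(M.X, WR) := ⟨𝔓, h𝔓⟩
  have hmem : ∀ q : Spec Γ(M.X, WR), hR.fromSpec q ∈ M.X.basicOpen h ↔ h ∉ q.asIdeal := by
    intro q
    have : hR.fromSpec q ∈ M.X.basicOpen h ↔ q ∈ hR.fromSpec ⁻¹ᵁ M.X.basicOpen h := Iff.rfl
    rw [this, hR.fromSpec_preimage_basicOpen]
    rfl
  have hw : hR.fromSpec w ∈ M.X.basicOpen h := (hmem w).2 hh𝔓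
  refine ⟨hR.fromSpec w, hw, (hbase w (hWW hw)).2 hb𝔓, ?_⟩
  intro x hx hxb
  let q : Spec Γ(M.X, WR) := hR.primeIdealOf ⟨x, hWW hx⟩
  have hq : hR.fromSpec q = x := hR.fromSpec_primeIdealOf ⟨x, hWW hx⟩
  clear_value q
  subst hq
  have hle := hmin q.asIdeal q.2 ((hbase q (hWW hx)).1 hxb) ((hmem q).1 hx)
  have : w ⤳ q := (PrimeSpectrum.le_iff_specializes w q).1 hle
  exact this.map hR.fromSpec.continuous

end PrimBir.NormalProjVariety

/-! ### Integral images, and fibres over a curve -/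

namespace AlgebraicGeometry.Scheme

instance image_isReduced {X Y : Scheme.{u}} [IsReduced X] (f : X ⟶ Y) [QuasiCompact f] :
    IsReduced f.image where
  component_reduced U := by
    have hinj : Function.Injective (f.toImage.app U) :=
      TopCat.Presheaf.app_injective_of_stalkFunctor_map_injective (F := f.image.sheaf) f.toImage.c U
        fun x _ ↦ f.stalkFunctor_toImage_injective x
    exact isReduced_of_injective (f.toImage.app U).hom hinj

instance image_isIntegral {X Y : Scheme.{u}} [IsIntegral X] (f : X ⟶ Y) [QuasiCompact f] :
    IsIntegral f.image := by
  have : IrreducibleSpace f.image := by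
    have h : IsPreirreducible (Set.univ : Set f.image) := by
      rw [← f.toImage.denseRange.closure_range, ← Set.image_univ]
      exact ((PreirreducibleSpace.isPreirreducible_univ (X := X)).image _ f.toImage.continuous.continuousOn).closure
    exact { isPreirreducible_univ := h, toNonempty := ⟨f.toImage (genericPoint X)⟩ }
  exact isIntegral_of_irreducibleSpace_of_isReduced _

lemma fromSpecStalk_bot {X : Scheme.{u}} [IsIntegral X] (x : X) (p : Spec (X.presheaf.stalk x))
    (hp : p.asIdeal = ⊥) : X.fromSpecStalk x p = genericPoint X := by
  have hg : genericPoint X ∈ Set.range (X.fromSpecStalk x) := by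
    rw [range_fromSpecStalk]
    exact genericPoint_specializes x
  obtain ⟨q, hq⟩ := hg
  have : p ⤳ q := (PrimeSpectrum.le_iff_specializes p q).1 (by
    change p.asIdeal ≤ q.asIdeal
    rw [hp]
    exact bot_le)
  have := this.map (X.fromSpecStalk x).continuous
  rw [hq] at this
  exact (this.antisymm (genericPoint_specializes _)).eq

/-- Let `q : Y ⟶ C` be a dominant morphism to a curve. Then, for almost all points `b` of `C`, the
fibre over `b` is the closure of its intersection with a given dense open subset. -/
theorem exists_finite_forall_exists_specializes {Y C : Scheme.{u}} [IsIntegral Y] [IsIntegral C]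
    [IsLocallyNoetherian Y] [CompactSpace Y] (q : Y ⟶ C) [IsDominant q]
    (hC : ∀ b : C, b = genericPoint C ∨ IsClosed ({b} : Set C)) (Ω : Y.Opens)
    (hΩ : genericPoint Y ∈ Ω) :
    ∃ N : Set C, N.Finite ∧ ∀ b ∉ N, b ≠ genericPoint C → ∀ z, q z = b →
      ∃ z' ∈ Ω, q z' = b ∧ z' ⤳ z := by
  have : IsNoetherian Y := {}
  obtain ⟨S, hS, hcl, hirr, hΩS⟩ :=
    TopologicalSpace.NoetherianSpace.exists_finite_set_isClosed_irreducible Ω.2.isClosed_compl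
  replace hΩS : (Ω : Set Y)ᶜ = ⋃₀ S := hΩS
  choose η hη using fun t : S ↦ QuasiSober.sober (hirr t t.2) (hcl t t.2)
  have := hS.to_subtype
  -- The exceptional points are the images of the generic points of the components of the complement
  -- of `Ω`.
  refine ⟨Set.range fun t ↦ q (η t), Set.finite_range _, ?_⟩
  rintro _ hN hb z rfl
  let σ := Y.fromSpecStalk z
  let ρ := C.fromSpecStalk (q z)
  have hcomm : Spec.map (q.stalkMap z) ≫ ρ = σ ≫ q := SpecMap_stalkMap_fromSpecStalk q
  have hρ : Function.Injective ρ := (C.fromSpecStalk (q z)).isEmbedding.injective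
  obtain ⟨t, htm, ht0⟩ : ∃ t ∈ IsLocalRing.maximalIdeal (C.presheaf.stalk (q z)), t ≠ 0 := by
    by_contra! h
    apply hb
    have h₁ := fromSpecStalk_bot (q z) (IsLocalRing.closedPoint _) (eq_bot_iff.2 fun t ht ↦ h t ht)
    rwa [fromSpecStalk_closedPoint] at h₁
  have hsm : (q.stalkMap z).hom t ∈ IsLocalRing.maximalIdeal (Y.presheaf.stalk z) := by
    rw [IsLocalRing.mem_maximalIdeal, mem_nonunits_iff] at htm ⊢
    exact fun h ↦ htm ((isUnit_map_iff (q.stalkMap z).hom t).1 h)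
  -- Krull: a minimal prime over the pull-back of `t ≠ 0` has height at most one. Its point
  -- specialises to `z` and lies over `b`, because `t` vanishes there and excludes the generic point
  -- of `C`.
  obtain ⟨p, hp, hpm⟩ := Ideal.exists_minimalPrimes_le
    ((Ideal.span_singleton_le_iff_mem (IsLocalRing.maximalIdeal (Y.presheaf.stalk z))).2 hsm)
  have hpp : p.IsPrime := hp.1.1
  have hht : p.height ≤ 1 := Ideal.height_le_one_of_isPrincipal_of_mem_minimalPrimes _ p hp
  let P : Spec (Y.presheaf.stalk z) := ⟨p, hpp⟩
  have hgen : ∀ Q : Spec (Y.presheaf.stalk z), (q.stalkMap z).hom t ∈ Q.asIdeal →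
      q (σ Q) ≠ genericPoint C := by
    intro Q hQ h
    rw [← Scheme.Hom.comp_apply, ← hcomm, Scheme.Hom.comp_apply,
      ← fromSpecStalk_bot (q z) (⟨⊥, Ideal.isPrime_bot⟩ : PrimeSpectrum _) rfl] at h
    have h₁ := congrArg PrimeSpectrum.asIdeal (hρ h)
    have h₂ : t ∈ (⊥ : Ideal (C.presheaf.stalk (q z))) := h₁.le hQ
    exact ht0 h₂
  have hσ : ∀ Q, σ Q ⤳ z := fun Q ↦ by
    have : σ Q ∈ Set.range σ := ⟨Q, rfl⟩
    rwa [range_fromSpecStalk] at this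
  have hPz := hσ P
  have hqP : q (σ P) = q z := by
    rcases hC (q (σ P)) with h | h
    · exact absurd h (hgen P (hp.1.2 (Ideal.mem_span_singleton_self _)))
    · have := (hPz.map q.continuous).mem_closed h rfl
      exact this.symm
  by_cases hPΩ : σ P ∈ Ω
  · exact ⟨_, hPΩ, hqP, hPz⟩
  exfalso
  have hmem : σ P ∈ (Ω : Set Y)ᶜ := hPΩ
  rw [hΩS] at hmem
  obtain ⟨T, hT, hPT⟩ := hmem
  have hηP : η ⟨T, hT⟩ ⤳ σ P := (hη ⟨T, hT⟩).specializes hPT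
  have hηΩ : η ⟨T, hT⟩ ∉ Ω := by
    have : η ⟨T, hT⟩ ∈ (Ω : Set Y)ᶜ := by
      rw [hΩS]
      exact ⟨T, hT, (hη ⟨T, hT⟩).mem⟩
    exact this
  obtain ⟨Q, hQ⟩ : η ⟨T, hT⟩ ∈ Set.range σ := by
    rw [range_fromSpecStalk]
    exact hηP.trans hPz
  have hQP : Q ⤳ P := by
    rw [← hQ] at hηP
    exact (Y.fromSpecStalk z).isEmbedding.isInducing.specializes_iff.1 hηP
  have hle : Q.asIdeal ≤ p := (PrimeSpectrum.le_iff_specializes Q P).2 hQP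
  have hQ0 : Q.asIdeal ≠ ⊥ := fun h ↦ hηΩ (by
    rw [← hQ, fromSpecStalk_bot z Q h]
    exact hΩ)
  -- The component through this point has a nonzero prime `Q ≤ p` as its generic point. Height at
  -- most one forces equality, so `b` would be exceptional.
  have hQp : Q.asIdeal = p := by
    by_contra hne
    have hQprime : Q.asIdeal.IsPrime := PrimeSpectrum.isPrime Q
    have h₁ := Ideal.height_add_one_le_of_lt_of_isPrime (lt_of_le_of_ne hle hne)
    have hbp : (⊥ : Ideal (Y.presheaf.stalk z)).IsPrime := Ideal.isPrime_bot
    have h₂ := Ideal.height_add_one_le_of_lt_of_isPrime (bot_lt_iff_ne_bot.2 hQ0)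
    have h₃ : (1 : ℕ∞) + 1 ≤ 1 := by
      calc (1 : ℕ∞) + 1 ≤ Q.asIdeal.height + 1 := by
            gcongr
            exact le_trans (by simp) h₂
        _ ≤ 1 := h₁.trans hht
    exact absurd h₃ (by decide)
  have hQP' : Q = P := PrimeSpectrum.ext hQp
  exact hN ⟨⟨T, hT⟩, by
    change q (η ⟨T, hT⟩) = q z
    rw [← hQ, hQP', hqP]⟩

end AlgebraicGeometry.Scheme

/-! ### The closed graph over the domain of definition -/

namespace AlgebraicGeometry.Scheme

/-- The closure of the graph of a morphism defined on an open subset `U` has no further points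
over `U`. -/
lemma imageι_eq_of_mem {X Y S : Scheme.{u}} [IsIntegral X] [Y.IsSeparated] {s : X ⟶ S} {t : Y ⟶ S}
    {U : X.Opens} [Nonempty U] (G : U.toScheme ⟶ Limits.pullback s t) [QuasiCompact G]
    (hG₁ : G ≫ Limits.pullback.fst s t = U.ι) (z : G.image)
    (hz : Limits.pullback.fst s t (G.imageι z) ∈ U) :
    ∃ x : U.toScheme, G x = G.imageι z ∧ U.ι x = Limits.pullback.fst s t (G.imageι z) := by
  have : IsIntegral U := isIntegral_of_isOpenImmersion U.ι
  let p := G.imageι ≫ Limits.pullback.fst s t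
  let V := p ⁻¹ᵁ U
  let a : V.toScheme ⟶ U.toScheme := p ∣_ U
  have ha : a ≫ U.ι = V.ι ≫ p := morphismRestrict_ι _ _
  have hp : G.toImage ≫ p = U.ι := by
    rw [← hG₁, ← Category.assoc, G.toImage_imageι]
  let j : U.toScheme ⟶ V.toScheme := IsOpenImmersion.lift V.ι G.toImage (by
    rw [Opens.range_ι]
    rintro _ ⟨x, rfl⟩
    change p (G.toImage x) ∈ U
    rw [← Scheme.Hom.comp_apply, hp]
    exact x.2)
  have hj : j ≫ V.ι = G.toImage := IsOpenImmersion.lift_fac _ _ _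
  have hjd : IsDominant j := by
    constructor
    have h := G.toImage.denseRange.preimage V.ι.isOpenEmbedding.isOpenMap
    refine h.mono ?_
    rintro v ⟨d, hd⟩
    refine ⟨d, V.ι.isOpenEmbedding.injective ?_⟩
    rw [← Scheme.Hom.comp_apply, hj, hd]
  have hja : j ≫ a = 𝟙 _ := by
    rw [← cancel_mono U.ι, Category.assoc, ha, ← Category.assoc, hj, hp, Category.id_comp]
  -- Both morphisms agree on the dense graph over `U`, hence everywhere by separatedness of the
  -- target.
  have heq : a ≫ G = V.ι ≫ G.imageι := by
    apply Limits.pullback.hom_ext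
    · rw [Category.assoc, hG₁, ha, Category.assoc]
    · apply ext_of_isDominant j
      rw [← Category.assoc, ← Category.assoc, hja, Category.id_comp, ← Category.assoc,
        ← Category.assoc, hj, G.toImage_imageι]
  let v : V.toScheme := ⟨z, hz⟩
  refine ⟨a v, ?_, congr($ha v)⟩
  exact congr($heq v)

end AlgebraicGeometry.Scheme

/-! ### Connectedness of the general fibre -/

namespace PrimBir.NormalProjVariety

open Scheme

variable {k : Type u} [Field k] {M B : NormalProjVariety k}

/-- A dominant rational map to a curve whose function field is algebraically closed in that of
the source is a rational fibration. -/
theorem hasConnectedGeneralFiber (φ : M.X ⤏ B.X) [φ.IsDominant] [φ.IsOver (Spec (.of k))]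
    (hcl : letI := φ.pullback.hom.toAlgebra;
      ∀ x : M.X.functionField, IsAlgebraic B.X.functionField x →
        x ∈ (algebraMap B.X.functionField M.X.functionField).range)
    (hB : ∀ b : B.X, b = genericPoint B.X ∨ IsClosed ({b} : Set B.X))
    (hB' : ¬ IsClosed ({genericPoint B.X} : Set B.X)) :
    HasConnectedGeneralFiber φ := by
  obtain ⟨W, U, hηW, hηU, hWdom, H⟩ := exists_generic_point_of_fiber φ hcl
  set g := φ.toPartialMap with hgdef
  have hgφ : g.toRationalMap = φ := φ.toRationalMap_toPartialMap
  have : Nonempty g.domain := ⟨⟨_, g.genericPoint_mem_domain⟩⟩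
  have : IsIntegral g.domain := isIntegral_of_isOpenImmersion g.domain.ι
  have : IsDominant g.hom := by
    rw [← PartialMap.isDominant_toRationalMap_iff, hgφ]
    infer_instance
  have : IsNoetherian M.X := {}
  have : TopologicalSpace.NoetherianSpace g.domain :=
    g.domain.ι.isOpenEmbedding.isInducing.noetherianSpace
  let G : g.domain.toScheme ⟶ Limits.pullback M.str B.str := graphMor φ
  have hG₁ : G ≫ Limits.pullback.fst M.str B.str = g.domain.ι := Limits.pullback.lift_fst _ _ _
  have hG₂ : G ≫ Limits.pullback.snd M.str B.str = g.hom := Limits.pullback.lift_snd _ _ _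
  let q₁ := G.imageι ≫ Limits.pullback.fst M.str B.str
  let q₂ := G.imageι ≫ Limits.pullback.snd M.str B.str
  have hq₁ : G.toImage ≫ q₁ = g.domain.ι := by
    rw [← hG₁, ← Category.assoc, G.toImage_imageι]
  have hq₂ : G.toImage ≫ q₂ = g.hom := by
    rw [← hG₂, ← Category.assoc, G.toImage_imageι]
  have : IsLocallyNoetherian G.image := LocallyOfFiniteType.isLocallyNoetherian q₁
  have : CompactSpace G.image := QuasiCompact.compactSpace_of_compactSpace q₁
  have : IsDominant q₂ := by
    have : IsDominant (G.toImage ≫ q₂) := by rwa [hq₂]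
    exact IsDominant.of_comp G.toImage q₂
  have hgenι : IsDominant g.domain.ι := Opens.isDominant_ι g.dense_domain
  have hdom₁ : IsDominant q₁ := by
    have : IsDominant (G.toImage ≫ q₁) := by rwa [hq₁]
    exact IsDominant.of_comp G.toImage q₁
  obtain ⟨N, hN, HN⟩ := exists_finite_forall_exists_specializes q₂ hB (q₁ ⁻¹ᵁ W) (by
    change q₁ (genericPoint G.image) ∈ W
    rwa [apply_genericPoint_of_isDominant])
  -- The generic point is dropped so that `N'` consists of finitely many closed points and its
  -- complement is open.
  let N' := N \ {genericPoint B.X}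
  have hN' : IsClosed N' := by
    rw [← Set.biUnion_of_singleton N']
    refine (hN.subset Set.sdiff_subset).isClosed_biUnion fun b hb ↦ ?_
    exact (hB b).resolve_left hb.2
  refine ⟨U ⊓ ⟨N'ᶜ, hN'.isOpen_compl⟩, ⟨genericPoint B.X, hηU, fun h ↦ h.2 rfl⟩, ?_⟩
  rintro b ⟨hbU, hbN⟩ hbc
  have hbη : b ≠ genericPoint B.X := fun h ↦ hB' (h ▸ hbc)
  obtain ⟨w, hw, hwb, hmin⟩ := H b hbU hbc
  let w₀ : g.domain.toScheme := ⟨w, hWdom hw⟩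
  let z₀ := G w₀
  let Z := {z | z ∈ graphClosure φ ∧ Limits.pullback.snd M.str B.str z = b}
  have hfib : fiber φ b = Limits.pullback.fst M.str B.str '' Z := by
    ext x
    constructor
    · rintro ⟨z, hz, hzx, hzb⟩
      exact ⟨z, ⟨hz, hzb⟩, hzx⟩
    · rintro ⟨z, ⟨hz, hzb⟩, hzx⟩
      exact ⟨z, hz, hzx, hzb⟩
  have hz₀ : z₀ ∈ Z := ⟨subset_closure ⟨_, rfl⟩, by
    rw [← hwb, ← hG₂]
    rfl⟩
  -- A point of the graph over `b` is a specialisation of one lying over `W`. There the graph has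
  -- only its honest points, and these specialise from the generic point `w` of the fibre.
  have hZ : Z ⊆ closure {z₀} := by
    rintro z ⟨hz, hzb⟩
    have hrange : z ∈ Set.range G.imageι := by
      rw [IdealSheafData.range_subschemeι, Hom.support_ker]
      exact hz
    obtain ⟨y, rfl⟩ := hrange
    obtain ⟨y', hy', hy'b, hyy⟩ := HN b (fun h ↦ hbN ⟨h, hbη⟩) hbη y hzb
    have hy'W : Limits.pullback.fst M.str B.str (G.imageι y') ∈ W := hy'
    obtain ⟨x, hx, hxι⟩ := imageι_eq_of_mem G hG₁ y' (hWdom hy'W)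
    have hxW : g.domain.ι x ∈ W := by rwa [hxι]
    have h₂ : g.hom x = b := by
      rw [← hy'b, ← hG₂, Scheme.Hom.comp_apply]
      exact congrArg _ hx
    have h₃ : g.domain.ι w₀ ⤳ g.domain.ι x := hmin _ hxW h₂
    rw [← specializes_iff_mem_closure]
    have h₄ : z₀ ⤳ G.imageι y' := by
      rw [← hx]
      exact (g.domain.ι.isOpenEmbedding.isInducing.specializes_iff.1 h₃).map G.continuous
    exact h₄.trans (hyy.map G.imageι.continuous)
  rw [hfib]
  refine IsConnected.image ⟨⟨z₀, hz₀⟩, ?_⟩ _ (Limits.pullback.fst M.str B.str).continuous.continuousOn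
  exact isPreconnected_singleton.subset_closure (Set.singleton_subset_iff.2 hz₀) hZ

end PrimBir.NormalProjVariety

/-! ### The normal projective curve of a function field -/

namespace PrimBir

attribute [local instance] MvPolynomial.gradedAlgebra
open HomogeneousLocalization

open Scheme

lemma _root_.AlgebraicGeometry.IsAffineOpen.fromSpec_bot {X : Scheme.{u}} [IsIntegral X]
    {U : X.Opens} (hU : IsAffineOpen U) (hg : genericPoint X ∈ U) (p : Spec Γ(X, U))
    (hp : p.asIdeal = ⊥) : hU.fromSpec p = genericPoint X := by
  let q : Spec Γ(X, U) := hU.primeIdealOf ⟨_, hg⟩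
  have hq : hU.fromSpec q = genericPoint X := hU.fromSpec_primeIdealOf ⟨_, hg⟩
  have : p ⤳ q := (PrimeSpectrum.le_iff_specializes p q).1 (by
    change p.asIdeal ≤ q.asIdeal
    rw [hp]
    exact bot_le)
  have := this.map hU.fromSpec.continuous
  rw [hq] at this
  exact (this.antisymm (genericPoint_specializes _)).eq

section Curve

variable {k : Type u} [Field k] {n : ℕ} {F : Type u} [Field F] [Algebra k F]
  {V : Scheme.{u}} [IsIntegral V] (ι : V ⟶ projSpace k n) [IsClosedImmersion ι]
  (φ : V.functionField ⟶ .of F) {ξ : Fin (n + 1) → F}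
  (hξ : IsCoord (Spec.map φ ≫ V.genericMap ≫ ι) ξ)

include hξ

/-- The ring of functions on a chart, identified with a subring of `F`. -/
lemma exists_chart_equiv {i : Fin (n + 1)} (h : ξ i ≠ 0) {C : Subalgebra k F}
    (hC : Algebra.adjoin k (Set.range fun j ↦ ξ j / ξ i) = C) :
    ∃ e : Γ(V, ι ⁻¹ᵁ chartOpen k n i) ≃+* C, ∀ s, (e s : F) =
      φ (V.presheaf.germ _ (genericPoint V) (genericPoint_mem_chart ι φ hξ h) s) := by
  let g : Γ(V, ι ⁻¹ᵁ chartOpen k n i) →+* F :=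
    φ.hom.comp (V.presheaf.germ _ (genericPoint V) (genericPoint_mem_chart ι φ hξ h)).hom
  have hmem : ∀ s, g s ∈ C := fun s ↦ hC ▸ (range_germ_chart ι φ hξ h _).1 ⟨s, rfl⟩
  let g' : Γ(V, ι ⁻¹ᵁ chartOpen k n i) →+* C := g.codRestrict C hmem
  have hbij : Function.Bijective g' := by
    constructor
    · have hg : Function.Injective g := by
        have := germ_injective_of_isIntegral V (genericPoint V) (genericPoint_mem_chart ι φ hξ h)
        exact φ.hom.injective.comp this
      exact fun a b hab ↦ hg congr(($hab : F))
    · rintro ⟨z, hz⟩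
      obtain ⟨s, hs⟩ := (range_germ_chart ι φ hξ h z).2 (hC ▸ hz)
      exact ⟨s, Subtype.ext hs⟩
  exact ⟨RingEquiv.ofBijective g' hbij, fun _ ↦ rfl⟩

lemma isIntegrallyClosed_stalk_of_adjoin_eq_curveRing {i : Fin (n + 1)} {y : F}
    (hC : Algebra.adjoin k (Set.range fun j ↦ ξ j / ξ i) = curveRing k y) {x : V}
    (hx : x ∈ ι ⁻¹ᵁ chartOpen k n i) : IsIntegrallyClosed (V.presheaf.stalk x) := by
  have h := ne_zero_of_mem_chart ι φ hξ hx
  obtain ⟨e, he⟩ := exists_chart_equiv ι φ hξ h hC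
  have hU := (isAffineOpen_chartOpen (k := k) (n := n) i).preimage ι
  have hg := genericPoint_mem_chart ι φ hξ h
  have : Nonempty (ι ⁻¹ᵁ chartOpen k n i) := ⟨⟨_, hg⟩⟩
  have := functionField_isFractionRing_of_isAffineOpen V (ι ⁻¹ᵁ chartOpen k n i) hU
  have : IsIntegrallyClosed Γ(V, ι ⁻¹ᵁ chartOpen k n i) := by
    rw [isIntegrallyClosed_iff V.functionField]
    intro z hz
    have h₁ : _root_.IsIntegral (curveRing k y) (φ z) :=
      hz.map_of_comp_eq e.toRingHom φ.hom (by
        ext s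
        exact he s)
    have h₂ := mem_curveRing_of_isIntegral h₁
    refine ⟨e.symm ⟨φ z, h₂⟩, φ.hom.injective ?_⟩
    refine (he (e.symm ⟨φ z, h₂⟩)).symm.trans ?_
    rw [e.apply_symm_apply]
  have hloc := hU.isLocalization_stalk ⟨x, hx⟩
  let := (V.presheaf.germ (ι ⁻¹ᵁ chartOpen k n i) x hx).hom.toAlgebra
  exact isIntegrallyClosed_of_isLocalization _ (hU.primeIdealOf ⟨x, hx⟩).asIdeal.primeCompl
    (Ideal.primeCompl_le_nonZeroDivisors _)

lemma eq_genericPoint_or_eq_of_specializes {i : Fin (n + 1)} {y : F}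
    (hC : Algebra.adjoin k (Set.range fun j ↦ ξ j / ξ i) = curveRing k y) {x x' : V}
    (hxx : x ⤳ x') (hx' : x' ∈ ι ⁻¹ᵁ chartOpen k n i) : x = genericPoint V ∨ x = x' := by
  have h := ne_zero_of_mem_chart ι φ hξ hx'
  obtain ⟨e, he⟩ := exists_chart_equiv ι φ hξ h hC
  have hU := (isAffineOpen_chartOpen (k := k) (n := n) i).preimage ι
  have hg := genericPoint_mem_chart ι φ hξ h
  have hx : x ∈ ι ⁻¹ᵁ chartOpen k n i := hxx.mem_open (ι ⁻¹ᵁ chartOpen k n i).isOpen hx'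
  let p : Spec Γ(V, ι ⁻¹ᵁ chartOpen k n i) := hU.primeIdealOf ⟨x, hx⟩
  let p' : Spec Γ(V, ι ⁻¹ᵁ chartOpen k n i) := hU.primeIdealOf ⟨x', hx'⟩
  have hp : hU.fromSpec p = x := hU.fromSpec_primeIdealOf ⟨_, hx⟩
  have hp' : hU.fromSpec p' = x' := hU.fromSpec_primeIdealOf ⟨_, hx'⟩
  clear_value p p'
  by_cases h0 : p.asIdeal = ⊥
  · exact .inl (hp ▸ hU.fromSpec_bot hg p h0)
  right
  have hpp : p.asIdeal.IsPrime := PrimeSpectrum.isPrime p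
  have hpp' : p'.asIdeal.IsPrime := PrimeSpectrum.isPrime p'
  have hq : (p.asIdeal.comap e.symm).IsPrime := inferInstance
  have hq0 : p.asIdeal.comap e.symm ≠ ⊥ := fun hq ↦ h0 (by
    rw [eq_bot_iff]
    intro a ha
    have : e a ∈ p.asIdeal.comap e.symm := by
      rw [Ideal.mem_comap, e.symm_apply_apply]
      exact ha
    rw [hq, Ideal.mem_bot, map_eq_zero_iff _ e.injective] at this
    exact this)
  have hmax : (p.asIdeal.comap e.symm).IsMaximal := isMaximal_of_isPrime_curveRing _ hq0
  have hle : p.asIdeal ≤ p'.asIdeal := (PrimeSpectrum.le_iff_specializes p p').2 (by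
    rw [← hp, ← hp'] at hxx
    exact hU.fromSpec.isOpenEmbedding.isInducing.specializes_iff.1 hxx)
  have heq := hmax.eq_of_le (Ideal.comap_ne_top e.symm hpp'.ne_top) (Ideal.comap_mono hle)
  have : p = p' := PrimeSpectrum.ext (Ideal.comap_injective_of_surjective e.symm e.symm.surjective heq)
  rw [← hp, ← hp', this]

/-- Choose a valuation ring `A` dominating the local ring at `x`; it contains `y` or `y⁻¹`, hence
one of the two curve rings. If `x` lies in the chart `j`, then `ξ j / ξ i` is in `A` for the
corresponding `i`. Its inverse is regular at `x`, and by domination a unit there, so `x` lies in the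
chart `i`. -/
lemma mem_chart_or_mem_chart {y : F} {i₀ i₁ : Fin (n + 1)} (h₀ : ξ i₀ ≠ 0) (h₁ : ξ i₁ ≠ 0)
    (hφ : ∀ (x : V) (c : k), ∃ s, φ (stalkToFunctionField x s) = algebraMap k F c)
    (hC₀ : Algebra.adjoin k (Set.range fun j ↦ ξ j / ξ i₀) = curveRing k y)
    (hC₁ : Algebra.adjoin k (Set.range fun j ↦ ξ j / ξ i₁) = curveRing k y⁻¹) (x : V) :
    x ∈ ι ⁻¹ᵁ chartOpen k n i₀ ∨ x ∈ ι ⁻¹ᵁ chartOpen k n i₁ := by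
  let g : V.presheaf.stalk x →+* F := φ.hom.comp (stalkToFunctionField x).hom
  obtain ⟨A, hA, hloc⟩ := IsLocalRing.exists_factor_valuationRing g
  obtain ⟨j, hj⟩ := exists_mem_chart ι x
  have hjne := ne_zero_of_mem_chart ι φ hξ hj
  have hk : ∀ c, algebraMap k F c ∈ A := fun c ↦ by
    obtain ⟨s, hs⟩ := hφ x c
    rw [← hs]
    exact hA s
  have key : ∀ i y, ξ i ≠ 0 → y ∈ A →
      Algebra.adjoin k (Set.range fun j ↦ ξ j / ξ i) = curveRing k y →
      x ∈ ι ⁻¹ᵁ chartOpen k n i := by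
    intro i y hi hy hC
    obtain ⟨s, hs, hsu⟩ := div_mem_stalk ι φ hξ hj i
    have h₂ : ξ j / ξ i ∈ A := curveRing_le_valuationSubring hk hy
      (hC ▸ Algebra.subset_adjoin ⟨j, rfl⟩)
    refine hsu ((isUnit_map_iff (g.codRestrict A.toSubring hA) s).1 ?_)
    refine IsUnit.of_mul_eq_one (⟨ξ j / ξ i, h₂⟩ : A.toSubring) (Subtype.ext ?_)
    change φ (stalkToFunctionField x s) * _ = 1
    rw [hs]
    field_simp
  rcases A.mem_or_inv_mem y with hy | hy
  · exact .inl (key i₀ y h₀ hy hC₀)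
  · exact .inr (key i₁ _ h₁ hy hC₁)

end Curve

/-- A field of algebraic functions of one variable is the function field of a normal projective
curve. -/
theorem exists_curve {k : Type u} [Field k] [PerfectField k] {L : Type u} [Field L] [Algebra k L]
    [Algebra.EssFiniteType k L] {y : L} (hy : Transcendental k y)
    (halg : Algebra.IsAlgebraic (IntermediateField.adjoin k {y}) L) :
    ∃ (B : NormalProjVariety k) (θ : B.X.functionField ⟶ .of L), Function.Bijective θ ∧
      Spec.map θ ≫ B.X.genericMap ≫ B.str = Spec.map (CommRingCat.ofHom (algebraMap k L)) ∧
      ∀ b : B.X, b = genericPoint B.X ∨ IsClosed ({b} : Set B.X) := by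
  obtain ⟨n, ξ, i₀, i₁, h₀, h₁, hC₀, hC₁⟩ := exists_curve_coordinates hy halg
  let P : Spec (.of L) ⟶ projSpace k n := pointOf k ξ i₀ h₀
  have hP : P ≫ projSpaceStr k n = Spec.map (CommRingCat.ofHom (algebraMap k L)) :=
    pointOf_projSpaceStr ξ i₀ h₀
  let pt : Spec (.of L) := IsLocalRing.closedPoint L
  have hpt : pt = genericPoint (Spec (.of L)) := by
    have : Subsingleton (Spec (.of L)) := inferInstanceAs (Subsingleton (PrimeSpectrum L))
    exact Subsingleton.elim _ _
  -- The curve is the scheme-theoretic image of the `L`-valued point with the coordinates `ξ`.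
  obtain ⟨θ, -, hθ⟩ := exists_eq_specMap_comp_fromSpecStalk P.toImage
    (show P.toImage pt = genericPoint P.image by
      rw [hpt]
      exact apply_genericPoint_of_isDominant P.toImage)
  have hθP : Spec.map θ ≫ P.image.genericMap ≫ P.imageι = P := by
    have : Spec.map θ ≫ P.image.genericMap = P.toImage := hθ.symm
    rw [← Category.assoc, this, P.toImage_imageι]
  have hξ : IsCoord (Spec.map θ ≫ P.image.genericMap ≫ P.imageι) ξ := by
    rw [hθP]
    exact isCoord_pointOf ξ i₀ h₀
  have hstalk : ∀ (x : P.image) (c : k), ∃ s, θ (stalkToFunctionField x s) = algebraMap k L c := by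
    intro x c
    obtain ⟨j, hj⟩ := exists_mem_chart P.imageι x
    have hc : algebraMap k L c ∈ Algebra.adjoin k (Set.range fun l ↦ ξ l / ξ j) :=
      algebraMap_mem _ c
    obtain ⟨s, hs⟩ := (range_germ_chart P.imageι θ hξ (ne_zero_of_mem_chart _ θ hξ hj) _).2 hc
    refine ⟨P.image.presheaf.germ _ x hj s, ?_⟩
    rw [stalkToFunctionField_germ hj (genericPoint_mem_chart _ θ hξ (ne_zero_of_mem_chart _ θ hξ hj))]
    exact hs
  have hcov := mem_chart_or_mem_chart P.imageι θ hξ h₀ h₁ hstalk hC₀ hC₁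
  let B : NormalProjVariety k :=
    { X := P.image
      str := P.imageι ≫ projSpaceStr k n
      isIntegral := inferInstance
      normal := fun x ↦ (hcov x).elim
        (isIntegrallyClosed_stalk_of_adjoin_eq_curveRing P.imageι θ hξ hC₀)
        (isIntegrallyClosed_stalk_of_adjoin_eq_curveRing P.imageι θ hξ hC₁)
      projective := ⟨n, P.imageι, inferInstance, rfl⟩ }
  refine ⟨B, θ, ⟨θ.hom.injective, fun z ↦ ?_⟩, ?_, fun b ↦ or_iff_not_imp_left.2 fun hb ↦ ?_⟩
  -- Every element of `L` is a quotient of two elements of the curve ring, so the function field is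
  -- all of `L`.
  · have hz : IsAlgebraic (Algebra.adjoin k {y}) z := by
      have h := (IntermediateField.isAlgebraic_adjoin_iff_top (F := k) (E := L) (s := {y})).mp halg
      exact h.isAlgebraic z
    obtain ⟨c, hc, hcz⟩ := hz.exists_integral_multiple
    have hcC : (c : L) ∈ curveRing k y := isIntegral_algebraMap (x := c)
    have hcz' : (c : L) * z ∈ curveRing k y := hcz
    rw [← hC₀] at hcC hcz'
    obtain ⟨s, hs⟩ := (range_germ_chart P.imageι θ hξ h₀ _).2 hcC
    obtain ⟨t, ht⟩ := (range_germ_chart P.imageι θ hξ h₀ _).2 hcz'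
    have hc0 : (c : L) ≠ 0 := fun h ↦ hc (Subtype.ext h)
    refine ⟨P.image.presheaf.germ _ (genericPoint P.image) (genericPoint_mem_chart _ θ hξ h₀) t /
      (P.image.presheaf.germ _ (genericPoint P.image) (genericPoint_mem_chart _ θ hξ h₀) s), ?_⟩
    refine (map_div₀ θ.hom _ _).trans ?_
    refine (congr($ht / $hs)).trans ?_
    field_simp
  · change Spec.map θ ≫ P.image.genericMap ≫ P.imageι ≫ projSpaceStr k n = _
    rw [← hP]
    conv_rhs => rw [← hθP]
    simp only [Category.assoc]
  · have : closure {b} = ({b} : Set B.X) := by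
      refine subset_antisymm (fun b' hb' ↦ ?_) subset_closure
      have hbb : b ⤳ b' := specializes_iff_mem_closure.2 hb'
      rcases hcov b' with h | h
      · exact ((eq_genericPoint_or_eq_of_specializes P.imageι θ hξ hC₀ hbb h).resolve_left hb).symm
      · exact ((eq_genericPoint_or_eq_of_specializes P.imageι θ hξ hC₁ hbb h).resolve_left hb).symm
    rw [← this]
    exact isClosed_closure

end PrimBir

/-- The algebraic closure in `K` of the field of rational functions of one element. -/
theorem exists_algebraicClosure_adjoin_simple {k K : Type*} [Field k] [IsAlgClosed k] [Field K]
    [Algebra k K] [Algebra.EssFiniteType k K] {x : K} (hx : x ∉ (algebraMap k K).range) :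
    ∃ (L : IntermediateField k K) (y : L), (y : K) = x ∧ Algebra.EssFiniteType k L ∧
      Transcendental k y ∧ Algebra.IsAlgebraic (IntermediateField.adjoin k {y}) L ∧
      (∀ z : K, IsAlgebraic L z → z ∈ L) ∧
      ∀ τ : K →ₐ[k] K, τ x ∈ IntermediateField.adjoin k {x} → ∀ z ∈ L, τ z ∈ L := by
  let E := IntermediateField.adjoin k {x}
  let L' := algebraicClosure E K
  let L : IntermediateField k K := L'.restrictScalars k
  have hmem : ∀ z : K, z ∈ L ↔ IsAlgebraic E z := fun z ↦ mem_algebraicClosure_iff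
  have hxE : x ∈ E := IntermediateField.mem_adjoin_simple_self k x
  have hEL : ∀ z ∈ E, z ∈ L := fun z hz ↦ (hmem z).2 (isAlgebraic_algebraMap (⟨z, hz⟩ : E))
  let y : L := ⟨x, hEL x hxE⟩
  have hmap : (IntermediateField.adjoin k {y}).map L.val = E := by
    rw [IntermediateField.adjoin_map, Set.image_singleton]
    rfl
  refine ⟨L, y, rfl, ?_, ?_, ?_, ?_, ?_⟩
  -- Being algebraic over `E = k(x)` inside a finitely generated extension, `L` is finite over `E`.
  · have : Algebra.EssFiniteType E K := .of_comp k E K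
    have : FiniteDimensional E L' := finiteDimensional_of_isAlgebraic_of_essFiniteType E L' K
    have : Algebra.EssFiniteType k E := by
      rw [IntermediateField.essFiniteType_iff]
      exact ⟨{x}, by simp [E]⟩
    exact Algebra.EssFiniteType.comp k E L'
  · intro h
    apply hx
    have h₁ : IsAlgebraic k x := h.algHom L.val
    exact minpoly.mem_range_of_degree_eq_one k x
      (IsAlgClosed.degree_eq_one_of_irreducible k (minpoly.irreducible h₁.isIntegral))
  · refine ⟨fun z ↦ ?_⟩
    have hz : IsAlgebraic E (z : K) := (hmem z).1 z.2
    let f : IntermediateField.adjoin k {y} →+* E :=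
      (L.val.toRingHom.comp (IntermediateField.adjoin k {y}).val.toRingHom).codRestrict E
        fun a ↦ hmap ▸ ⟨a, a.2, rfl⟩
    refine hz.of_ringHom_of_comp_eq f L.val.toRingHom ?_ L.val.injective rfl
    rintro ⟨e, he⟩
    rw [← hmap] at he
    obtain ⟨a, ha, rfl⟩ := he
    exact ⟨⟨a, ha⟩, rfl⟩
  · intro z hz
    have hz' : IsAlgebraic L' z := hz
    exact (hmem z).2 (hz'.restrictScalars E)
  · intro τ hτ z hz
    have hτE : ∀ a ∈ E, τ a ∈ E := by
      have : E.map τ ≤ E := by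
        rw [IntermediateField.adjoin_map, Set.image_singleton,
          IntermediateField.adjoin_simple_le_iff]
        exact hτ
      exact fun a ha ↦ this ⟨a, ha, rfl⟩
    refine (hmem _).2 (((hmem z).1 hz).ringHom_of_comp_eq
      ((τ.toRingHom.comp E.val.toRingHom).codRestrict E fun a ↦ hτE a a.2) τ.toRingHom ?_ rfl)
    exact RingHom.injective _

/-! ### Rational maps from field homomorphisms, and the dimension of a curve -/

namespace PrimBir.NormalProjVariety

open Scheme

variable {k : Type u} [Field k] {M B : NormalProjVariety k}

/-- Homomorphisms over `k` of function fields are induced by rational maps. -/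
lemma exists_rationalMap (α : B.X.functionField ⟶ M.X.functionField)
    (hα : B.constHom ≫ α = M.constHom) :
    ∃ (φ : M.X ⤏ B.X) (_ : φ.IsDominant) (_ : φ.IsOver (Spec (.of k))), φ.pullback = α := by
  have h : (Spec.map α ≫ B.X.genericMap) ≫ B.str = M.X.genericMap ≫ M.str := by
    rw [Category.assoc, ← specMap_constHom, ← specMap_constHom, ← Spec.map_comp, hα]
  let φ := RationalMap.ofFunctionField M.str B.str _ h
  have hφ : φ.fromFunctionField = Spec.map α ≫ B.X.genericMap :=
    RationalMap.fromFunctionField_ofFunctionField _ _ _ _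
  have hdom : φ.IsDominant := by
    obtain ⟨g, hg⟩ := φ.exists_rep
    have hgφ : g.toRationalMap = φ := hg
    rw [← hgφ, PartialMap.isDominant_toRationalMap_iff]
    have h₁ : g.domain.fromSpecStalkOfMem _ g.genericPoint_mem_domain ≫ g.hom =
        Spec.map α ≫ B.X.genericMap := by
      rw [← hφ, ← hgφ]
      rfl
    let pt : Spec M.X.functionField := IsLocalRing.closedPoint M.X.functionField
    have h₂ : B.X.genericMap (Spec.map α pt) = genericPoint B.X := by
      have : B.X.genericMap (Spec.map α pt) ∈ Set.range B.X.genericMap := ⟨_, rfl⟩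
      rw [range_fromSpecStalk] at this
      exact (this.antisymm (genericPoint_specializes _)).eq
    have h₃ : genericPoint B.X ∈ Set.range g.hom := by
      refine ⟨g.domain.fromSpecStalkOfMem _ g.genericPoint_mem_domain pt, ?_⟩
      rw [← h₂]
      exact congr($h₁ pt)
    refine ⟨fun b ↦ ?_⟩
    have h₄ := closure_mono (Set.singleton_subset_iff.2 h₃)
    rw [(genericPoint_spec B.X).def] at h₄
    exact h₄ trivial
  refine ⟨φ, hdom, ?_, (φ.eq_pullback hφ.symm).symm⟩
  rw [RationalMap.isOver_iff]
  exact (RationalMap.equivFunctionField M.str B.str ⟨_, h⟩).2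

lemma mem_localRing_genericPoint (z : M.K) : z ∈ M.localRing (genericPoint M.X) := by
  have h : stalkToFunctionField (genericPoint M.X) = 𝟙 _ :=
    TopCat.Presheaf.stalkSpecializes_refl _ _
  exact ⟨z, congr($h z)⟩

section Curve

variable (hB : ∀ b : B.X, b = genericPoint B.X ∨ IsClosed ({b} : Set B.X))
  (hB' : ¬ IsClosed ({genericPoint B.X} : Set B.X))

include hB

lemma dim_le_one_of_curve : B.dim ≤ 1 := by
  rw [dim, topologicalKrullDim, Order.krullDim_le_one_iff]
  intro Z
  obtain ⟨b, hb⟩ := QuasiSober.sober Z.isIrreducible Z.isClosed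
  rcases hB b with rfl | h
  · right
    intro Y hY y _
    have : (Z : Set B.X) = Set.univ := hb.def.symm.trans (genericPoint_spec B.X).def
    have h' : y ∈ (Z : Set B.X) := this ▸ trivial
    exact h'
  · left
    intro Y hY y hy
    have hZ : (Z : Set B.X) = {b} := hb.def.symm.trans h.closure_eq
    have h₁ : ∀ z ∈ (Y : Set B.X), z = b := fun z hz ↦ by
      have h₂ : z ∈ (Z : Set B.X) := hY hz
      rwa [hZ] at h₂
    obtain ⟨z, hz⟩ := Y.isIrreducible.nonempty
    have hyb : y = b := by
      have h₂ : y ∈ (Z : Set B.X) := hy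
      rwa [hZ] at h₂
    rw [hyb, ← h₁ z hz]
    exact hz

include hB'

lemma dim_pos_of_curve : 0 < B.dim := by
  rw [dim, topologicalKrullDim, Order.krullDim_pos_iff]
  obtain ⟨b, hb⟩ : ∃ b : B.X, b ≠ genericPoint B.X := by
    by_contra! h
    apply hB'
    have : ({genericPoint B.X} : Set B.X) = Set.univ := Set.eq_univ_of_forall h
    rw [this]
    exact isClosed_univ
  have hbc := (hB b).resolve_left hb
  refine ⟨⟨{b}, isIrreducible_singleton, hbc⟩,
    ⟨Set.univ, IrreducibleSpace.isIrreducible_univ _, isClosed_univ⟩, ?_⟩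
  refine lt_of_le_of_ne (fun _ _ ↦ trivial) fun h ↦ hb ?_
  have h₁ : ({b} : Set B.X) = Set.univ := congr(($h : Set B.X))
  have h₂ : genericPoint B.X ∈ ({b} : Set B.X) := h₁ ▸ trivial
  exact h₂.symm

end Curve

end PrimBir.NormalProjVariety

/-! ### The criterion for imprimitivity -/

namespace PrimBir.Bir

open Scheme NormalProjVariety

variable {k : Type u} [Field k] [IsAlgClosed k] {M : NormalProjVariety k} (f : Bir M)

/-- If the pull-back under `f` preserves the field of rational functions of one element, then `f`
preserves a fibration over a curve. -/
theorem isImprimitive_of_pullbackK_mem_adjoin (hM : 2 ≤ M.dim) {x : M.K}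
    (hx : x ∉ (algebraMap k M.K).range)
    (h : f.pullbackK x ∈ IntermediateField.adjoin k {x}) : f.IsImprimitive := by
  obtain ⟨L, y, hyx, hL, hy, halg, hLcl, hLτ⟩ := exists_algebraicClosure_adjoin_simple hx
  obtain ⟨B, θ, hθ, hθk, hB⟩ := exists_curve hy halg
  have hθc : B.constHom ≫ θ = CommRingCat.ofHom (algebraMap k L) := by
    apply Spec.map_injective
    rw [Spec.map_comp, specMap_constHom, hθk]
  have : IsIso θ := (ConcreteCategory.isIso_iff_bijective θ).2 hθ
  let incl : CommRingCat.of L ⟶ M.X.functionField := CommRingCat.ofHom L.val.toRingHom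
  let τL : CommRingCat.of L ⟶ CommRingCat.of L :=
    CommRingCat.ofHom ((f.pullbackK.toRingHom.comp L.val.toRingHom).codRestrict L
      fun a ↦ hLτ f.pullbackK h a a.2)
  have hincl : CommRingCat.ofHom (algebraMap k L) ≫ incl = M.constHom := rfl
  have hτL : CommRingCat.ofHom (algebraMap k L) ≫ τL = CommRingCat.ofHom (algebraMap k L) := by
    ext c
    exact f.pullbackK.commutes c
  have hτincl : τL ≫ incl = incl ≫ f.map.pullback := rfl
  obtain ⟨φ, hφd, hφo, hφ⟩ := exists_rationalMap (M := M) (B := B) (θ ≫ incl) (by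
    rw [← Category.assoc, hθc, hincl])
  obtain ⟨fB, hfBd, hfBo, hfB⟩ := exists_rationalMap (M := B) (B := B) (θ ≫ τL ≫ inv θ) (by
    rw [← Category.assoc, hθc, ← Category.assoc, hτL, ← hθc, Category.assoc, IsIso.hom_inv_id,
      Category.comp_id])
  -- Otherwise `B` is a single point, every rational function on it is regular everywhere, hence
  -- constant, and `y` would not be transcendental.
  have hB' : ¬ IsClosed ({genericPoint B.X} : Set B.X) := by
    intro hcl
    have hgen : ∀ b : B.X, b = genericPoint B.X := fun b ↦ by
      have h₁ := hcl.closure_eq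
      rw [(genericPoint_spec B.X).def] at h₁
      have h₂ : b ∈ ({genericPoint B.X} : Set B.X) := h₁ ▸ trivial
      exact h₂
    obtain ⟨w, hw⟩ := hθ.2 y
    have hw' : ∀ b : B.X, (w : B.K) ∈ B.localRing b := fun b ↦ by
      rw [hgen b]
      exact mem_localRing_genericPoint w
    obtain ⟨c, hc⟩ := mem_range_of_forall_mem_localRing hw'
    have : y = algebraMap k L c := by
      rw [← hw]
      refine (congrArg θ hc.symm).trans ?_
      exact congr($hθc c)
    exact hy (this ▸ isAlgebraic_algebraMap c)
  refine ⟨B, φ, hφd, hφo, fB, hfBo, ?_, dim_pos_of_curve hB hB', ?_, ?_⟩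
  · refine hasConnectedGeneralFiber φ ?_ hB hB'
    intro z hz
    let zK : M.K := z
    have hz' : IsAlgebraic L zK := by
      let idK : M.X.functionField →+* M.K := RingHom.id M.X.functionField
      let := φ.pullback.hom.toAlgebra
      refine IsAlgebraic.ringHom_of_comp_eq (a := z) θ.hom idK hz θ.hom.injective ?_
      ext a
      exact (congr($hφ a)).symm
    obtain ⟨w, hw⟩ := hθ.2 ⟨z, hLcl z hz'⟩
    refine ⟨w, ?_⟩
    refine (congr($hφ w)).trans ?_
    exact congrArg (Subtype.val : L → M.K) hw
  · exact (dim_le_one_of_curve hB).trans_lt (lt_of_lt_of_le (by norm_num) hM)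
  · apply RationalMap.eq_of_fromFunctionField_eq
    rw [RationalMap.fromFunctionField_comp, RationalMap.fromFunctionField_comp,
      ← φ.specMap_pullback, ← fB.specMap_pullback, ← Category.assoc, ← Category.assoc,
      ← Spec.map_comp, ← Spec.map_comp, hφ, hfB]
    congr 2
    simp only [Category.assoc, IsIso.inv_hom_id_assoc, hτincl]

end PrimBir.Bir

/-! ### Cartier divisors and points of codimension one -/

namespace PrimBir

open Scheme NormalProjVariety

namespace NormalProjVariety

variable {k : Type u} [Field k] {M : NormalProjVariety k}

lemma toK_stalkSpecializes {x y : M.X} (h : y ⤳ x) (s : M.X.presheaf.stalk x) :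
    M.toK y (M.X.presheaf.stalkSpecializes h s) = M.toK x s :=
  congr($(M.X.presheaf.stalkSpecializes_comp (genericPoint_specializes y) h) s)

lemma localRing_mono {x y : M.X} (h : y ⤳ x) : M.localRing x ≤ M.localRing y := by
  rintro _ ⟨s, rfl⟩
  exact ⟨_, toK_stalkSpecializes h s⟩

lemma localUnits_mono {x y : M.X} (h : y ⤳ x) : localUnits M x ≤ localUnits M y :=
  fun _ hu ↦ (mem_localUnits M).2 ⟨localRing_mono h ((mem_localUnits M).1 hu).1,
    localRing_mono h ((mem_localUnits M).1 hu).2⟩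

lemma toK_mem_localUnits {x : M.X} {s : M.X.presheaf.stalk x} (hs : IsUnit s) (u : M.Kˣ)
    (hu : (u : M.K) = M.toK x s) : u ∈ localUnits M x := by
  refine (mem_localUnits M).2 ⟨⟨s, hu.symm⟩, ?_⟩
  obtain ⟨t, rfl⟩ := hs
  refine ⟨((t⁻¹ : (M.X.presheaf.stalk x)ˣ) : M.X.presheaf.stalk x), ?_⟩
  rw [Units.val_inv_eq_inv_val, hu]
  refine eq_inv_of_mul_eq_one_left ?_
  rw [← map_mul, Units.inv_mul, map_one]

lemma germClass_eq_iff {x : M.X} {d d' : M.Kˣ} :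
    germClass M x d = germClass M x d' ↔ d⁻¹ * d' ∈ localUnits M x :=
  QuotientGroup.eq

lemma germClass_eq_one_iff {x : M.X} {d : M.Kˣ} :
    germClass M x d = 1 ↔ d ∈ localUnits M x :=
  QuotientGroup.eq_one_iff d

lemma mem_localUnits_genericPoint (d : M.Kˣ) : d ∈ localUnits M (genericPoint M.X) :=
  (mem_localUnits M).2 ⟨mem_localRing_genericPoint _, mem_localRing_genericPoint _⟩

lemma eq_genericPoint_or_eq_of_ringKrullDim_le_one {y y' : M.X}
    (hy : ringKrullDim (M.X.presheaf.stalk y) ≤ 1) (h : y' ⤳ y) :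
    y' = genericPoint M.X ∨ y' = y := by
  obtain ⟨P, rfl⟩ : y' ∈ Set.range (M.X.fromSpecStalk y) := by
    rw [range_fromSpecStalk]
    exact h
  by_cases hP : P.asIdeal = ⊥
  · exact .inl (fromSpecStalk_bot y P hP)
  right
  have : Ring.KrullDimLE 1 (M.X.presheaf.stalk y) := Ring.krullDimLE_iff.2 hy
  have hPp : P.asIdeal.IsPrime := PrimeSpectrum.isPrime P
  have hmax := Ring.krullDimLE_one_iff_of_noZeroDivisors.1 this P.asIdeal hP hPp
  have : P = IsLocalRing.closedPoint (M.X.presheaf.stalk y) :=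
    PrimeSpectrum.ext (IsLocalRing.eq_maximalIdeal hmax)
  rw [this]
  exact fromSpecStalk_closedPoint

/-- Such a point is the generic point of a component of the complement of `W`, of which there are
finitely many. -/
lemma finite_notMem_of_ringKrullDim_le_one (W : M.X.Opens) (hW : genericPoint M.X ∈ W) :
    {y : M.X | y ∉ W ∧ ringKrullDim (M.X.presheaf.stalk y) ≤ 1}.Finite := by
  have : IsNoetherian M.X := {}
  obtain ⟨S, hS, hcl, hirr, hWS⟩ :=
    TopologicalSpace.NoetherianSpace.exists_finite_set_isClosed_irreducible W.2.isClosed_compl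
  replace hWS : (W : Set M.X)ᶜ = ⋃₀ S := hWS
  choose η hη using fun t : S ↦ QuasiSober.sober (hirr t t.2) (hcl t t.2)
  have := hS.to_subtype
  refine (Set.finite_range η).subset ?_
  rintro y ⟨hyW, hy⟩
  have hmem : y ∈ (W : Set M.X)ᶜ := hyW
  rw [hWS] at hmem
  obtain ⟨T, hT, hyT⟩ := hmem
  refine ⟨⟨T, hT⟩, (eq_genericPoint_or_eq_of_ringKrullDim_le_one hy
    ((hη ⟨T, hT⟩).specializes hyT)).resolve_left fun h ↦ ?_⟩
  have : η ⟨T, hT⟩ ∈ (W : Set M.X)ᶜ := by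
    rw [hWS]
    exact ⟨T, hT, (hη ⟨T, hT⟩).mem⟩
  rw [h] at this
  exact this hW

lemma exists_open_mem_localRing (z : M.K) :
    ∃ W : M.X.Opens, genericPoint M.X ∈ W ∧ ∀ y ∈ W, z ∈ M.localRing y := by
  obtain ⟨W, hW, s, hs⟩ := M.X.presheaf.exists_germ_eq (x := genericPoint M.X) z
  refine ⟨W, hW, fun y hy ↦ ⟨M.X.presheaf.germ W y hy s, ?_⟩⟩
  exact (stalkToFunctionField_germ hy hW s).trans hs

lemma exists_open_mem_localUnits (z : M.Kˣ) :
    ∃ W : M.X.Opens, genericPoint M.X ∈ W ∧ ∀ y ∈ W, z ∈ localUnits M y := by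
  obtain ⟨W, hW, h⟩ := exists_open_mem_localRing (z : M.K)
  obtain ⟨W', hW', h'⟩ := exists_open_mem_localRing ((z⁻¹ : M.Kˣ) : M.K)
  exact ⟨W ⊓ W', ⟨hW, hW'⟩, fun y hy ↦ (mem_localUnits M).2 ⟨h y hy.1, h' y hy.2⟩⟩

/-- Hartogs for the quotient of `d` and `d'` and for its inverse. -/
lemma germClass_eq_of_forall_specializes {x : M.X} {d d' : M.Kˣ}
    (h : ∀ y : M.X, y ⤳ x → ringKrullDim (M.X.presheaf.stalk y) ≤ 1 →
      germClass M y d = germClass M y d') : germClass M x d = germClass M x d' := by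
  rw [germClass_eq_iff]
  refine (mem_localUnits M).2 ⟨M.mem_localRing_of_forall_specializes fun y hy hy1 ↦ ?_,
    M.mem_localRing_of_forall_specializes fun y hy hy1 ↦ ?_⟩
  · exact ((mem_localUnits M).1 (germClass_eq_iff.1 (h y hy hy1))).1
  · exact ((mem_localUnits M).1 (germClass_eq_iff.1 (h y hy hy1))).2

end NormalProjVariety

variable {k : Type u} [Field k] {M : NormalProjVariety k}

lemma IsLocalEquation.of_specializes {D : CartierDivisor M} {x y : M.X} {d : M.Kˣ}
    (hd : IsLocalEquation D x d) (h : y ⤳ x) : IsLocalEquation D y d := by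
  obtain ⟨V, hV, d₀, hd₀⟩ := D.2 x
  have h₁ : germClass M x d₀ = germClass M x d := (hd₀ x hV).symm.trans hd
  refine (hd₀ y (h.mem_open V.2 hV)).trans ?_
  rw [germClass_eq_iff] at h₁ ⊢
  exact localUnits_mono h h₁

lemma CartierDivisor.ext_of_ringKrullDim_le_one {D D' : CartierDivisor M}
    (h : ∀ y : M.X, ringKrullDim (M.X.presheaf.stalk y) ≤ 1 → D.1 y = D'.1 y) : D = D' := by
  refine Subtype.ext (funext fun x ↦ ?_)
  obtain ⟨d, hd⟩ := exists_isLocalEquation D x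
  obtain ⟨d', hd'⟩ := exists_isLocalEquation D' x
  refine Eq.trans hd (Eq.trans ?_ hd'.symm)
  refine germClass_eq_of_forall_specializes fun y hy hy1 ↦ ?_
  exact (hd.of_specializes hy).symm.trans ((h y hy1).trans (hd'.of_specializes hy))

/-- At a factorial point, the prime divisors through it have local equations. -/
lemma exists_uniformizer {x : M.X} [UniqueFactorizationMonoid (M.X.presheaf.stalk x)] {y : M.X}
    (hyx : y ⤳ x) (hy : ringKrullDim (M.X.presheaf.stalk y) ≤ 1) (hyη : y ≠ genericPoint M.X) :
    ∃ π : M.Kˣ, (∀ c : DivisorGerm M y, ∃ n : ℤ, c = germClass M y (π ^ n)) ∧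
      ∀ y' : M.X, y' ⤳ x → ringKrullDim (M.X.presheaf.stalk y') ≤ 1 → y' ≠ y →
        π ∈ localUnits M y' := by
  let σ := M.X.fromSpecStalk x
  have hσ : Function.Injective σ := (M.X.fromSpecStalk x).isEmbedding.injective
  have hσx : ∀ y', y' ⤳ x → ∃ P, σ P = y' := fun y' h ↦ by
    have : y' ∈ Set.range σ := by
      rw [range_fromSpecStalk]
      exact h
    exact this
  have hunit : ∀ (Q : Spec (M.X.presheaf.stalk x)) (a : M.X.presheaf.stalk x) (u : M.Kˣ),
      (u : M.K) = M.toK x a → a ∉ Q.asIdeal → u ∈ localUnits M (σ Q) := by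
    intro Q a u hu ha
    have hQx : σ Q ⤳ x := by
      have : σ Q ∈ Set.range σ := ⟨Q, rfl⟩
      rwa [range_fromSpecStalk] at this
    let pt : Spec (M.X.presheaf.stalk (σ Q)) := IsLocalRing.closedPoint (M.X.presheaf.stalk (σ Q))
    have h₁ : Spec.map (M.X.presheaf.stalkSpecializes hQx) pt = Q := by
      apply hσ
      have h₂ : σ (Spec.map (M.X.presheaf.stalkSpecializes hQx) pt) = M.X.fromSpecStalk (σ Q) pt :=
        congr($(SpecMap_stalkSpecializes_fromSpecStalk hQx) pt)
      rw [h₂]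
      exact fromSpecStalk_closedPoint
    refine toK_mem_localUnits (s := M.X.presheaf.stalkSpecializes hQx a) ?_ u
      (hu.trans (toK_stalkSpecializes hQx a).symm)
    by_contra hn
    apply ha
    rw [← h₁]
    exact (IsLocalRing.mem_maximalIdeal _).2 hn
  obtain ⟨P, rfl⟩ := hσx y hyx
  have hPp : P.asIdeal.IsPrime := PrimeSpectrum.isPrime P
  have hP0 : P.asIdeal ≠ ⊥ := fun h ↦ hyη (fromSpecStalk_bot x P h)
  -- Unique factorisation provides a prime element in `P`. Codimension one forces `P = (p)`, so `p`
  -- is a unit at the other points of codimension one through `x`.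
  obtain ⟨p, hpP, hp⟩ := Ideal.IsPrime.exists_mem_prime_of_ne_bot hPp hP0
  let P' : Spec (M.X.presheaf.stalk x) :=
    ⟨Ideal.span {p}, (Ideal.span_singleton_prime hp.ne_zero).2 hp⟩
  have hP'P : P' = P := by
    have h₁ : P' ⤳ P := (PrimeSpectrum.le_iff_specializes P' P).1
      ((Ideal.span_singleton_le_iff_mem _).2 hpP)
    refine hσ ((eq_genericPoint_or_eq_of_ringKrullDim_le_one hy (h₁.map σ.continuous)).resolve_left
      fun h ↦ hp.ne_zero ?_)
    rw [← fromSpecStalk_bot x (⟨⊥, Ideal.isPrime_bot⟩ : PrimeSpectrum _) rfl] at h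
    have h₂ : p ∈ P'.asIdeal := Ideal.mem_span_singleton_self p
    rw [hσ h] at h₂
    exact h₂
  have hPspan : ∀ a, a ∈ P.asIdeal ↔ p ∣ a := fun a ↦ by
    rw [← hP'P]
    exact Ideal.mem_span_singleton
  have hp0 : M.toK x p ≠ 0 := (map_ne_zero_iff _ (M.toK_injective x)).2 hp.ne_zero
  let π : M.Kˣ := Units.mk0 _ hp0
  refine ⟨π, fun c ↦ ?_, fun y' hy'x hy' hne ↦ ?_⟩
  · obtain ⟨z, rfl⟩ := QuotientGroup.mk_surjective c
    obtain ⟨a, b, hb, hab⟩ := M.exists_div_toK x z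
    have hb0 : M.toK x b ≠ 0 := (map_ne_zero_iff _ (M.toK_injective x)).2 hb
    have ha : a ≠ 0 := by
      rintro rfl
      rw [map_zero] at hab
      exact (mul_ne_zero z.ne_zero hb0) hab
    obtain ⟨a', hpa, ha'⟩ := (FiniteMultiplicity.of_prime_left hp ha).exists_eq_pow_mul_and_not_dvd
    obtain ⟨b', hpb, hb'⟩ := (FiniteMultiplicity.of_prime_left hp hb).exists_eq_pow_mul_and_not_dvd
    generalize multiplicity p a = m at hpa
    generalize multiplicity p b = l at hpb
    have ha'0 : M.toK x a' ≠ 0 := (map_ne_zero_iff _ (M.toK_injective x)).2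
      fun h ↦ ha' (h ▸ dvd_zero p)
    have hb'0 : M.toK x b' ≠ 0 := (map_ne_zero_iff _ (M.toK_injective x)).2
      fun h ↦ hb' (h ▸ dvd_zero p)
    have hua := hunit P a' (Units.mk0 _ ha'0) rfl (by rwa [hPspan])
    have hub := hunit P b' (Units.mk0 _ hb'0) rfl (by rwa [hPspan])
    refine ⟨m - l, germClass_eq_iff.2 ?_⟩
    have : z⁻¹ * π ^ ((m : ℤ) - l) = (Units.mk0 _ ha'0)⁻¹ * Units.mk0 _ hb'0 := by
      rw [hpa, hpb, map_mul, map_mul, map_pow, map_pow] at hab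
      rw [zpow_sub, zpow_natCast, zpow_natCast]
      apply Units.ext
      have hz0 := z.ne_zero
      push_cast
      simp only [Units.val_mk0, π]
      field_simp
      linear_combination -hab
    rw [this]
    exact mul_mem (inv_mem hua) hub
  · obtain ⟨Q, rfl⟩ := hσx y' hy'x
    refine hunit Q p π rfl fun hpQ ↦ ?_
    have h₁ : P ⤳ Q := by
      rw [← hP'P]
      exact (PrimeSpectrum.le_iff_specializes P' Q).1 ((Ideal.span_singleton_le_iff_mem _).2 hpQ)
    rcases eq_genericPoint_or_eq_of_ringKrullDim_le_one hy' (h₁.map σ.continuous) with h | h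
    · exact hyη h
    · exact hne h.symm

/-- On a factorial variety, a divisor is given by its local equations in codimension one. -/
theorem exists_cartierDivisor_of_isFactorial (hM : M.IsFactorial) (w : ∀ y, DivisorGerm M y)
    (d₀ : M.Kˣ)
    (hfin : {y : M.X | w y ≠ germClass M y d₀ ∧ ringKrullDim (M.X.presheaf.stalk y) ≤ 1}.Finite) :
    ∃ D : CartierDivisor M, ∀ y, ringKrullDim (M.X.presheaf.stalk y) ≤ 1 → D.1 y = w y := by
  classical
  have hloc : ∀ x : M.X, ∃ d, ∀ y : M.X, y ⤳ x → ringKrullDim (M.X.presheaf.stalk y) ≤ 1 →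
      w y = germClass M y d := by
    intro x
    have := hM x
    have h₁ : ∀ y : M.X, ∃ e : M.Kˣ, y ⤳ x → ringKrullDim (M.X.presheaf.stalk y) ≤ 1 →
        w y = germClass M y (d₀ * e) ∧
          ∀ y' : M.X, y' ⤳ x → ringKrullDim (M.X.presheaf.stalk y') ≤ 1 → y' ≠ y →
            germClass M y' e = 1 := by
      intro y
      by_cases hyη : y = genericPoint M.X
      · refine ⟨1, fun _ _ ↦ ⟨?_, fun y' _ _ _ ↦ map_one _⟩⟩
        obtain ⟨z, hz⟩ := QuotientGroup.mk_surjective (w y)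
        rw [← hz, hyη]
        exact germClass_eq_iff.2 (mem_localUnits_genericPoint _)
      by_cases hyx : y ⤳ x ∧ ringKrullDim (M.X.presheaf.stalk y) ≤ 1
      · obtain ⟨π, h₁, h₂⟩ := exists_uniformizer hyx.1 hyx.2 hyη
        obtain ⟨n, hn⟩ := h₁ ((germClass M y d₀)⁻¹ * w y)
        refine ⟨π ^ n, fun _ _ ↦ ⟨?_, fun y' hy' hy'1 hne ↦ ?_⟩⟩
        · rw [map_mul, ← hn, mul_inv_cancel_left]
        · exact germClass_eq_one_iff.2 (zpow_mem (h₂ y' hy' hy'1 hne) n)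
      · exact ⟨1, fun h h' ↦ absurd ⟨h, h'⟩ hyx⟩
    choose e he using h₁
    let N := hfin.toFinset.filter fun y ↦ y ⤳ x
    -- `d₀` is wrong at only finitely many points of codimension one through `x`. Each `e y`
    -- corrects one of them without affecting the others.
    refine ⟨d₀ * ∏ y ∈ N, e y, fun y hy hy1 ↦ ?_⟩
    have hone : ∀ y' ∈ N, y' ≠ y → germClass M y (e y') = 1 := by
      intro y' hy' hne
      obtain ⟨hy'₁, hy'₂⟩ := Finset.mem_filter.1 hy'
      exact (he y' hy'₂ ((Set.Finite.mem_toFinset _).1 hy'₁).2).2 y hy hy1 hne.symm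
    rw [map_mul, map_prod]
    by_cases hyN : y ∈ N
    · rw [Finset.prod_eq_single_of_mem y hyN hone, ← map_mul]
      exact (he y hy hy1).1
    · rw [Finset.prod_eq_one fun y' hy' ↦ hone y' hy' fun h ↦ hyN (h ▸ hy'), mul_one]
      by_contra hne
      exact hyN (Finset.mem_filter.2 ⟨(Set.Finite.mem_toFinset _).2 ⟨hne, hy1⟩, hy⟩)
  choose d hd using hloc
  refine ⟨⟨fun x ↦ germClass M x (d x), fun x ↦ ?_⟩, fun y hy ↦ (hd y y specializes_rfl hy).symm⟩
  have hfin' : {y : M.X | w y ≠ germClass M y (d x) ∧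
      ringKrullDim (M.X.presheaf.stalk y) ≤ 1}.Finite := by
    obtain ⟨W, hW, hWu⟩ := exists_open_mem_localUnits (d₀⁻¹ * d x)
    refine (hfin.union (finite_notMem_of_ringKrullDim_le_one W hW)).subset ?_
    rintro y ⟨hy, hy1⟩
    by_cases hyW : y ∈ W
    · left
      rw [← germClass_eq_iff.2 (hWu y hyW)] at hy
      exact ⟨hy, hy1⟩
    · exact .inr ⟨hyW, hy1⟩
  -- Away from the closures of the finitely many codimension-one points at which `d x` fails, it is
  -- a local equation everywhere.
  refine ⟨⟨(⋃ y ∈ {y : M.X | w y ≠ germClass M y (d x) ∧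
      ringKrullDim (M.X.presheaf.stalk y) ≤ 1}, closure {y})ᶜ,
    (hfin'.isClosed_biUnion fun _ _ ↦ isClosed_closure).isOpen_compl⟩, ?_, d x, fun y hy ↦ ?_⟩
  · intro h
    obtain ⟨y, ⟨hy, hy1⟩, hyx⟩ := Set.mem_iUnion₂.1 h
    exact hy (hd x y (specializes_iff_mem_closure.2 hyx) hy1)
  · refine germClass_eq_of_forall_specializes fun y' hy' hy'1 ↦ ?_
    rw [← hd y y' hy' hy'1]
    by_contra hne
    exact hy (Set.mem_iUnion₂.2 ⟨y', ⟨hne, hy'1⟩, specializes_iff_mem_closure.1 hy'⟩)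

end PrimBir

/-! ### Pull-back of Cartier divisors -/

namespace PrimBir.Bir

open Scheme NormalProjVariety

variable {k : Type u} [Field k] {M : NormalProjVariety k} (f : Bir M)

/-- The domain of definition of `f`. -/
noncomputable abbrev domain : M.X.Opens := f.map.toPartialMap.domain

/-- The morphism given by `f` on its domain of definition, on points. -/
noncomputable def apply (x : f.domain) : M.X := f.map.toPartialMap.hom x

/-- The pull-back of nonzero rational functions. -/
noncomputable def pullbackUnits : M.Kˣ →* M.Kˣ := Units.map (f.pullbackK : M.K →* M.K)

lemma val_pullbackUnits (d : M.Kˣ) : (f.pullbackUnits d : M.K) = f.pullbackK d := rfl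

lemma pullbackK_mem_localRing (x : f.domain) {z : M.K} (hz : z ∈ M.localRing (f.apply x)) :
    f.pullbackK z ∈ M.localRing x.1 := by
  obtain ⟨s, rfl⟩ := hz
  exact ⟨_, f.toK_localPullback x s⟩

lemma pullbackUnits_mem_localUnits (x : f.domain) {u : M.Kˣ} (hu : u ∈ localUnits M (f.apply x)) :
    f.pullbackUnits u ∈ localUnits M x.1 := by
  rw [mem_localUnits] at hu
  refine (mem_localUnits M).2 ⟨f.pullbackK_mem_localRing x hu.1, ?_⟩
  rw [← map_inv]
  exact f.pullbackK_mem_localRing x hu.2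

/-- The pull-back `K*/O*_{f(x)} → K*/O*_x`. -/
noncomputable def germMap (x : f.domain) : DivisorGerm M (f.apply x) →* DivisorGerm M x.1 :=
  QuotientGroup.map _ _ f.pullbackUnits fun _ ↦ f.pullbackUnits_mem_localUnits x

lemma germMap_germClass (x : f.domain) (d : M.Kˣ) :
    f.germMap x (germClass M (f.apply x) d) = germClass M x.1 (f.pullbackUnits d) := rfl

lemma isPullback_iff_germMap {D D' : CartierDivisor M} :
    f.IsPullback D D' ↔ ∀ x : f.domain, D'.1 x.1 = f.germMap x (D.1 (f.apply x)) := by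
  rw [isPullback_iff]
  refine forall_congr' fun x ↦ ⟨fun h ↦ ?_, fun h d d' hd hd' ↦ ?_⟩
  · obtain ⟨d, hd⟩ := exists_isLocalEquation D (f.apply x)
    obtain ⟨d', hd'⟩ := exists_isLocalEquation D' x.1
    obtain ⟨u, hu, h⟩ := h d d' hd hd'
    have hd₂ : D.1 (f.apply x) = germClass M _ d := hd
    rw [hd₂, germMap_germClass]
    refine Eq.trans hd' (germClass_eq_iff.2 ?_).symm
    have : d' = f.pullbackUnits d * u := Units.ext h
    rwa [this, inv_mul_cancel_left]
  · have hd₂ : D.1 (f.apply x) = germClass M _ d := hd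
    rw [hd₂, germMap_germClass] at h
    have hd₁ : D'.1 x.1 = germClass M _ d' := hd'
    rw [hd₁] at h
    refine ⟨_, germClass_eq_iff.1 h.symm, ?_⟩
    rw [← val_pullbackUnits, ← Units.val_mul, mul_inv_cancel_left]

lemma apply_specializes {x y : f.domain} (h : y.1 ⤳ x.1) : f.apply y ⤳ f.apply x :=
  Specializes.map (Topology.IsInducing.subtypeVal.specializes_iff.1 h)
    f.map.toPartialMap.hom.continuous

lemma isPullback_of_ringKrullDim_le_one {D D' : CartierDivisor M}
    (h : ∀ x : f.domain, ringKrullDim (M.X.presheaf.stalk x.1) ≤ 1 →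
      D'.1 x.1 = f.germMap x (D.1 (f.apply x))) : f.IsPullback D D' := by
  rw [isPullback_iff_germMap]
  intro x
  obtain ⟨d, hd⟩ := exists_isLocalEquation D (f.apply x)
  obtain ⟨d', hd'⟩ := exists_isLocalEquation D' x.1
  have hd₂ : D.1 (f.apply x) = germClass M _ d := hd
  rw [hd₂, germMap_germClass]
  refine Eq.trans hd' (germClass_eq_of_forall_specializes fun y hy hy1 ↦ ?_)
  have hyd : y ∈ f.domain := hy.mem_open f.domain.2 x.2
  have hdy : D.1 (f.apply ⟨y, hyd⟩) = germClass M _ d :=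
    hd.of_specializes (f.apply_specializes (y := ⟨y, hyd⟩) hy)
  refine (hd'.of_specializes hy).symm.trans ((h ⟨y, hyd⟩ hy1).trans ?_)
  rw [hdy, germMap_germClass]

variable {f} in
-- The domain of `f` contains all points of codimension at most one, and these determine a divisor.
lemma IsPullback.unique {D D' D'' : CartierDivisor M} (h' : f.IsPullback D D')
    (h'' : f.IsPullback D D'') : D' = D'' := by
  rw [isPullback_iff_germMap] at h' h''
  refine CartierDivisor.ext_of_ringKrullDim_le_one fun y hy ↦ ?_
  have hyd := M.mem_domain_of_ringKrullDim_le_one f.map hy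
  exact (h' ⟨y, hyd⟩).trans (h'' ⟨y, hyd⟩).symm

variable {f} in
lemma IsPullback.mul {D D' E E' : CartierDivisor M} (hD : f.IsPullback D D')
    (hE : f.IsPullback E E') : f.IsPullback (D * E) (D' * E') := by
  rw [isPullback_iff_germMap] at hD hE ⊢
  intro x
  have h₁ : (D' * E').1 x.1 = D'.1 x.1 * E'.1 x.1 := rfl
  have h₂ : (D * E).1 (f.apply x) = D.1 (f.apply x) * E.1 (f.apply x) := rfl
  rw [h₁, h₂, map_mul, hD, hE]

lemma isPullback_principal (h : M.Kˣ) :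
    f.IsPullback (principal M h) (principal M (f.pullbackUnits h)) :=
  f.isPullback_iff_germMap.2 fun _ ↦ rfl

variable {f} in
lemma IsPullback.isEffective {D D' : CartierDivisor M} (h : f.IsPullback D D')
    (hD : IsEffective D) : IsEffective D' := by
  rw [isPullback_iff_germMap] at h
  intro x d' hd'
  refine M.mem_localRing_of_forall_specializes fun y hy hy1 ↦ ?_
  have hyd := M.mem_domain_of_ringKrullDim_le_one f.map hy1
  obtain ⟨d, hd⟩ := exists_isLocalEquation D (f.apply ⟨y, hyd⟩)
  have hd₂ : D.1 (f.apply ⟨y, hyd⟩) = germClass M _ d := hd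
  have h₁ := h ⟨y, hyd⟩
  rw [hd₂, germMap_germClass] at h₁
  have hu := germClass_eq_iff.1 (h₁.symm.trans (hd'.of_specializes hy))
  have : d' = f.pullbackUnits d * ((f.pullbackUnits d)⁻¹ * d') := (mul_inv_cancel_left _ _).symm
  rw [this, Units.val_mul]
  exact mul_mem (f.pullbackK_mem_localRing ⟨y, hyd⟩ (hD _ _ hd)) ((mem_localUnits M).1 hu).1

lemma genericPoint_mem_domain : genericPoint M.X ∈ f.domain :=
  f.map.toPartialMap.genericPoint_mem_domain

lemma exists_open_germMap_eq (D : CartierDivisor M) (x : f.domain) :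
    ∃ W : M.X.Opens, x.1 ∈ W ∧ ∃ d : M.Kˣ, ∀ y ∈ W, ∃ hy : y ∈ f.domain,
      f.germMap ⟨y, hy⟩ (D.1 (f.apply ⟨y, hy⟩)) = germClass M y d := by
  obtain ⟨V, hV, d, hd⟩ := D.2 (f.apply x)
  refine ⟨f.domain.ι ''ᵁ (f.map.toPartialMap.hom ⁻¹ᵁ V), ⟨x, hV, rfl⟩, f.pullbackUnits d, ?_⟩
  rintro _ ⟨y, hy, rfl⟩
  refine ⟨y.2, ?_⟩
  have h : D.1 (f.apply y) = germClass M _ d := hd _ hy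
  exact (congrArg (f.germMap y) h).trans (f.germMap_germClass y d)

/-- Local equations always pull back over the domain of `f`. Either this is all of `M`, or
factoriality extends the divisor from codimension one. -/
lemma exists_isPullback (h : f.domain = ⊤ ∨ M.IsFactorial) (D : CartierDivisor M) :
    ∃ D', f.IsPullback D D' := by
  classical
  -- The value outside the domain is immaterial, since `IsPullback` only tests points of the domain.
  let w : ∀ y, DivisorGerm M y := fun y ↦
    if hy : y ∈ f.domain then f.germMap ⟨y, hy⟩ (D.1 (f.apply ⟨y, hy⟩)) else 1
  have hw : ∀ y : f.domain, w y.1 = f.germMap y (D.1 (f.apply y)) := fun y ↦ dif_pos y.2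
  obtain h | h := h
  · refine ⟨⟨w, fun x ↦ ?_⟩, f.isPullback_iff_germMap.2 hw⟩
    have hx : x ∈ f.domain := h ▸ trivial
    obtain ⟨W, hW, d, hd⟩ := f.exists_open_germMap_eq D ⟨x, hx⟩
    refine ⟨W, hW, d, fun y hy ↦ ?_⟩
    obtain ⟨hy, h⟩ := hd y hy
    exact (hw ⟨y, hy⟩).trans h
  · obtain ⟨W, hW, d, hd⟩ := f.exists_open_germMap_eq D ⟨_, f.genericPoint_mem_domain⟩
    obtain ⟨D', hD'⟩ := exists_cartierDivisor_of_isFactorial h w d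
      ((finite_notMem_of_ringKrullDim_le_one W hW).subset fun y hy ↦ ⟨fun hyW ↦ hy.1 (by
        obtain ⟨hy, h⟩ := hd y hyW
        exact (hw ⟨y, hy⟩).trans h), hy.2⟩)
    exact ⟨D', f.isPullback_of_ringKrullDim_le_one fun y hy ↦ (hD' _ hy).trans (hw y)⟩

end PrimBir.Bir

/-! ### The inverse of `f` and the automorphism of the Picard group -/

namespace PrimBir.Bir

open Scheme NormalProjVariety

variable {k : Type u} [Field k] {M : NormalProjVariety k}

lemma exists_apply_eq (f : Bir M) {e : M.X.PartialIso M.X} (he : e.toRationalMap = f.map)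
    (x : e.source) : ∃ h : x.1 ∈ f.domain, f.apply ⟨x.1, h⟩ = (e.iso.hom x).1 := by
  obtain ⟨φ, hφ⟩ := f
  obtain rfl : e.toRationalMap = φ := he
  have hle : e.source ≤ e.toRationalMap.toPartialMap.domain :=
    e.toPartialMap.le_domain_toRationalMap
  refine ⟨hle x.2, ?_⟩
  have h := e.toPartialMap.toPartialMap_toRationalMap_restrict
  have h' : (e.toRationalMap.toPartialMap.restrict _ e.dense_source hle).hom x =
    e.toPartialMap.hom x := congr($h x)
  refine Eq.trans ?_ h'
  refine congrArg e.toRationalMap.toPartialMap.hom (Subtype.ext ?_)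
  exact congr($(M.X.homOfLE_ι hle) x).symm

lemma specMap_pullback_fromSpecStalkOfMem (f : Bir M) {e : M.X.PartialIso M.X}
    (he : e.toRationalMap = f.map) :
    Spec.map f.map.pullback ≫
        e.target.fromSpecStalkOfMem _ e.symm.toPartialMap.genericPoint_mem_domain =
      e.source.fromSpecStalkOfMem _ e.toPartialMap.genericPoint_mem_domain ≫ e.iso.hom := by
  rw [← cancel_mono e.target.ι, Category.assoc, Category.assoc]
  refine Eq.trans (congrArg (Spec.map f.map.pullback ≫ ·) (Opens.fromSpecStalkOfMem_ι ..)) ?_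
  refine f.map.specMap_pullback.trans ?_
  rw [← he]
  rfl

lemma pullbackK_pullbackK (f g : Bir M) {e : M.X.PartialIso M.X} (hf : e.toRationalMap = f.map)
    (hg : e.symm.toRationalMap = g.map) (z : M.K) : g.pullbackK (f.pullbackK z) = z := by
  have h : f.map.pullback ≫ g.map.pullback = 𝟙 _ := by
    apply specMap_comp_fromSpecStalk_injective (x := genericPoint M.X)
    rw [Spec.map_comp, Category.assoc, Spec.map_id, Category.id_comp]
    have h₁ := g.specMap_pullback_fromSpecStalkOfMem hg
    have h₂ := f.specMap_pullback_fromSpecStalkOfMem hf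
    have h₃ : M.X.genericMap = e.target.fromSpecStalkOfMem _
      e.symm.toPartialMap.genericPoint_mem_domain ≫ e.target.ι := (Opens.fromSpecStalkOfMem_ι ..).symm
    change Spec.map g.map.pullback ≫ Spec.map f.map.pullback ≫ M.X.genericMap = M.X.genericMap
    rw [h₃, reassoc_of% h₂]
    have h₄ : Spec.map g.map.pullback ≫
        e.source.fromSpecStalkOfMem _ e.toPartialMap.genericPoint_mem_domain =
      e.target.fromSpecStalkOfMem _ e.symm.toPartialMap.genericPoint_mem_domain ≫ e.iso.inv := h₁
    rw [reassoc_of% h₄, e.iso.inv_hom_id_assoc]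
  exact congr($h z)

/-- It suffices to compare at points of codimension at most one. These lie in `e.target`, where the
two maps are mutually inverse on points as well as on functions. -/
lemma IsPullback.eq_of_inverse {f g : Bir M} {e : M.X.PartialIso M.X}
    (hf : e.toRationalMap = f.map) (hg : e.symm.toRationalMap = g.map)
    (hcodim : M.CodimComplGeTwo e.target) {D D' D'' : CartierDivisor M}
    (h : f.IsPullback D D') (h' : g.IsPullback D' D'') : D'' = D := by
  rw [isPullback_iff_germMap] at h h'
  refine CartierDivisor.ext_of_ringKrullDim_le_one fun z hz ↦ ?_
  have hzt : z ∈ e.target := by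
    by_contra hn
    have h₁ : (2 : WithBot ℕ∞) ≤ 1 := (hcodim z hn).trans hz
    exact absurd h₁ (by decide)
  obtain ⟨hzg, hgz⟩ := g.exists_apply_eq hg ⟨z, hzt⟩
  let y : e.source := e.iso.inv ⟨z, hzt⟩
  replace hgz : g.apply ⟨z, hzg⟩ = y.1 := hgz
  obtain ⟨hyf, hfy⟩ := f.exists_apply_eq hf y
  have hey : e.iso.hom y = ⟨z, hzt⟩ := congr($(e.iso.inv_hom_id) (⟨z, hzt⟩ : e.target))
  rw [hey] at hfy
  obtain ⟨d, hd⟩ := exists_isLocalEquation D z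
  have h₁ : D.1 (f.apply ⟨y.1, hyf⟩) = germClass M _ d := by
    rw [hfy]
    exact hd
  have h₂ : D'.1 y.1 = germClass M y.1 (f.pullbackUnits d) :=
    (h ⟨y.1, hyf⟩).trans (congrArg (f.germMap _) h₁)
  have h₃ : D'.1 (g.apply ⟨z, hzg⟩) = germClass M _ (f.pullbackUnits d) := by
    rw [hgz]
    exact h₂
  refine (h' ⟨z, hzg⟩).trans ((congrArg (g.germMap _) h₃).trans ?_)
  rw [germMap_germClass]
  refine Eq.trans ?_ (Eq.symm hd)
  congr 1
  exact Units.ext (pullbackK_pullbackK f g hf hg d)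

variable (f : Bir M)

lemma exists_mulEquiv_isPullback (h : f.IsRegular ∨ (M.IsFactorial ∧ f.IsIsoInCodimOne)) :
    ∃ F : CartierDivisor M ≃* CartierDivisor M, (∀ D, f.IsPullback D (F D)) ∧
      (principal M).range.map F.toMonoidHom = (principal M).range := by
  -- Both hypotheses take one form: a partial isomorphism with small complements that is either
  -- total or lives on a factorial variety. Pull-back along its inverse then inverts pull-back by
  -- `f`.
  obtain ⟨e, he, hf, hs, ht, htop⟩ : ∃ e : M.X.PartialIso M.X, e.IsOver M.str M.str ∧
      e.toRationalMap = f.map ∧ M.CodimComplGeTwo e.source ∧ M.CodimComplGeTwo e.target ∧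
      ((e.source = ⊤ ∧ e.target = ⊤) ∨ M.IsFactorial) := by
    obtain ⟨g, hg, hgf⟩ | ⟨hM, e, he, hf, hs, ht⟩ := h
    · refine ⟨.ofIso g, ?_, ?_, fun x hx ↦ absurd trivial hx, fun x hx ↦ absurd trivial hx,
        .inl ⟨rfl, rfl⟩⟩
      · change (M.X.topIso.hom ≫ g.hom ≫ M.X.topIso.inv) ≫ M.X.topIso.hom ≫ M.str = M.X.topIso.hom ≫ M.str
        simp only [Category.assoc, Iso.inv_hom_id_assoc, hg]
      · have : (PartialIso.ofIso g).toPartialMap = g.hom.toPartialMap := by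
          refine PartialMap.ext _ _ rfl ?_
          change (M.X.topIso.hom ≫ g.hom ≫ M.X.topIso.inv) ≫ M.X.topIso.hom = _
          simp only [Category.assoc, Iso.inv_hom_id, Category.comp_id]
          exact ((congrArg (fun i : (⊤ : M.X.Opens).toScheme ≅ _ ↦ i.hom ≫ M.X.topIso.hom ≫ g.hom)
            (M.X.isoOfEq_rfl ⊤)).trans (Category.id_comp _)).symm
        exact (congrArg PartialMap.toRationalMap this).trans hgf
    · exact ⟨e, he, hf, hs, ht, .inr hM⟩
  let g : Bir M := ⟨e.symm.toRationalMap, e.symm, PartialIso.IsOver.symm he, rfl⟩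
  have hmem : ∀ {U : M.X.Opens} (x : M.X), U = ⊤ → x ∈ U := fun x h ↦ h ▸ trivial
  have hf' : ∀ D, ∃ D', f.IsPullback D D' := f.exists_isPullback (htop.imp_left fun h ↦
    eq_top_iff.2 fun x _ ↦ (f.exists_apply_eq hf ⟨x, hmem x h.1⟩).1)
  have hg' : ∀ D, ∃ D', g.IsPullback D D' := g.exists_isPullback (htop.imp_left fun h ↦
    eq_top_iff.2 fun x _ ↦ (g.exists_apply_eq (e := e.symm) rfl ⟨x, hmem x h.2⟩).1)
  choose F hF using hf'
  choose G hG using hg'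
  let Φ : CartierDivisor M ≃* CartierDivisor M :=
    { toFun := F
      invFun := G
      left_inv D := IsPullback.eq_of_inverse hf rfl ht (hF D) (hG _)
      right_inv D := IsPullback.eq_of_inverse (e := e.symm) rfl hf hs (hG D) (hF _)
      map_mul' D E := (hF _).unique ((hF D).mul (hF E)) }
  refine ⟨Φ, hF, le_antisymm ?_ ?_⟩
  · rintro _ ⟨_, ⟨h, rfl⟩, rfl⟩
    exact ⟨_, (f.isPullback_principal h).unique (hF _)⟩
  · rintro _ ⟨h, rfl⟩
    refine ⟨G (principal M h), ⟨_, (g.isPullback_principal h).unique (hG _)⟩, ?_⟩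
    exact Φ.right_inv _

theorem existsUnique_isPicPullback
    (h : f.IsRegular ∨ (M.IsFactorial ∧ f.IsIsoInCodimOne)) :
    ∃! α : MulAut (Pic M), f.IsPicPullback α := by
  obtain ⟨F, hF, hP⟩ := f.exists_mulEquiv_isPullback h
  refine ⟨QuotientGroup.congr _ _ F hP, fun D ↦ ⟨F D, hF D, rfl⟩, fun α hα ↦ ?_⟩
  refine MulEquiv.ext fun c ↦ ?_
  obtain ⟨D, rfl⟩ := QuotientGroup.mk_surjective c
  obtain ⟨D', hD', h⟩ := hα D
  rw [hD'.unique (hF D)] at h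
  exact h

end PrimBir.Bir

/-! ### Moving divisors, and finite order on the Picard group -/

namespace PrimBir

open Scheme NormalProjVariety

variable {k : Type u} [Field k] {M : NormalProjVariety k}

lemma IsEffective.one : IsEffective (1 : CartierDivisor M) := fun _ _ hd ↦
  ((mem_localUnits M).1 (germClass_eq_one_iff.1 (Eq.symm hd))).1

lemma IsLocalEquation.exists_mul {D E : CartierDivisor M} {x : M.X} {d : M.Kˣ}
    (hd : IsLocalEquation (D * E) x d) :
    ∃ a b : M.Kˣ, IsLocalEquation D x a ∧ IsLocalEquation E x b ∧ d = a * b := by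
  obtain ⟨a, ha⟩ := exists_isLocalEquation D x
  refine ⟨a, a⁻¹ * d, ha, ?_, (mul_inv_cancel_left _ _).symm⟩
  have h₁ : D.1 x * E.1 x = germClass M x d := hd
  have h₂ : D.1 x = germClass M x a := ha
  change E.1 x = germClass M x (a⁻¹ * d)
  rw [map_mul, ← h₁, map_inv, ← h₂, inv_mul_cancel_left]

lemma IsEffective.mul {D E : CartierDivisor M} (hD : IsEffective D) (hE : IsEffective E) :
    IsEffective (D * E) := by
  intro x d hd
  obtain ⟨a, b, ha, hb, rfl⟩ := hd.exists_mul
  exact mul_mem (hD x a ha) (hE x b hb)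

lemma IsEffective.prod {ι : Type*} (t : Finset ι) {D : ι → CartierDivisor M}
    (h : ∀ i ∈ t, IsEffective (D i)) : IsEffective (∏ i ∈ t, D i) :=
  Finset.prod_induction _ _ (fun _ _ ↦ .mul) .one h

lemma globalSections_le_mul {D E : CartierDivisor M} (hE : IsEffective E) :
    globalSections D ≤ globalSections (E * D) := by
  intro s hs x d hd
  obtain ⟨a, b, ha, hb, rfl⟩ := hd.exists_mul
  rw [Units.val_mul, mul_left_comm]
  exact mul_mem (hE x a ha) (hs x b hb)

lemma IsEffective.one_mem_globalSections {D : CartierDivisor M} (hD : IsEffective D) :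
    1 ∈ globalSections D := fun x d hd ↦ by
  rw [one_mul]
  exact hD x d hd

/-- The hyperplane sections of `M` move. -/
lemma exists_isEffective_notMem_range (hM : 0 < M.dim) :
    ∃ H : CartierDivisor M, IsEffective H ∧
      ∃ t ∈ globalSections H, t ∉ (algebraMap k M.K).range := by
  obtain ⟨n, ι, ξ, hι, hξ⟩ := M.exists_coord
  obtain ⟨i, hi⟩ := hξ.1
  choose j hj using exists_mem_chart ι
  have hdiv : ∀ {x : M.X} {l}, x ∈ ι ⁻¹ᵁ chartOpen k n l → ∀ m, ξ m / ξ l ∈ M.localRing x := by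
    intro x l hx m
    obtain ⟨s, hs, -⟩ := div_mem_stalk ι M.kHom hξ hx m
    exact ⟨s, hs⟩
  have h0 : ∀ {x l}, x ∈ ι ⁻¹ᵁ chartOpen k n l → ξ l ≠ 0 := fun hx ↦
    ne_zero_of_mem_chart ι M.kHom hξ hx
  -- `H` is the hyperplane section `ξ i = 0`, whose sections include all ratios `ξ l / ξ i`. If
  -- these were all constant, the chart ring, and with it `M.K`, would be `k`.
  let d : M.X → M.Kˣ := fun x ↦ Units.mk0 (ξ i / ξ (j x)) (div_ne_zero hi (h0 (hj x)))
  let H : CartierDivisor M := ⟨fun x ↦ germClass M x (d x), fun x ↦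
    ⟨ι ⁻¹ᵁ chartOpen k n (j x), hj x, d x, fun y hy ↦ germClass_eq_iff.2 ?_⟩⟩
  · have hH : ∀ l, ξ l / ξ i ∈ globalSections H := by
      intro l x e he
      have hu := ((mem_localUnits M).1 (germClass_eq_iff.1 (show germClass M x (d x) = _ from he))).1
      have : e = d x * ((d x)⁻¹ * e) := (mul_inv_cancel_left _ _).symm
      rw [this, Units.val_mul, ← mul_assoc]
      refine mul_mem ?_ hu
      rw [Units.val_mk0, div_mul_div_cancel₀ hi]
      exact hdiv (hj x) l
    refine ⟨H, fun x e he ↦ ?_, ?_⟩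
    · have := hH i x e he
      rwa [div_self hi, one_mul] at this
    by_contra! hno
    obtain ⟨z, hz⟩ := exists_notMem_range hM
    have hle : Algebra.adjoin k (Set.range fun l ↦ ξ l / ξ i) ≤ ⊥ := by
      rw [Algebra.adjoin_le_iff]
      rintro _ ⟨l, rfl⟩
      exact Algebra.mem_bot.2 (hno _ (hH l))
    obtain ⟨a, ha, b, hb, hb0, hab⟩ := exists_div_adjoin hξ hi z
    obtain ⟨a', rfl⟩ := Algebra.mem_bot.1 (hle ha)
    obtain ⟨b', rfl⟩ := Algebra.mem_bot.1 (hle hb)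
    refine hz ⟨a' / b', ?_⟩
    rw [map_div₀]
    exact ((eq_div_iff hb0).2 hab).symm
  · have hv : ((d y)⁻¹ * d x : M.Kˣ) = Units.mk0 (ξ (j y) / ξ (j x))
        (div_ne_zero (h0 (hj y)) (h0 (hj x))) := by
      apply Units.ext
      have := h0 (hj x)
      have := h0 (hj y)
      simp only [d, Units.val_mul, Units.val_inv_eq_inv_val, Units.val_mk0]
      field_simp
    rw [hv, mem_localUnits]
    refine ⟨hdiv hy _, ?_⟩
    rw [Units.val_inv_eq_inv_val, Units.val_mk0, inv_div]
    exact hdiv (hj y) _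

namespace Bir

variable (f : Bir M)

/-- The pull-back of a section of `D` is a section of `f^* D = D + div g`; multiplication by `g`
brings it back to `D`. Points of codimension one suffice for checking this. -/
lemma mul_pullbackK_mem_globalSections {D D' : CartierDivisor M} (h : f.IsPullback D D')
    {g : M.Kˣ} (hg : D' = D * principal M g) {s : M.K} (hs : s ∈ globalSections D) :
    (g : M.K) * f.pullbackK s ∈ globalSections D := by
  rw [isPullback_iff_germMap] at h
  intro x d hd
  refine M.mem_localRing_of_forall_specializes fun y hy hy1 ↦ ?_
  have hyd := M.mem_domain_of_ringKrullDim_le_one f.map hy1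
  obtain ⟨e, he⟩ := exists_isLocalEquation D (f.apply ⟨y, hyd⟩)
  have he' : D.1 (f.apply ⟨y, hyd⟩) = germClass M _ e := he
  have h₁ : D'.1 y = germClass M y (f.pullbackUnits e) :=
    (h ⟨y, hyd⟩).trans (congrArg (f.germMap _) he')
  have h₂ : D'.1 y = germClass M y (d * g) := by
    rw [hg, map_mul]
    exact congrArg (· * germClass M y g) (hd.of_specializes hy)
  have hu := ((mem_localUnits M).1 (germClass_eq_iff.1 (h₁.symm.trans h₂))).1
  have hgd : d * g = f.pullbackUnits e * ((f.pullbackUnits e)⁻¹ * (d * g)) :=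
    (mul_inv_cancel_left _ _).symm
  have h₃ : (g : M.K) * f.pullbackK s * d =
      f.pullbackK (s * e) * ((f.pullbackUnits e)⁻¹ * (d * g) : M.Kˣ) := by
    calc (g : M.K) * f.pullbackK s * d = f.pullbackK s * (d * g : M.Kˣ) := by
          rw [Units.val_mul]
          ring
      _ = _ := by
          rw [hgd, Units.val_mul, map_mul, val_pullbackUnits, mul_inv_cancel_left, mul_assoc]
  rw [h₃]
  exact mul_mem (f.pullbackK_mem_localRing ⟨y, hyd⟩ (hs _ e he)) hu

theorem exists_map_eq_affine_of_isPicPullback [IsAlgClosed k] (hM : 0 < M.dim)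
    (h : f.IsRegular ∨ (M.IsFactorial ∧ f.IsIsoInCodimOne))
    (α : MulAut (Pic M)) (hα : f.IsPicPullback α) (hfin : IsOfFinOrder α) :
    ∃ x : M.K, x ∉ (algebraMap k M.K).range ∧
      ∃ α β : k, f.pullbackK x = algebraMap k M.K α * x + algebraMap k M.K β := by
  obtain ⟨F, hF, -⟩ := f.exists_mulEquiv_isPullback h
  have hαF : ∀ D : CartierDivisor M, α (D : Pic M) = (F D : Pic M) := fun D ↦ by
    obtain ⟨D', hD', h⟩ := hα D
    rw [h, hD'.unique (hF D)]
  obtain ⟨m, hm, hαm⟩ := isOfFinOrder_iff_pow_eq_one.1 hfin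
  obtain ⟨n, rfl⟩ : ∃ n, m = n + 1 := ⟨m - 1, by omega⟩
  obtain ⟨H, hH, t, ht, htk⟩ := exists_isEffective_notMem_range hM
  have hpow : ∀ i : ℕ, (α ^ i) (H : Pic M) = (((F ^ i : MulAut _) H : CartierDivisor M) : Pic M) := by
    intro i
    induction i with
    | zero => rfl
    | succ i ih =>
      rw [pow_succ', pow_succ', MulAut.mul_apply, MulAut.mul_apply, ih, hαF]
  obtain ⟨g, hg⟩ : ∃ g, principal M g = H⁻¹ * (F ^ (n + 1) : MulAut _) H := by
    have h₁ := hpow (n + 1)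
    rw [hαm] at h₁
    exact QuotientGroup.eq.1 h₁
  -- The sum of the pull-backs of `H` over one period, in multiplicative notation. By telescoping,
  -- `F D` and `D` differ by `F ^ (n + 1) H` against `H`, which is principal.
  let D : CartierDivisor M := ∏ i ∈ Finset.range (n + 1), (F ^ i : MulAut _) H
  have hFD : F D = D * principal M g := by
    have h₁ : F D = ∏ i ∈ Finset.range (n + 1), (F ^ (i + 1) : MulAut _) H := by
      rw [map_prod]
      refine Finset.prod_congr rfl fun i _ ↦ ?_
      rw [pow_succ', MulAut.mul_apply]
    have h₂ : (F ^ 0 : MulAut _) H = H := rfl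
    have h₃ : D * (F ^ (n + 1) : MulAut _) H = F D * H := by
      rw [h₁, ← Finset.prod_range_succ (fun i ↦ (F ^ i : MulAut _) H), Finset.prod_range_succ', h₂]
    rw [hg, mul_left_comm, h₃, mul_comm (F D), inv_mul_cancel_left]
  have heff : ∀ i : ℕ, IsEffective ((F ^ i : MulAut _) H) := by
    intro i
    induction i with
    | zero => exact hH
    | succ i ih =>
      rw [pow_succ', MulAut.mul_apply]
      exact (hF _).isEffective ih
  have htD : t ∈ globalSections D := by
    dsimp only [D]
    rw [Finset.prod_range_succ']
    exact globalSections_le_mul (.prod _ fun i _ ↦ heff _) ht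
  have h1D : 1 ∈ globalSections D := (IsEffective.prod _ fun i _ ↦ heff i).one_mem_globalSections
  have := finiteDimensional_globalSections D
  -- `D` is `H` plus an effective divisor, so `1` and the non-constant `t` are sections of `D`, and
  -- they are linearly independent.
  have hrank : 2 ≤ Module.finrank k (globalSections D) := by
    by_contra! hlt
    obtain ⟨v, hv⟩ := finrank_le_one_iff.1 (Nat.le_of_lt_succ hlt)
    obtain ⟨a, ha⟩ := hv ⟨1, h1D⟩
    obtain ⟨b, hb⟩ := hv ⟨t, htD⟩
    replace ha : algebraMap k M.K a * v = 1 := (Algebra.smul_def _ _).symm.trans congr(($ha).1)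
    replace hb : algebraMap k M.K b * v = t := (Algebra.smul_def _ _).symm.trans congr(($hb).1)
    refine htk ⟨b / a, ?_⟩
    have ha0 : algebraMap k M.K a ≠ 0 := left_ne_zero_of_mul_eq_one ha
    rw [map_div₀, ← hb, div_eq_iff ha0]
    linear_combination -algebraMap k M.K b * ha
  let A : globalSections D →ₗ[k] globalSections D :=
    (LinearMap.mulLeft k (g : M.K) ∘ₗ f.pullbackK.toLinearMap).restrict fun s hs ↦
      f.mul_pullbackK_mem_globalSections (hF D) hFD hs
  have hA : ∀ s, (A s : M.K) = g * f.pullbackK s := fun _ ↦ rfl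
  refine exists_map_eq_affine f.pullbackK (globalSections D) hrank A (fun s s' hss' ↦ ?_)
    fun s s' _ _ ↦ ⟨1, ?_⟩
  · have : (g : M.K) * f.pullbackK s = g * f.pullbackK s' := congr(($hss').1)
    exact Subtype.ext (f.pullbackK.injective (mul_left_cancel₀ g.ne_zero this))
  · rw [hA, hA, map_one]
    ring

end Bir
end PrimBir


/-! ### Conclusion -/

theorem PrimBir.Bir.isImprimitive_of_map_eq_affine {k : Type u} [Field k] [IsAlgClosed k]
    {M : PrimBir.NormalProjVariety k} (f : PrimBir.Bir M) (hM : 2 ≤ M.dim)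
    (h : ∃ x : M.K, x ∉ (algebraMap k M.K).range ∧
      ∃ α β : k, f.pullbackK x = algebraMap k M.K α * x + algebraMap k M.K β) :
    f.IsImprimitive := by
  obtain ⟨x, hx, α, β, h⟩ := h
  refine f.isImprimitive_of_pullbackK_mem_adjoin hM hx ?_
  rw [h]
  exact add_mem (mul_mem (algebraMap_mem _ _) (IntermediateField.mem_adjoin_simple_self _ _))
    (algebraMap_mem _ _)

theorem lemma3p2 {k : Type u} [Field k] [IsAlgClosed k] (M : PrimBir.NormalProjVariety k)
    (f : PrimBir.Bir M) (hM : 2 ≤ M.dim) :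
    (∀ D : PrimBir.CartierDivisor M, PrimBir.LinearSystemDimGeOne D →
      f.ActsOnLinearSystem D → ¬ f.IsPrimitive) ∧
    ((f.IsRegular ∨ (M.IsFactorial ∧ f.IsIsoInCodimOne)) →
      (∃! α : MulAut (PrimBir.Pic M), f.IsPicPullback α) ∧
      ∀ α : MulAut (PrimBir.Pic M), f.IsPicPullback α → IsOfFinOrder α → ¬ f.IsPrimitive) ∧
    (f.HasFiniteOrder → ¬ f.IsPrimitive) := by
  refine ⟨fun D hD hf ↦ not_not.2 ?_, fun h ↦ ⟨f.existsUnique_isPicPullback h,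
    fun α hα hfin ↦ not_not.2 ?_⟩, fun hf ↦ not_not.2 ?_⟩
  · exact f.isImprimitive_of_map_eq_affine hM
      (f.exists_map_eq_affine_of_actsOnLinearSystem D hD hf)
  · exact f.isImprimitive_of_map_eq_affine hM
      (f.exists_map_eq_affine_of_isPicPullback (lt_of_lt_of_le (by norm_num) hM) h α hα hfin)
  · obtain ⟨x, hx, hfx⟩ := f.exists_pullbackK_eq_self
      (lt_of_lt_of_le (by norm_num) hM) hf
    refine f.isImprimitive_of_pullbackK_mem_adjoin hM hx ?_
    rw [hfx]
    exact IntermediateField.mem_adjoin_simple_self _ _
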